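/- All Hilbert spaces are finite-dimensional. For $q>1$ and $qs\ge 1$ and a unit vector $|\psi\rangle\in\mathcal H^{A_1}\otimes\cdots\otimes\mathcal H^{A_n}$ put $$E^{(n)}_{q,s}(|\psi\rangle)=\frac{1}{2(q-1)s}\Big[n-\sum_{j=1}^n\big(\operatorname{Tr}\rho_{A_j}^q\big)^s\Big],$$ where $\rho_{A_j}$ is the reduced state of $|\psi\rangle\langle\psi|$ on $A_j$, and for a mixed state $\rho$ put $E^{(n)}_{q,s}(\rho)=\min\sum_i p_iE^{(n)}_{q,s}(|\psi_i\rangle)$, the minimum running over all pure-state ensembles $\rho=\sum_ip_i|\psi_i\rangle\langle\psi_i|$ (convex roof). *Partitions.* Let $\gamma,\gamma'$ be partitions of $A_1\cdots A_n$ or of subsystems of it. Write $\gamma\succ^a\gamma'$, $\gamma\succ^b\gamma'$, $\gamma\succ^c\gamma'$ if $\gamma'$ is obtained from $\gamma$ by discarding some blocks, by combining some blocks, or by discarding some (not all) of the parties inside some blocks, respectively; $\gamma'$ is coarser than $\gamma$ ($\gamma\succ\gamma'$) if it is obtained by a finite sequence of such steps. For a state $\rho$ of $A_1\cdots A_n$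 and a partition $\gamma$ with $k$ blocks, $E^{(k)}(\gamma)$ is the value of $E^{(k)}$ on the reduced state of $\rho$ on the subsystem partitioned by $\gamma$, each block being regarded as one party. $\Xi(\gamma-\gamma')$ is the set of all partitions $\Gamma$ with at least two blocks such that $\Gamma$ is coarser than $\gamma$; $\Gamma$ is not coarser than $\gamma'$ and $\gamma'$ is not coarser than $\Gamma$ (each partition counts as coarser than itself); and whatever $\Gamma$ contains from different blocks of $\gamma'$ is regarded as one subsystem, i.e. if $\Gamma$ contains parties from at least two blocks of $\gamma'$, then all parties of $\gamma'$ that occur in $\Gamma$ lie in one block of $\Gamma$. For example $\Xi(A|B|C|D-A|BCD)=\{B|C|D,\ B|CD,\ BC|D,\ C|BD,\ B|C,\ C|D,\ B|D\}$. **Theorem.** For all $q>1$ and $s$ with $qs\ge 1$, the family $E^{(n)}=E^{(n)}_{q,s}$ has the following properties. 1. It is a complete global multipartite entanglement monotone, that is: - (entanglement monotone) $E^{(n)}\ge 0$; $E^{(n)}(\rho)=0$ for fully separable $\rho$; $E^{(n)}$ does not increase under $n$-partite LOCC; $E^{(n)}$ is convex; and if $n$-partite LOCC converts $\rho$ into $\rho_j$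 with probability $p_j$, then $\sum_jp_jE^{(n)}(\rho_j)\le E^{(n)}(\rho)$; - (unification condition) $E^{(n)}(\rho\otimes\sigma)\ge E^{(k)}(\rho)+E^{(n-k)}(\sigma)$ whenever $\rho$ is a state of $k$ of the parties and $\sigma$ a state of the other $n-k$ parties, with $E^{(1)}=0$; $E^{(n)}$ is invariant under permutations of the parties; and $E^{(k)}(\gamma)\ge E^{(l)}(\gamma')$ for every state $\rho$ of $A_1\cdots A_n$ whenever $\gamma\succ^a\gamma'$; - (hierarchy condition) $E^{(k)}(\gamma)\ge E^{(l)}(\gamma')$ for every state $\rho$ of $A_1\cdots A_n$ whenever $\gamma\succ^b\gamma'$. 2. It is completely monogamous: if $\gamma\succ^a\gamma'$ and a state $\rho$ of $A_1\cdots A_n$ satisfies $E^{(k)}(\gamma)=E^{(l)}(\gamma')$, then $E^{(*)}(\Gamma)=0$ for all $\Gamma\in\Xi(\gamma-\gamma')$, where $*$ is the number of blocks of $\Gamma$. 3. It is tightly completely monogamous: the same holds with $\succ^b$ in place of $\succ^a$. -/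

import Mathlib

open scoped BigOperators Matrix ComplexOrder

noncomputable section

namespace Multipartite

/-! ### States of a finite multipartite system

The parties form a finite type `κ`; the Hilbert space of party `k` is `ℂ^(X k)`, and the space of the
whole system is `ℂ^(∀ k, X k)`, with the product basis. -/

/-- Density matrices. -/
def IsState {α : Type} [Fintype α] (ρ : Matrix α α ℂ) : Prop :=
  ρ.PosSemidef ∧ ρ.trace = 1

/-- Unit vectors. -/
def IsUnitVector {α : Type} [Fintype α] (ψ : α → ℂ) : Prop :=
  ∑ a, ‖ψ a‖ ^ 2 = 1

/-- The rank-one operator `|ψ⟩⟨ψ|`. -/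
def proj {α : Type} (ψ : α → ℂ) : Matrix α α ℂ :=
  Matrix.vecMulVec ψ (star ψ)

/-- `Tr ρ^q`, the power being taken by the functional calculus of Hermitian matrices. -/
def tracePow {α : Type} [Fintype α] [DecidableEq α] (q : ℝ) (ρ : Matrix α α ℂ) : ℝ :=
  (cfc (fun x : ℝ => x ^ q) ρ).trace.re

section General

variable {κ : Type} [Fintype κ] [DecidableEq κ]
  {X : κ → Type} [∀ k, Fintype (X k)] [∀ k, DecidableEq (X k)]

/-- The reduced state of the single party `k`: the partial trace over all other parties. -/
def marginal (ρ : Matrix (∀ k, X k) (∀ k, X k) ℂ) (k : κ) : Matrix (X k) (X k) ℂ :=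
  fun x y => ∑ a : (∀ k, X k), ∑ b : (∀ k, X k),
    if a k = x ∧ b k = y ∧ ∀ i, i ≠ k → a i = b i then ρ a b else 0

/-- The tensor product `⊗_k M_k` of local matrices. -/
def tensor {Y : κ → Type} (M : ∀ k, Matrix (Y k) (X k) ℂ) :
    Matrix (∀ k, Y k) (∀ k, X k) ℂ :=
  fun x y => ∏ k, M k (x k) (y k)

/-- Fully separable states: finite mixtures of products of local states. -/
def IsFullySeparable (ρ : Matrix (∀ k, X k) (∀ k, X k) ℂ) : Prop :=
  ∃ (m : ℕ) (p : Fin m → ℝ) (σ : Fin m → ∀ k, Matrix (X k) (X k) ℂ),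
    (∀ i, 0 ≤ p i) ∧ ∑ i, p i = 1 ∧ (∀ i k, IsState (σ i k)) ∧
      ρ = ∑ i, (p i : ℂ) • tensor (σ i)

/-- The convex roof of a function `f` of unit vectors: the least average of `f` over all
pure-state ensembles of `ρ`. -/
def convexRoof {α : Type} (f : (α → ℂ) → ℝ) [Fintype α] (ρ : Matrix α α ℂ) : ℝ :=
  sInf {e : ℝ | ∃ (m : ℕ) (p : Fin m → ℝ) (ψ : Fin m → α → ℂ),
    (∀ i, 0 ≤ p i) ∧ ∑ i, p i = 1 ∧ (∀ i, IsUnitVector (ψ i)) ∧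
      ρ = ∑ i, (p i : ℂ) • proj (ψ i) ∧ e = ∑ i, p i * f (ψ i)}

/-- `E_{q,s}` on a pure state: `(1 / (2 (q-1) s)) (n - ∑_j (Tr ρ_{A_j}^q)^s)`. -/
def pureValue (q s : ℝ) (ψ : (∀ k, X k) → ℂ) : ℝ :=
  1 / (2 * (q - 1) * s) *
    ((Fintype.card κ : ℝ) - ∑ k, (tracePow q (marginal (proj ψ) k)) ^ s)

/-- The product `ρ ⊗ σ` of a state of the parties in `S` and a state of the parties outside `S`. -/
def prodState (S : Finset κ)
    (ρ : Matrix (∀ k : {k // k ∈ S}, X k) (∀ k : {k // k ∈ S}, X k) ℂ)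
    (σ : Matrix (∀ k : {k // k ∉ S}, X k) (∀ k : {k // k ∉ S}, X k) ℂ) :
    Matrix (∀ k, X k) (∀ k, X k) ℂ :=
  fun a b => ρ (fun k => a k) (fun k => b k) * σ (fun k => a k) (fun k => b k)

/-- The same state with the parties listed in the order given by `π`. -/
def permute (π : Equiv.Perm κ) (ρ : Matrix (∀ k, X k) (∀ k, X k) ℂ) :
    Matrix (∀ k, X (π k)) (∀ k, X (π k)) ℂ :=
  ρ.submatrix (Equiv.piCongrLeft X π) (Equiv.piCongrLeft X π)

end General

/-- A family of real functions `E^{(n)}`, one for each finite multipartite system. Only the values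
on states matter. -/
def MeasureFamily : Type 1 :=
  ∀ (κ : Type) [Fintype κ] [DecidableEq κ] (X : κ → Type)
    [∀ k, Fintype (X k)] [∀ k, DecidableEq (X k)],
    Matrix (∀ k, X k) (∀ k, X k) ℂ → ℝ

/-- The measures `E_{q,s}^{(n)}`. -/
def unifiedMeasure (q s : ℝ) : MeasureFamily :=
  fun κ _ _ X _ _ ρ => convexRoof (pureValue (κ := κ) (X := X) q s) ρ

/-! ### Operators on `n` parties with local dimensions `d`, and LOCC -/

/-- Operators on `ℂ^{d 0} ⊗ ⋯ ⊗ ℂ^{d (n-1)}`. -/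
abbrev Op {n : ℕ} (d : Fin n → ℕ) : Type :=
  Matrix (∀ k, Fin (d k)) (∀ k, Fin (d k)) ℂ

/-- The value of the `n`-partite member of a family. -/
def MeasureFamily.val (E : MeasureFamily) {n : ℕ} {d : Fin n → ℕ} (ρ : Op d) : ℝ :=
  E (Fin n) (fun k => Fin (d k)) ρ

/-- `n`-partite LOCC protocols, starting from local dimensions `d`, whose final outcomes are
labelled by `J`, the final local dimensions for the label `j` being `e j`. In a round every party
`k` performs a local measurement with Kraus operators `K k i` (a party that does nothing uses
the identity); all outcomes are broadcast and the rest of the protocol depends on them. Different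
branches may end in the same label, which discards the information about the branch. -/
inductive LOCC {n : ℕ} {J : Type} (e : J → Fin n → ℕ) : (Fin n → ℕ) → Type
  | finish (j : J) : LOCC e (e j)
  | round {d : Fin n → ℕ} (r : Fin n → ℕ) (d' : ∀ k, Fin (r k) → ℕ)
      (K : ∀ k (i : Fin (r k)), Matrix (Fin (d' k i)) (Fin (d k)) ℂ)
      (hK : ∀ k, ∑ i, (K k i)ᴴ * K k i = 1)
      (next : ∀ o : (∀ k, Fin (r k)), LOCC e (fun k => d' k (o k))) : LOCC e d

open Classical in
/-- The unnormalized final operator with label `j'`; its trace is the probability of `j'`. -/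
def LOCC.run {n : ℕ} {J : Type} {e : J → Fin n → ℕ} {d : Fin n → ℕ} :
    LOCC e d → Op d → (j' : J) → Op (e j')
  | .finish j, ρ, j' => if h : j = j' then h ▸ ρ else 0
  | .round _ _ K _ next, ρ, j' =>
      ∑ o, (next o).run
        (tensor (fun k => K k (o k)) * ρ * (tensor (fun k => K k (o k)))ᴴ) j'

/-- The probability of the final label `j`. -/
def LOCC.prob {n : ℕ} {J : Type} {e : J → Fin n → ℕ} {d : Fin n → ℕ}
    (Λ : LOCC e d) (ρ : Op d) (j : J) : ℝ :=
  (Λ.run ρ j).trace.re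

/-- The normalized final state with label `j` (irrelevant if the probability is zero). -/
def LOCC.post {n : ℕ} {J : Type} {e : J → Fin n → ℕ} {d : Fin n → ℕ}
    (Λ : LOCC e d) (ρ : Op d) (j : J) : Op (e j) :=
  (((Λ.prob ρ j)⁻¹ : ℝ) : ℂ) • Λ.run ρ j

/-! ### Partitions of subsystems -/

/-- A partition `X₁|X₂|⋯|X_k` of a subsystem of `A₁⋯A_n`. -/
@[ext]
structure SubPartition (n : ℕ) where
  parts : Finset (Finset (Fin n))
  nonempty_of_mem : ∀ P ∈ parts, P.Nonempty
  disjoint : ∀ P ∈ parts, ∀ Q ∈ parts, P ≠ Q → Disjoint P Q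

namespace SubPartition

variable {n : ℕ}

/-- The subsystem that is partitioned. -/
def supp (γ : SubPartition n) : Finset (Fin n) := γ.parts.sup id

/-- `γ ≻ᵃ γ'`: some subsystems of `γ` are discarded. -/
def Discards (γ γ' : SubPartition n) : Prop := γ'.parts ⊆ γ.parts

/-- `γ ≻ᵇ γ'`: some subsystems of `γ` are combined. -/
def Combines (γ γ' : SubPartition n) : Prop :=
  γ'.supp = γ.supp ∧ ∀ P ∈ γ.parts, ∃ Q ∈ γ'.parts, P ⊆ Q

/-- `γ ≻ᶜ γ'`: inside some subsystems of `γ`, some (not all) of the parties are discarded. -/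
def Shrinks (γ γ' : SubPartition n) : Prop :=
  ∃ f : Finset (Fin n) → Finset (Fin n),
    (∀ P ∈ γ.parts, f P ⊆ P) ∧ γ'.parts = γ.parts.image f

/-- `γ ≻ γ'`: `γ'` is coarser than `γ`. -/
def CoarsensTo (γ γ' : SubPartition n) : Prop :=
  Relation.ReflTransGen (fun α β => Discards α β ∨ Combines α β ∨ Shrinks α β) γ γ'

/-- The set `Ξ(γ - γ')`: partitions `Γ` coarser than `γ` that are not coarser than `γ'` and from
which `γ'` cannot be derived by coarsening, and in which whatever is included from different
subsystems of `γ'` is regarded as one subsystem, i.e. lies in one block. If `γ'` arises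
from `γ` by combining `X_l, …, X_k` into one block, the last clause leaves exactly
`X_l|⋯|X_k` and the partitions coarser than it. -/
def Xi (γ γ' : SubPartition n) : Set (SubPartition n) :=
  {Γ | 2 ≤ Γ.parts.card ∧ CoarsensTo γ Γ ∧ ¬ CoarsensTo γ' Γ ∧ ¬ CoarsensTo Γ γ' ∧
    ∀ Y ∈ γ'.parts, ∀ Y' ∈ γ'.parts, Y ≠ Y' →
      ∀ P ∈ Γ.parts, ∀ P' ∈ Γ.parts,
        (P ∩ Y).Nonempty → (P' ∩ Y').Nonempty → P = P'}

/-- The restriction of a basis label to the blocks of `γ`. -/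
def restrict (γ : SubPartition n) {d : Fin n → ℕ} (a : ∀ k, Fin (d k)) :
    ∀ P : {P // P ∈ γ.parts}, ∀ k : {k // k ∈ P.1}, Fin (d k) :=
  fun _ k => a k

/-- The reduced state on the subsystem partitioned by `γ`, every block being one party. -/
def reduce (γ : SubPartition n) {d : Fin n → ℕ} (ρ : Op d) :
    Matrix (∀ P : {P // P ∈ γ.parts}, ∀ k : {k // k ∈ P.1}, Fin (d k))
      (∀ P : {P // P ∈ γ.parts}, ∀ k : {k // k ∈ P.1}, Fin (d k)) ℂ :=
  fun x y => ∑ a : (∀ k, Fin (d k)), ∑ b : (∀ k, Fin (d k)),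
    if γ.restrict a = x ∧ γ.restrict b = y ∧ ∀ k, k ∉ γ.supp → a k = b k then ρ a b else 0

end SubPartition

namespace MeasureFamily

/-- `E^{(k)}(γ)`, where `k` is the number of blocks of `γ`. -/
def on (E : MeasureFamily) {n : ℕ} {d : Fin n → ℕ} (ρ : Op d) (γ : SubPartition n) : ℝ :=
  E {P // P ∈ γ.parts} (fun P => ∀ k : {k // k ∈ P.1}, Fin (d k)) (γ.reduce ρ)

/-! ### Multipartite entanglement measures and monotones -/

/-- Multipartite entanglement measures: nonnegative, zero on fully separable states, and
nonincreasing under `n`-partite LOCC. -/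
structure IsEntanglementMeasure (E : MeasureFamily) : Prop where
  nonneg : ∀ {n : ℕ} {d : Fin n → ℕ} (ρ : Op d), IsState ρ → 0 ≤ E.val ρ
  separable : ∀ {n : ℕ} {d : Fin n → ℕ} (ρ : Op d), IsState ρ → IsFullySeparable ρ → E.val ρ = 0
  locc : ∀ {n : ℕ} {d d' : Fin n → ℕ} (Λ : LOCC (fun _ : Unit => d') d) (ρ : Op d),
    IsState ρ → E.val (Λ.run ρ ()) ≤ E.val ρ

/-- Entanglement monotones: measures that are convex and nonincreasing on average under
`n`-partite stochastic LOCC. -/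
structure IsEntanglementMonotone (E : MeasureFamily) : Prop extends
    IsEntanglementMeasure E where
  convex : ∀ {n : ℕ} {d : Fin n → ℕ} (ρ σ : Op d) (t : ℝ), IsState ρ → IsState σ →
    0 ≤ t → t ≤ 1 →
      E.val ((t : ℂ) • ρ + ((1 - t : ℝ) : ℂ) • σ) ≤ t * E.val ρ + (1 - t) * E.val σ
  average : ∀ {n : ℕ} {d : Fin n → ℕ} {J : Type} [Fintype J] {e : J → Fin n → ℕ}
    (Λ : LOCC e d) (ρ : Op d), IsState ρ →
      ∑ j, Λ.prob ρ j * E.val (Λ.post ρ j) ≤ E.val ρ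

/-- Coarsening monotonicity. -/
def CoarseningMonotone (E : MeasureFamily) : Prop :=
  ∀ {n : ℕ} {d : Fin n → ℕ} (ρ : Op d), IsState ρ → ∀ γ γ' : SubPartition n,
    γ.Discards γ' → E.on ρ γ' ≤ E.on ρ γ

/-- Tight coarsening monotonicity (the hierarchy condition). -/
def TightCoarseningMonotone (E : MeasureFamily) : Prop :=
  ∀ {n : ℕ} {d : Fin n → ℕ} (ρ : Op d), IsState ρ → ∀ γ γ' : SubPartition n,
    γ.Combines γ' → E.on ρ γ' ≤ E.on ρ γ

/-- The unification condition: superadditivity, symmetry, coarsening monotonicity. -/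
structure IsUnified (E : MeasureFamily) : Prop where
  superadditive : ∀ {n : ℕ} {d : Fin n → ℕ} (S : Finset (Fin n))
    (ρ : Matrix (∀ k : {k // k ∈ S}, Fin (d k)) (∀ k : {k // k ∈ S}, Fin (d k)) ℂ)
    (σ : Matrix (∀ k : {k // k ∉ S}, Fin (d k)) (∀ k : {k // k ∉ S}, Fin (d k)) ℂ),
    IsState ρ → IsState σ →
      E {k // k ∈ S} (fun k => Fin (d k)) ρ + E {k // k ∉ S} (fun k => Fin (d k)) σ ≤
        E.val (prodState (X := fun k => Fin (d k)) S ρ σ)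
  trivial_of_single : ∀ {d : Fin 1 → ℕ} (ρ : Op d), IsState ρ → E.val ρ = 0
  symmetric : ∀ {n : ℕ} {d : Fin n → ℕ} (π : Equiv.Perm (Fin n)) (ρ : Op d), IsState ρ →
    E.val (d := fun k => d (π k)) (permute (X := fun k => Fin (d k)) π ρ) = E.val ρ
  coarsening : E.CoarseningMonotone

/-- Complete multipartite entanglement monotones: entanglement monotones that satisfy the
unification condition and the hierarchy condition. -/
structure IsCompleteMonotone (E : MeasureFamily) : Prop where
  monotone : E.IsEntanglementMonotone
  unified : E.IsUnified
  hierarchy : E.TightCoarseningMonotone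

/-- Complete monogamy. -/
def CompletelyMonogamous (E : MeasureFamily) : Prop :=
  E.CoarseningMonotone ∧
  ∀ {n : ℕ} {d : Fin n → ℕ} (ρ : Op d), IsState ρ → ∀ γ γ' : SubPartition n,
    γ.Discards γ' → E.on ρ γ = E.on ρ γ' → ∀ Γ ∈ γ.Xi γ', E.on ρ Γ = 0

/-- Tight complete monogamy. -/
def TightlyCompletelyMonogamous (E : MeasureFamily) : Prop :=
  E.TightCoarseningMonotone ∧
  ∀ {n : ℕ} {d : Fin n → ℕ} (ρ : Op d), IsState ρ → ∀ γ γ' : SubPartition n,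
    γ.Combines γ' → E.on ρ γ = E.on ρ γ' → ∀ Γ ∈ γ.Xi γ', E.on ρ Γ = 0

end MeasureFamily

end Multipartite

end

/-! Put `t = q * s`, so that `t ≥ 1` and `(Tr ρ^q)^s = ‖ρ‖_q^t` with the Schatten norm. Everything
rests on the homogeneous entropy `S(ρ) = Tr ρ · (1 - (‖ρ‖_q / Tr ρ)^t)` of positive operators. Up to
a positive factor, the measure of a pure state is the sum of the entropies of its parties.
Homogeneity lets unnormalized vectors carry the probabilities, so a convex roof becomes an infimum
over decompositions `ρ = ∑ |v i⟩⟨v i|` (`convexRoof_eq_roof`).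

Two properties of `S` do the work. The triangle inequality and the convexity of `x ^ t` give
superadditivity, `S(ρ) + S(σ) ≤ S(ρ + σ)` (`entropy_add_le`), that is, concavity. Together with the
symmetry of `S` across a cut of a pure state it shows that local measurements, hence LOCC, do not
increase the measure on average, and that reading out and forgetting a register lowers the
entropies. Audenaert's inequality `‖ρ_A‖_q + ‖ρ_B‖_q ≤ 1 + ‖ρ_AB‖_q` gives subadditivity, with
equality only if a marginal is pure (`entropy_subadditive`).

Tracing out a register turns a vector into the ensemble of its components along the register. In
each cut the register may be counted on either side, or divided between the two sides
(`sum_labelEntropy_component_split`). For discarded blocks this bounds the new measure by the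
entropies of the remaining blocks. For combined blocks it bounds it by entropies of groups of
blocks, which subadditivity compares with the old measure.

For monogamy, take an optimal ensemble of the state on `γ`; it exists by compactness. If the
measures on `γ` and `γ'` agree, every vector in it satisfies the relevant inequality with equality:
the discarded blocks are pure, or each combined block contains at most one mixed block. The
one-block clause in `Xi` then makes all mixed blocks of that vector meet at most one block of `Γ`.
If every block of `γ` is assigned to a block of `Γ` accordingly, all groups have zero entropy,
because a group and its complement have the same entropy (`roof_coarsen_eq_zero`). -/

set_option linter.unusedSectionVars false

noncomputable section

namespace Multipartite

/-! ### The `ℓ^q` norm of real vectors. -/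

section LpNorm

variable {α : Type} [Fintype α]

/-- The `ℓ^q` norm of a real vector. -/
def lpNorm (q : ℝ) (x : α → ℝ) : ℝ := (∑ i, |x i| ^ q) ^ (1 / q)

theorem lpNorm_nonneg (q : ℝ) (x : α → ℝ) : 0 ≤ lpNorm q x := by
  unfold lpNorm; positivity

theorem lpNorm_add_le {q : ℝ} (hq : 1 ≤ q) (x y : α → ℝ) :
    lpNorm q (x + y) ≤ lpNorm q x + lpNorm q y :=
  Real.Lp_add_le _ _ _ hq

theorem lpNorm_rpow {q : ℝ} (hq : 1 < q) (x : α → ℝ) : lpNorm q x ^ q = ∑ i, |x i| ^ q := by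
  rw [lpNorm, ← Real.rpow_mul (by positivity), one_div_mul_cancel (by linarith), Real.rpow_one]

theorem lpNorm_const_mul {q : ℝ} (hq : 1 < q) {c : ℝ} (hc : 0 ≤ c) (x : α → ℝ) :
    lpNorm q (fun i => c * x i) = c * lpNorm q x := by
  simp only [lpNorm, abs_mul, abs_of_nonneg hc]
  simp only [Real.mul_rpow hc (abs_nonneg _), ← Finset.mul_sum]
  rw [Real.mul_rpow (by positivity) (by positivity), ← Real.rpow_mul hc,
    mul_one_div_cancel (by linarith), Real.rpow_one]

theorem lpNorm_le_sum_abs {q : ℝ} (hq : 1 < q) (x : α → ℝ) : lpNorm q x ≤ ∑ i, |x i| := by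
  set S := ∑ i, |x i| with hS
  have hS0 : 0 ≤ S := Finset.sum_nonneg fun i _ => abs_nonneg _
  have hle : ∑ i, |x i| ^ q ≤ S ^ q := by
    have e : ∀ y : ℝ, 0 ≤ y → y ^ q = y * y ^ (q - 1) := by
      intro y hy
      rcases hy.eq_or_lt with rfl | hy
      · rw [Real.zero_rpow (by linarith), zero_mul]
      · rw [Real.rpow_sub_one hy.ne']; field_simp
    rw [e S hS0]
    calc ∑ i, |x i| ^ q ≤ ∑ i, |x i| * S ^ (q - 1) := by
          refine Finset.sum_le_sum fun i _ => ?_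
          rw [e _ (abs_nonneg _)]
          refine mul_le_mul_of_nonneg_left ?_ (abs_nonneg _)
          exact Real.rpow_le_rpow (abs_nonneg _)
            (Finset.single_le_sum (f := fun i => |x i|) (fun i _ => abs_nonneg _)
              (Finset.mem_univ i)) (by linarith)
      _ = S * S ^ (q - 1) := by rw [← Finset.sum_mul]
  calc lpNorm q x ≤ (S ^ q) ^ (1 / q) :=
        Real.rpow_le_rpow (by positivity) hle (by positivity)
    _ = S := by rw [← Real.rpow_mul hS0, mul_one_div_cancel (by linarith), Real.rpow_one]

theorem abs_le_lpNorm {q : ℝ} (hq : 1 < q) (x : α → ℝ) (i : α) : |x i| ≤ lpNorm q x := by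
  have hq0 : 0 < q := by linarith
  rw [← Real.rpow_le_rpow_iff (abs_nonneg _) (lpNorm_nonneg q x) hq0, lpNorm_rpow hq]
  exact Finset.single_le_sum (f := fun i => |x i| ^ q) (fun i _ => by positivity)
    (Finset.mem_univ i)

end LpNorm

/-! ### Schatten norms through diagonals in orthonormal bases. -/

section SpectralSums

variable {α β : Type} [Fintype α] [DecidableEq α] [Fintype β] [DecidableEq β]

theorem tracePow_eq_sum_eigenvalues (q : ℝ) {ρ : Matrix α α ℂ} (h : ρ.IsHermitian) :
    tracePow q ρ = ∑ i, h.eigenvalues i ^ q := by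
  unfold tracePow
  rw [h.cfc_eq, Matrix.IsHermitian.cfc, Unitary.conjStarAlgAut_apply, Matrix.trace_mul_comm,
    ← mul_assoc]
  simp [Matrix.trace]

theorem tracePow_eq_sum_roots (q : ℝ) {ρ : Matrix α α ℂ} (h : ρ.IsHermitian) :
    tracePow q ρ = (ρ.charpoly.roots.map fun z : ℂ => z.re ^ q).sum := by
  rw [tracePow_eq_sum_eigenvalues q h, h.roots_charpoly_eq_eigenvalues]
  simp [Multiset.map_map]

/-- The two products have the same eigenvalues up to zeros, which shows in their characteristic
polynomials up to powers of `X`; the extra zeros contribute `0 ^ q = 0`. -/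
theorem tracePow_mul_conjTranspose_comm {q : ℝ} (hq : q ≠ 0) (M : Matrix α β ℂ) :
    tracePow q (M * Mᴴ) = tracePow q (Mᴴ * M) := by
  rw [tracePow_eq_sum_roots q (Matrix.isHermitian_mul_conjTranspose_self M),
    tracePow_eq_sum_roots q (Matrix.isHermitian_conjTranspose_mul_self M)]
  have h := congrArg (fun p => (p.roots.map fun z : ℂ => z.re ^ q).sum)
    (Matrix.charpoly_mul_comm' M Mᴴ)
  have hX : ∀ k : ℕ, (Polynomial.X ^ k : Polynomial ℂ) ≠ 0 := fun k =>
    pow_ne_zero _ Polynomial.X_ne_zero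
  simp only [Polynomial.roots_mul (mul_ne_zero (hX _) (Matrix.charpoly_monic _).ne_zero),
    Polynomial.roots_pow, Polynomial.roots_X, Multiset.map_add, Multiset.map_nsmul,
    Multiset.map_singleton, Multiset.sum_add, Multiset.sum_nsmul, Multiset.sum_singleton,
    Complex.zero_re, Real.zero_rpow hq, smul_zero, zero_add] at h
  exact h

theorem tracePow_transpose (q : ℝ) {ρ : Matrix α α ℂ} (h : ρ.IsHermitian) :
    tracePow q ρᵀ = tracePow q ρ := by
  rw [tracePow_eq_sum_roots q h, tracePow_eq_sum_roots q h.transpose, Matrix.charpoly_transpose]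

/-- The diagonal of `ρ` in the orthonormal basis formed by the columns of `U`. -/
def diagIn (U ρ : Matrix α α ℂ) (i : α) : ℝ := ((Uᴴ * ρ * U) i i).re

theorem diagIn_add (U ρ σ : Matrix α α ℂ) : diagIn U (ρ + σ) = diagIn U ρ + diagIn U σ := by
  ext i
  simp [diagIn, mul_add, add_mul]

theorem diagIn_smul (U ρ : Matrix α α ℂ) (c : ℝ) :
    diagIn U ((c : ℂ) • ρ) = fun i => c * diagIn U ρ i := by
  ext i
  simp [diagIn]

theorem diagIn_nonneg {ρ : Matrix α α ℂ} (h : ρ.PosSemidef) (U : Matrix α α ℂ) (i : α) :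
    0 ≤ diagIn U ρ i :=
  (Complex.nonneg_iff.1 ((h.conjTranspose_mul_mul_same U).diag_nonneg (i := i))).1

theorem sum_diagIn {U : Matrix α α ℂ} (hU : U ∈ Matrix.unitaryGroup α ℂ) (ρ : Matrix α α ℂ) :
    ∑ i, diagIn U ρ i = ρ.trace.re := by
  have : U * Uᴴ = 1 := Matrix.mem_unitaryGroup_iff.1 hU
  calc ∑ i, diagIn U ρ i = (Uᴴ * ρ * U).trace.re := by simp [diagIn, Matrix.trace]
    _ = _ := by rw [Matrix.trace_mul_comm, ← mul_assoc, this, one_mul]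

theorem exists_unitary_diag {ρ : Matrix α α ℂ} (h : ρ.IsHermitian) :
    ∃ U ∈ Matrix.unitaryGroup α ℂ,
      Uᴴ * ρ * U = Matrix.diagonal fun i => (h.eigenvalues i : ℂ) := by
  refine ⟨h.eigenvectorUnitary, h.eigenvectorUnitary.2, ?_⟩
  have := h.conjStarAlgAut_star_eigenvectorUnitary
  rw [Unitary.conjStarAlgAut_star_apply] at this
  exact this

theorem sum_norm_sq_row {W : Matrix α α ℂ} (hW : W ∈ Matrix.unitaryGroup α ℂ) (j : α) :
    ∑ i, ‖W j i‖ ^ 2 = 1 := by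
  have h : (W * star W) j j = 1 := by rw [Matrix.mem_unitaryGroup_iff.1 hW]; simp
  simp only [Matrix.mul_apply, Matrix.star_apply, RCLike.star_def, Complex.mul_conj'] at h
  exact_mod_cast h

theorem sum_norm_sq_col {W : Matrix α α ℂ} (hW : W ∈ Matrix.unitaryGroup α ℂ) (i : α) :
    ∑ j, ‖W j i‖ ^ 2 = 1 := by
  have h : (star W * W) i i = 1 := by rw [Matrix.mem_unitaryGroup_iff'.1 hW]; simp
  simp only [Matrix.mul_apply, Matrix.star_apply, RCLike.star_def, Complex.conj_mul'] at h
  exact_mod_cast h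

/-- Schur's inequality: in any orthonormal basis the `q`-th powers of the diagonal sum to at most
`Tr ρ^q`. -/
theorem sum_diagIn_rpow_le {q : ℝ} (hq : 1 ≤ q) {ρ : Matrix α α ℂ} (h : ρ.PosSemidef)
    {U : Matrix α α ℂ} (hU : U ∈ Matrix.unitaryGroup α ℂ) :
    ∑ j, diagIn U ρ j ^ q ≤ tracePow q ρ := by
  obtain ⟨V, hV, hd⟩ := exists_unitary_diag h.1
  have hVV : V * Vᴴ = 1 := Matrix.mem_unitaryGroup_iff.1 hV
  set W := Uᴴ * V with hWdef
  have hW : W ∈ Matrix.unitaryGroup α ℂ := mul_mem (Unitary.star_mem hU) hV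
  -- The diagonal is the image of the spectrum under the doubly stochastic matrix `‖W j i‖ ^ 2`;
  -- Jensen's inequality uses its row sums, the final summation its column sums.
  have key : ∀ j, diagIn U ρ j = ∑ i, ‖W j i‖ ^ 2 * h.1.eigenvalues i := by
    intro j
    have hρ : Uᴴ * ρ * U = W * (Matrix.diagonal fun i => (h.1.eigenvalues i : ℂ)) * Wᴴ := by
      rw [← hd, hWdef, Matrix.conjTranspose_mul, Matrix.conjTranspose_conjTranspose]
      calc Uᴴ * ρ * U = Uᴴ * (V * Vᴴ) * ρ * (V * Vᴴ) * U := by rw [hVV]; simp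
        _ = _ := by simp only [mul_assoc]
    rw [diagIn, hρ, Matrix.mul_apply]
    simp only [Matrix.mul_diagonal, Matrix.conjTranspose_apply, RCLike.star_def, Complex.re_sum]
    refine Finset.sum_congr rfl fun i _ => ?_
    rw [mul_right_comm, Complex.mul_conj', ← Complex.ofReal_pow, ← Complex.ofReal_mul,
      Complex.ofReal_re]
  rw [tracePow_eq_sum_eigenvalues q h.1]
  calc ∑ j, diagIn U ρ j ^ q ≤ ∑ j, ∑ i, ‖W j i‖ ^ 2 * h.1.eigenvalues i ^ q := by
        refine Finset.sum_le_sum fun j _ => ?_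
        rw [key]
        exact Real.rpow_arith_mean_le_arith_mean_rpow _ _ _ (fun i _ => by positivity)
          (sum_norm_sq_row hW j) (fun i _ => h.eigenvalues_nonneg i) hq
    _ = ∑ i, h.1.eigenvalues i ^ q := by
        rw [Finset.sum_comm]
        refine Finset.sum_congr rfl fun i _ => ?_
        rw [← Finset.sum_mul, sum_norm_sq_col hW, one_mul]

theorem tracePow_nonneg (q : ℝ) {ρ : Matrix α α ℂ} (h : ρ.PosSemidef) : 0 ≤ tracePow q ρ := by
  rw [tracePow_eq_sum_eigenvalues q h.1]
  exact Finset.sum_nonneg fun i _ => Real.rpow_nonneg (h.eigenvalues_nonneg i) q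

/-- The Schatten norm `(Tr ρ^q)^(1/q)`. -/
def schatten (q : ℝ) (ρ : Matrix α α ℂ) : ℝ := tracePow q ρ ^ (1 / q)

theorem schatten_nonneg (q : ℝ) {ρ : Matrix α α ℂ} (h : ρ.PosSemidef) : 0 ≤ schatten q ρ :=
  Real.rpow_nonneg (tracePow_nonneg q h) _

/-- With `exists_lpNorm_diagIn_eq` this makes the Schatten norm a maximum of `ℓ^q` norms of
diagonals over all orthonormal bases. Properties of vector norms transfer by evaluating in a basis
that attains the maximum. -/
theorem lpNorm_diagIn_le {q : ℝ} (hq : 1 < q) {ρ : Matrix α α ℂ} (h : ρ.PosSemidef)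
    {U : Matrix α α ℂ} (hU : U ∈ Matrix.unitaryGroup α ℂ) :
    lpNorm q (diagIn U ρ) ≤ schatten q ρ := by
  refine Real.rpow_le_rpow (by positivity) ?_ (by positivity)
  simp only [abs_of_nonneg (diagIn_nonneg h U _)]
  exact sum_diagIn_rpow_le hq.le h hU

theorem exists_lpNorm_diagIn_eq (q : ℝ) {ρ : Matrix α α ℂ} (h : ρ.PosSemidef) :
    ∃ U ∈ Matrix.unitaryGroup α ℂ, lpNorm q (diagIn U ρ) = schatten q ρ := by
  obtain ⟨U, hU, hd⟩ := exists_unitary_diag h.1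
  refine ⟨U, hU, ?_⟩
  simp only [lpNorm, schatten, tracePow_eq_sum_eigenvalues q h.1, diagIn, hd]
  simp [abs_of_nonneg (h.eigenvalues_nonneg _)]

theorem schatten_add_le {q : ℝ} (hq : 1 < q) {ρ σ : Matrix α α ℂ} (hρ : ρ.PosSemidef)
    (hσ : σ.PosSemidef) : schatten q (ρ + σ) ≤ schatten q ρ + schatten q σ := by
  obtain ⟨U, hU, h⟩ := exists_lpNorm_diagIn_eq q (hρ.add hσ)
  rw [← h, diagIn_add]
  exact (lpNorm_add_le hq.le _ _).trans
    (add_le_add (lpNorm_diagIn_le hq hρ hU) (lpNorm_diagIn_le hq hσ hU))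

theorem schatten_smul {q : ℝ} (hq : 1 < q) {ρ : Matrix α α ℂ} (hρ : ρ.PosSemidef) {c : ℝ}
    (hc : 0 ≤ c) : schatten q ((c : ℂ) • ρ) = c * schatten q ρ := by
  have hcρ : ((c : ℂ) • ρ).PosSemidef := hρ.smul (by exact_mod_cast hc)
  apply le_antisymm
  · obtain ⟨U, hU, h⟩ := exists_lpNorm_diagIn_eq q hcρ
    rw [← h, diagIn_smul, lpNorm_const_mul hq hc]
    exact mul_le_mul_of_nonneg_left (lpNorm_diagIn_le hq hρ hU) hc
  · obtain ⟨U, hU, h⟩ := exists_lpNorm_diagIn_eq q hρ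
    rw [← h, ← lpNorm_const_mul hq hc, ← diagIn_smul]
    exact lpNorm_diagIn_le hq hcρ hU

theorem schatten_le_trace {q : ℝ} (hq : 1 < q) {ρ : Matrix α α ℂ} (hρ : ρ.PosSemidef) :
    schatten q ρ ≤ ρ.trace.re := by
  obtain ⟨U, hU, h⟩ := exists_lpNorm_diagIn_eq q hρ
  rw [← h, ← sum_diagIn hU]
  refine (lpNorm_le_sum_abs hq _).trans_eq ?_
  simp only [abs_of_nonneg (diagIn_nonneg hρ U _)]

theorem schatten_mul_conjTranspose_comm {q : ℝ} (hq : 1 < q) (M : Matrix α β ℂ) :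
    schatten q (M * Mᴴ) = schatten q (Mᴴ * M) := by
  rw [schatten, schatten, tracePow_mul_conjTranspose_comm (by linarith)]

theorem trace_re_nonneg {ρ : Matrix α α ℂ} (hρ : ρ.PosSemidef) : 0 ≤ ρ.trace.re :=
  (Complex.nonneg_iff.1 hρ.trace_nonneg).1

theorem abs_diagIn_le {U : Matrix α α ℂ} (hU : U ∈ Matrix.unitaryGroup α ℂ)
    (X : Matrix α α ℂ) (i : α) : |diagIn U X i| ≤ ∑ a, ∑ b, ‖X a b‖ := by
  have hU1 : ∀ a, ‖U a i‖ ≤ 1 := (entry_norm_bound_of_unitary hU · i)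
  refine (Complex.abs_re_le_norm _).trans ?_
  simp only [Matrix.mul_apply, Finset.sum_mul, Matrix.conjTranspose_apply]
  rw [Finset.sum_comm]
  refine (norm_sum_le _ _).trans (Finset.sum_le_sum fun a _ => (norm_sum_le _ _).trans
    (Finset.sum_le_sum fun b _ => ?_))
  rw [norm_mul, norm_mul, norm_star]
  calc ‖U a i‖ * ‖X a b‖ * ‖U b i‖ ≤ 1 * ‖X a b‖ * 1 := by
        gcongr
        exacts [hU1 a, hU1 b]
    _ = ‖X a b‖ := by ring

/-- A crude Lipschitz bound that serves only continuity. The difference need not be positive, so its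
diagonal is bounded entrywise instead of by a Schatten norm. -/
theorem schatten_le_add_dist {q : ℝ} (hq : 1 < q) {ρ σ : Matrix α α ℂ} (hρ : ρ.PosSemidef)
    (hσ : σ.PosSemidef) :
    schatten q ρ ≤ schatten q σ + Fintype.card α * ∑ a, ∑ b, ‖ρ a b - σ a b‖ := by
  obtain ⟨U, hU, h⟩ := exists_lpNorm_diagIn_eq q hρ
  have e : diagIn U ρ = diagIn U σ + diagIn U (ρ - σ) := by
    rw [← diagIn_add, add_sub_cancel]
  rw [← h, e]
  refine (lpNorm_add_le hq.le _ _).trans (add_le_add (lpNorm_diagIn_le hq hσ hU) ?_)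
  refine (lpNorm_le_sum_abs hq _).trans
    ((Finset.sum_le_sum fun i _ => abs_diagIn_le hU (ρ - σ) i).trans_eq ?_)
  simp

/-- The Schatten norm of a continuous family of positive matrices is continuous. -/
theorem continuous_schatten_comp {q : ℝ} (hq : 1 < q) {T : Type*} [TopologicalSpace T]
    {F : T → Matrix α α ℂ} (hF : Continuous F) (hpos : ∀ x, (F x).PosSemidef) :
    Continuous fun x => schatten q (F x) := by
  rw [continuous_iff_continuousAt]
  intro x
  have hF' : ∀ a b, Continuous fun y => F y a b := fun a b => hF.matrix_elem a b
  have h0 : Filter.Tendsto (fun y => Fintype.card α * ∑ a, ∑ b, ‖F y a b - F x a b‖)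
      (nhds x) (nhds 0) := by
    have : Continuous fun y => (Fintype.card α : ℝ) * ∑ a, ∑ b, ‖F y a b - F x a b‖ := by
      fun_prop
    simpa using this.tendsto x
  rw [ContinuousAt, tendsto_iff_dist_tendsto_zero]
  refine squeeze_zero (fun _ => dist_nonneg) (fun y => ?_) h0
  rw [Real.dist_eq, abs_le]
  have h1 := schatten_le_add_dist hq (hpos y) (hpos x)
  have h2 := schatten_le_add_dist hq (hpos x) (hpos y)
  simp only [norm_sub_rev (F x _ _)] at h2
  constructor <;> linarith

end SpectralSums

/-! ### Audenaert's inequality and its strict form. -/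

section Subadditivity

variable {α β : Type} [Fintype α] [Fintype β]

theorem proj_posSemidef (u : α → ℂ) : (proj u).PosSemidef :=
  Matrix.posSemidef_vecMulVec_self_star u

/-- The vector dual to a nonnegative vector with respect to the `ℓ^q` norm. -/
theorem exists_dual_vector {q : ℝ} (hq : 1 < q) {l : α → ℝ} (hl : ∀ i, 0 ≤ l i)
    (hsum : ∑ i, l i = 1) :
    ∃ x : α → ℝ, (∀ i, 0 ≤ x i) ∧ (∀ i, x i ≤ 1) ∧ ∑ i, l i * x i = lpNorm q l ∧
      ∑ i, x i ^ q.conjExponent = 1 ∧ (lpNorm q l < 1 → ∀ i, x i < 1) := by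
  set a := lpNorm q l with ha
  have hle : ∀ i, l i ≤ a := fun i => (le_abs_self _).trans (abs_le_lpNorm hq l i)
  have ha0 : 0 < a := by
    refine (lpNorm_nonneg q l).lt_of_ne' fun h0 => ?_
    have : ∑ i, l i ≤ 0 := Finset.sum_nonpos fun i _ => (hle i).trans h0.le
    linarith
  have hpow : ∑ i, l i ^ q = a ^ q := by
    rw [ha, lpNorm_rpow hq]
    simp only [abs_of_nonneg (hl _)]
  have hdiv0 : ∀ i, 0 ≤ l i / a := fun i => div_nonneg (hl i) ha0.le
  have hdiv1 : ∀ i, l i / a ≤ 1 := fun i => (div_le_one ha0).2 (hle i)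
  have hq1 : 0 < q - 1 := by linarith
  have hsumq : ∑ i, (l i / a) ^ q = 1 := by
    simp only [Real.div_rpow (hl _) ha0.le, ← Finset.sum_div, hpow]
    exact div_self (Real.rpow_pos_of_pos ha0 q).ne'
  -- The vector for which Hölder's inequality against `l` is an equality, normalized in the
  -- conjugate exponent.
  refine ⟨fun i => (l i / a) ^ (q - 1), fun i => Real.rpow_nonneg (hdiv0 i) _,
    fun i => Real.rpow_le_one (hdiv0 i) (hdiv1 i) hq1.le, ?_, ?_, ?_⟩
  · have : ∀ i, l i * (l i / a) ^ (q - 1) = a * (l i / a) ^ q := by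
      intro i
      rcases (hl i).eq_or_lt with h | h
      · rw [← h, zero_div, Real.zero_rpow (by linarith), Real.zero_rpow (by linarith)]
        simp
      · rw [Real.rpow_sub_one (div_pos h ha0).ne']
        field_simp
    simp only [this, ← Finset.mul_sum, hsumq, mul_one]
  · refine Eq.trans (Finset.sum_congr rfl fun i _ => ?_) hsumq
    rw [← Real.rpow_mul (hdiv0 i), Real.conjExponent]
    congr 1
    field_simp
  · intro ha1 i
    refine Real.rpow_lt_one (hdiv0 i) ((div_lt_one ha0).2 ((hle i).lt_of_ne fun h => ?_)) hq1
    classical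
    -- An entry equal to the norm exhausts the sum of `q`-th powers, so `l` is a point mass and its
    -- norm is `1`.
    have h1 : ∑ j ∈ Finset.univ.erase i, l j ^ q = 0 := by
      have := Finset.add_sum_erase Finset.univ (fun j => l j ^ q) (Finset.mem_univ i)
      rw [hpow, ← h] at this
      linarith
    have h2 : ∀ j ∈ Finset.univ.erase i, l j = 0 := by
      intro j hj
      have := (Finset.sum_eq_zero_iff_of_nonneg fun j _ => Real.rpow_nonneg (hl j) q).1 h1 j hj
      exact ((Real.rpow_eq_zero_iff_of_nonneg (hl j)).1 this).1
    have h3 := Finset.add_sum_erase Finset.univ l (Finset.mem_univ i)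
    rw [Finset.sum_eq_zero h2, hsum] at h3
    linarith

/-- Audenaert's inequality for a joint probability distribution and its two marginals. -/
theorem lpNorm_marginals_le {q : ℝ} (hq : 1 < q) {p : α × β → ℝ} (hp : ∀ z, 0 ≤ p z)
    (hsum : ∑ z, p z = 1) :
    lpNorm q (fun i => ∑ j, p (i, j)) + lpNorm q (fun j => ∑ i, p (i, j)) ≤ 1 + lpNorm q p ∧
    (lpNorm q (fun i => ∑ j, p (i, j)) < 1 → lpNorm q (fun j => ∑ i, p (i, j)) < 1 →
      lpNorm q (fun i => ∑ j, p (i, j)) + lpNorm q (fun j => ∑ i, p (i, j)) <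
        1 + lpNorm q p) := by
  obtain ⟨x, hx0, hx1, hxs, hxq, hxlt⟩ := exists_dual_vector hq (l := fun i => ∑ j, p (i, j))
    (fun i => Finset.sum_nonneg fun j _ => hp _) (by rw [← hsum, Fintype.sum_prod_type])
  obtain ⟨y, hy0, hy1, hys, hyq, hylt⟩ := exists_dual_vector hq (l := fun j => ∑ i, p (i, j))
    (fun i => Finset.sum_nonneg fun j _ => hp _) (by rw [← hsum, Fintype.sum_prod_type_right])
  set a := lpNorm q (fun i => ∑ j, p (i, j))
  set b := lpNorm q (fun j => ∑ i, p (i, j))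
  have hxs' : ∑ z, p z * x z.1 = a := by
    rw [← hxs, Fintype.sum_prod_type]
    simp only [Finset.sum_mul]
  have hys' : ∑ z, p z * y z.2 = b := by
    rw [← hys, Fintype.sum_prod_type_right]
    simp only [Finset.sum_mul]
  -- The defect in the inequality is the mean of `(1 - x) * (1 - y)` under `p`. The mean of `x * y`
  -- is at most the norm of `p` by Hölder, since the product vector has norm `1` in the conjugate
  -- exponent.
  have hsplit : a + b + ∑ z, p z * ((1 - x z.1) * (1 - y z.2)) =
      1 + ∑ z, p z * (x z.1 * y z.2) := by
    conv_rhs => rw [← hsum]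
    rw [← hxs', ← hys', ← Finset.sum_add_distrib, ← Finset.sum_add_distrib,
      ← Finset.sum_add_distrib]
    exact Finset.sum_congr rfl fun z _ => by ring
  have hholder : ∑ z, p z * (x z.1 * y z.2) ≤ lpNorm q p := by
    refine (Real.inner_le_Lp_mul_Lq_of_nonneg Finset.univ (Real.HolderConjugate.conjExponent hq)
      (fun z _ => hp z) (fun z _ => mul_nonneg (hx0 z.1) (hy0 z.2))).trans_eq ?_
    have : ∑ z : α × β, (x z.1 * y z.2) ^ q.conjExponent = 1 := by
      rw [Fintype.sum_prod_type]
      simp only [Real.mul_rpow (hx0 _) (hy0 _), ← Finset.mul_sum, hyq, mul_one, hxq]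
    rw [this, Real.one_rpow, mul_one, lpNorm]
    simp only [abs_of_nonneg (hp _)]
  have hterm : ∀ z, 0 ≤ p z * ((1 - x z.1) * (1 - y z.2)) := fun z =>
    mul_nonneg (hp z) (mul_nonneg (sub_nonneg.2 (hx1 _)) (sub_nonneg.2 (hy1 _)))
  refine ⟨by linarith [Finset.sum_nonneg fun z (_ : z ∈ Finset.univ) => hterm z], ?_⟩
  intro ha hb
  have : 0 < ∑ z, p z * ((1 - x z.1) * (1 - y z.2)) := by
    obtain ⟨z, -, hz⟩ : ∃ z ∈ (Finset.univ : Finset (α × β)), 0 < p z := by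
      by_contra! h
      linarith [Finset.sum_nonpos h]
    exact Finset.sum_pos' (fun z _ => hterm z) ⟨z, Finset.mem_univ z,
      mul_pos hz (mul_pos (sub_pos.2 (hxlt ha _)) (sub_pos.2 (hylt hb _)))⟩
  linarith

/-- The points `a` and `b` are mirror-image convex combinations of `1` and `d = a + b - 1`, with
weights `w, 1 - w` and `1 - w, w`; adding the two convexity inequalities makes the weights
disappear. -/
theorem rpow_add_rpow_le {t a b : ℝ} (ht : 1 ≤ t) (ha1 : a ≤ 1) (hb1 : b ≤ 1)
    (hab : 1 ≤ a + b) : a ^ t + b ^ t ≤ 1 + (a + b - 1) ^ t := by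
  set d := a + b - 1 with hd
  rcases eq_or_ne d 1 with h1 | h1
  · have : a = 1 := by linarith
    have : b = 1 := by linarith
    simp [*]
  have hd1 : 0 < 1 - d := sub_pos.2 (lt_of_le_of_ne (by linarith) h1)
  set w := (a - d) / (1 - d) with hw
  have hw0 : 0 ≤ w := div_nonneg (by linarith) hd1.le
  have hw1 : w ≤ 1 := (div_le_one hd1).2 (by linarith)
  have hwm : w * (1 - d) = a - d := div_mul_cancel₀ _ hd1.ne'
  have hc := (convexOn_rpow ht).2
  have h2 := hc (x := 1) (y := d) (Set.mem_Ici.2 zero_le_one) (Set.mem_Ici.2 (by linarith)) hw0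
    (sub_nonneg.2 hw1) (by ring)
  have h3 := hc (x := d) (y := 1) (Set.mem_Ici.2 (by linarith)) (Set.mem_Ici.2 zero_le_one) hw0
    (sub_nonneg.2 hw1) (by ring)
  simp only [smul_eq_mul, Real.one_rpow, mul_one] at h2 h3
  rw [show w + (1 - w) * d = a by linarith] at h2
  rw [show w * d + (1 - w) = b by linarith] at h3
  linarith

theorem rpow_add_rpow_le_one_add {t a b c : ℝ} (ht : 1 ≤ t) (ha0 : 0 ≤ a) (hb0 : 0 ≤ b)
    (hc0 : 0 ≤ c) (ha1 : a ≤ 1) (hb1 : b ≤ 1) (h : a + b ≤ 1 + c) : a ^ t + b ^ t ≤ 1 + c ^ t := by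
  have hle : ∀ x : ℝ, 0 ≤ x → x ≤ 1 → x ^ t ≤ x := fun x h0 h1 => by
    simpa using Real.rpow_le_rpow_of_exponent_ge' h0 h1 zero_le_one ht
  rcases le_total 1 (a + b) with h1 | h1
  · linarith [rpow_add_rpow_le ht ha1 hb1 h1,
      Real.rpow_le_rpow (by linarith : 0 ≤ a + b - 1) (by linarith : a + b - 1 ≤ c)
        (by linarith : (0 : ℝ) ≤ t)]
  · linarith [hle a ha0 ha1, hle b hb0 hb1, Real.rpow_nonneg hc0 t]

/-- The weak inequality already holds with `max 0 (a + b - 1)` in place of `c`, and this is strictly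
below `c`. -/
theorem rpow_add_rpow_lt_one_add {t a b c : ℝ} (ht : 1 ≤ t) (ha0 : 0 ≤ a) (hb0 : 0 ≤ b)
    (hc0 : 0 < c) (ha1 : a ≤ 1) (hb1 : b ≤ 1) (h : a + b < 1 + c) : a ^ t + b ^ t < 1 + c ^ t := by
  have hm : 0 ≤ max 0 (a + b - 1) := le_max_left _ _
  have := rpow_add_rpow_le_one_add ht ha0 hb0 hm ha1 hb1
    (by linarith [le_max_right 0 (a + b - 1)])
  linarith [Real.rpow_lt_rpow hm (max_lt hc0 (by linarith)) (by linarith : 0 < t)]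

variable [DecidableEq α] [DecidableEq β]

/-- The first marginal of an operator on a tensor product of two spaces. -/
def margFst (ρ : Matrix (α × β) (α × β) ℂ) : Matrix α α ℂ :=
  fun a a' => ∑ b, ρ (a, b) (a', b)

/-- The second marginal of an operator on a tensor product of two spaces. -/
def margSnd (ρ : Matrix (α × β) (α × β) ℂ) : Matrix β β ℂ :=
  fun b b' => ∑ a, ρ (a, b) (a, b')

open scoped Kronecker in
theorem kronecker_mem_unitary {U : Matrix α α ℂ} {V : Matrix β β ℂ}
    (hU : U ∈ Matrix.unitaryGroup α ℂ) (hV : V ∈ Matrix.unitaryGroup β ℂ) :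
    U ⊗ₖ V ∈ Matrix.unitaryGroup (α × β) ℂ :=
  Matrix.kronecker_mem_unitary hU hV

open scoped Kronecker in
-- In a product basis the diagonal of `ρ` is a joint distribution whose marginals are the diagonals
-- of the reduced operators; this reduces the quantum inequality to the classical one.
theorem sum_diagIn_kronecker_right {U : Matrix α α ℂ} {V : Matrix β β ℂ}
    (hV : V ∈ Matrix.unitaryGroup β ℂ) (ρ : Matrix (α × β) (α × β) ℂ) (i : α) :
    ∑ j, diagIn (U ⊗ₖ V) ρ (i, j) = diagIn U (margFst ρ) i := by
  have hVV : ∀ b b', ∑ j, V b' j * star (V b j) = if b' = b then 1 else 0 := fun b b' => by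
    have := congrFun (congrFun (Matrix.mem_unitaryGroup_iff.1 hV) b') b
    simpa [Matrix.mul_apply, Matrix.one_apply] using this
  simp only [diagIn, ← Complex.re_sum]
  congr 1
  calc ∑ j, ((U ⊗ₖ V)ᴴ * ρ * (U ⊗ₖ V)) (i, j) (i, j)
      = ∑ j, ∑ a', ∑ b', ∑ a, ∑ b, star (U a i) * ρ (a, b) (a', b') * U a' i *
          (V b' j * star (V b j)) := by
        simp only [Matrix.mul_apply, Fintype.sum_prod_type, Matrix.conjTranspose_apply,
          Matrix.kronecker_apply, Finset.sum_mul, star_mul']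
        refine Finset.sum_congr rfl fun j _ => Finset.sum_congr rfl fun a' _ =>
          Finset.sum_congr rfl fun b' _ => Finset.sum_congr rfl fun a _ =>
          Finset.sum_congr rfl fun b _ => by ring
    _ = ∑ a', ∑ b', ∑ a, ∑ b, star (U a i) * ρ (a, b) (a', b') * U a' i *
          (∑ j, V b' j * star (V b j)) := by
        rw [Finset.sum_comm]
        refine Finset.sum_congr rfl fun a' _ => ?_
        rw [Finset.sum_comm]
        refine Finset.sum_congr rfl fun b' _ => ?_
        rw [Finset.sum_comm]
        refine Finset.sum_congr rfl fun a _ => ?_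
        rw [Finset.sum_comm]
        exact Finset.sum_congr rfl fun b _ => by rw [Finset.mul_sum]
    _ = ∑ a', ∑ b', ∑ a, star (U a i) * ρ (a, b') (a', b') * U a' i := by
        simp only [hVV, mul_ite, mul_one, mul_zero, Finset.sum_ite_eq, Finset.mem_univ, if_true]
    _ = (Uᴴ * margFst ρ * U) i i := by
        simp only [Matrix.mul_apply, margFst, Finset.mul_sum, Finset.sum_mul,
          Matrix.conjTranspose_apply]
        refine Finset.sum_congr rfl fun a' _ => ?_
        rw [Finset.sum_comm]

open scoped Kronecker in
theorem sum_diagIn_kronecker_left {U : Matrix α α ℂ} {V : Matrix β β ℂ}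
    (hU : U ∈ Matrix.unitaryGroup α ℂ) (ρ : Matrix (α × β) (α × β) ℂ) (j : β) :
    ∑ i, diagIn (U ⊗ₖ V) ρ (i, j) = diagIn V (margSnd ρ) j := by
  have h := sum_diagIn_kronecker_right (U := V) hU (ρ.submatrix Prod.swap Prod.swap) j
  rw [show margFst (ρ.submatrix Prod.swap Prod.swap) = margSnd ρ from rfl] at h
  rw [← h]
  refine Finset.sum_congr rfl fun i _ => ?_
  simp only [diagIn, Matrix.mul_apply, Matrix.conjTranspose_apply, Matrix.kronecker_apply,
    Fintype.sum_prod_type, Finset.sum_mul, Matrix.submatrix_apply, Prod.swap_prod_mk]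
  congr 1
  rw [Finset.sum_comm]
  refine Finset.sum_congr rfl fun b _ => Finset.sum_congr rfl fun a _ => ?_
  rw [Finset.sum_comm]
  refine Finset.sum_congr rfl fun b' _ => Finset.sum_congr rfl fun a' _ => ?_
  rw [mul_comm (U a' i) (V b' j), mul_comm (U a i) (V b j)]

theorem margFst_posSemidef {ρ : Matrix (α × β) (α × β) ℂ} (h : ρ.PosSemidef) :
    (margFst ρ).PosSemidef := by
  have : margFst ρ = ∑ b, ρ.submatrix (fun a => (a, b)) (fun a => (a, b)) := by
    ext a a'
    simp [margFst, Matrix.sum_apply]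
  rw [this]
  exact Matrix.posSemidef_sum _ fun b _ => h.submatrix _

theorem margSnd_posSemidef {ρ : Matrix (α × β) (α × β) ℂ} (h : ρ.PosSemidef) :
    (margSnd ρ).PosSemidef :=
  margFst_posSemidef (h.submatrix Prod.swap)

theorem trace_margFst (ρ : Matrix (α × β) (α × β) ℂ) : (margFst ρ).trace = ρ.trace := by
  simp [margFst, Matrix.trace, Fintype.sum_prod_type]

theorem trace_margSnd (ρ : Matrix (α × β) (α × β) ℂ) : (margSnd ρ).trace = ρ.trace := by
  simp [margSnd, Matrix.trace, Fintype.sum_prod_type_right]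

/-- Subadditivity of Schatten norms, with strictness when neither marginal is pure. -/
theorem schatten_marg_le {q : ℝ} (hq : 1 < q) {ρ : Matrix (α × β) (α × β) ℂ} (h : ρ.PosSemidef)
    (htr : ρ.trace.re = 1) :
    schatten q (margFst ρ) + schatten q (margSnd ρ) ≤ 1 + schatten q ρ ∧
    (schatten q (margFst ρ) < 1 → schatten q (margSnd ρ) < 1 →
      schatten q (margFst ρ) + schatten q (margSnd ρ) < 1 + schatten q ρ) := by
  -- Bases adapted to the two marginals make their norms exact, while passing to the diagonal only
  -- lowers the norm of `ρ`, which is on the larger side.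
  obtain ⟨U, hU, hUe⟩ := exists_lpNorm_diagIn_eq q (margFst_posSemidef h)
  obtain ⟨V, hV, hVe⟩ := exists_lpNorm_diagIn_eq q (margSnd_posSemidef h)
  have hW := kronecker_mem_unitary hU hV
  have := lpNorm_marginals_le hq (diagIn_nonneg h (Matrix.kronecker U V))
    ((sum_diagIn hW ρ).trans htr)
  have e1 : (fun i => ∑ j, diagIn (Matrix.kronecker U V) ρ (i, j)) = diagIn U (margFst ρ) :=
    funext fun i => sum_diagIn_kronecker_right hV ρ i
  have e2 : (fun j => ∑ i, diagIn (Matrix.kronecker U V) ρ (i, j)) = diagIn V (margSnd ρ) :=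
    funext fun j => sum_diagIn_kronecker_left hU ρ j
  rw [e1, e2, hUe, hVe] at this
  have hle := lpNorm_diagIn_le hq h hW
  exact ⟨this.1.trans (by gcongr; exact hle),
    fun ha hb => (this.2 ha hb).trans_le (by gcongr; exact hle)⟩

end Subadditivity

/-! ### The homogeneous entropy: superadditivity and subadditivity. -/

section Entropy

variable {α β : Type} [Fintype α] [DecidableEq α] [Fintype β] [DecidableEq β]

/-- The homogeneous extension of `ρ ↦ 1 - (Tr ρ^q)^(t/q)` to positive operators. -/
def entropy (q t : ℝ) (ρ : Matrix α α ℂ) : ℝ :=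
  ρ.trace.re * (1 - (schatten q ρ / ρ.trace.re) ^ t)

theorem schatten_div_trace_nonneg (q : ℝ) {ρ : Matrix α α ℂ} (h : ρ.PosSemidef) :
    0 ≤ schatten q ρ / ρ.trace.re :=
  div_nonneg (schatten_nonneg q h) (trace_re_nonneg h)

theorem schatten_div_trace_le_one {q : ℝ} (hq : 1 < q) {ρ : Matrix α α ℂ} (h : ρ.PosSemidef) :
    schatten q ρ / ρ.trace.re ≤ 1 :=
  div_le_one_of_le₀ (schatten_le_trace hq h) (trace_re_nonneg h)

theorem entropy_nonneg {q t : ℝ} (hq : 1 < q) (ht : 1 ≤ t) {ρ : Matrix α α ℂ}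
    (h : ρ.PosSemidef) : 0 ≤ entropy q t ρ :=
  mul_nonneg (trace_re_nonneg h) (sub_nonneg.2 (Real.rpow_le_one (schatten_div_trace_nonneg q h)
    (schatten_div_trace_le_one hq h) (by linarith)))

@[simp]
theorem entropy_zero (q t : ℝ) : entropy q t (0 : Matrix α α ℂ) = 0 := by
  simp [entropy]

theorem entropy_smul {q : ℝ} (hq : 1 < q) (t : ℝ) {ρ : Matrix α α ℂ} (h : ρ.PosSemidef) {c : ℝ}
    (hc : 0 ≤ c) : entropy q t ((c : ℂ) • ρ) = c * entropy q t ρ := by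
  rcases hc.eq_or_lt with rfl | hc'
  · simp
  have : ((c : ℂ) • ρ).trace.re = c * ρ.trace.re := by simp [Matrix.trace_smul]
  rw [entropy, entropy, schatten_smul hq h hc, this, mul_div_mul_left _ _ hc'.ne', mul_assoc]

theorem entropy_mul_conjTranspose_comm {q : ℝ} (hq : 1 < q) (t : ℝ) (M : Matrix α β ℂ) :
    entropy q t (M * Mᴴ) = entropy q t (Mᴴ * M) := by
  rw [entropy, entropy, schatten_mul_conjTranspose_comm hq, Matrix.trace_mul_comm]

theorem entropy_transpose (q t : ℝ) {ρ : Matrix α α ℂ} (h : ρ.IsHermitian) :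
    entropy q t ρᵀ = entropy q t ρ := by
  rw [entropy, entropy, schatten, schatten, tracePow_transpose q h, Matrix.trace_transpose]

/-- The normalized norm of a sum is at most the trace-weighted mean of the normalized norms, and `x
^ t` is increasing and convex. By homogeneity this is concavity of the entropy on states. -/
theorem entropy_add_le {q t : ℝ} (hq : 1 < q) (ht : 1 ≤ t) {ρ σ : Matrix α α ℂ}
    (hρ : ρ.PosSemidef) (hσ : σ.PosSemidef) :
    entropy q t ρ + entropy q t σ ≤ entropy q t (ρ + σ) := by
  have htr : (ρ + σ).trace.re = ρ.trace.re + σ.trace.re := by simp [Matrix.trace_add]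
  have ha := trace_re_nonneg hρ
  have hb := trace_re_nonneg hσ
  have hx := schatten_div_trace_nonneg q hρ
  have hy := schatten_div_trace_nonneg q hσ
  -- At trace zero the quotient is `0` by convention, but then the norm vanishes as well, being at
  -- most the trace.
  have hN : schatten q (ρ + σ) ≤ ρ.trace.re * (schatten q ρ / ρ.trace.re) +
      σ.trace.re * (schatten q σ / σ.trace.re) := by
    have e : ∀ τ : Matrix α α ℂ, τ.PosSemidef →
        schatten q τ ≤ τ.trace.re * (schatten q τ / τ.trace.re) := by
      intro τ hτ
      rcases eq_or_ne τ.trace.re 0 with h0 | h0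
      · rw [h0, zero_mul]
        exact (schatten_le_trace hq hτ).trans h0.le
      · rw [mul_div_cancel₀ _ h0]
    exact (schatten_add_le hq hρ hσ).trans (add_le_add (e ρ hρ) (e σ hσ))
  have h0 := schatten_nonneg q (hρ.add hσ)
  unfold entropy
  rw [htr]
  set a := ρ.trace.re
  set b := σ.trace.re
  set x := schatten q ρ / a
  set y := schatten q σ / b
  rcases (add_nonneg ha hb).eq_or_lt with hs | hs
  · have : a = 0 := by linarith
    have : b = 0 := by linarith
    simp only [‹a = 0›, ‹b = 0›, zero_mul, add_zero, le_refl]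
  have hconv := (convexOn_rpow ht).2 (Set.mem_Ici.2 hx) (Set.mem_Ici.2 hy)
    (div_nonneg ha hs.le) (div_nonneg hb hs.le) (by field_simp)
  simp only [smul_eq_mul] at hconv
  have hle : (schatten q (ρ + σ) / (a + b)) ^ t ≤ a / (a + b) * x ^ t + b / (a + b) * y ^ t := by
    refine le_trans (Real.rpow_le_rpow (div_nonneg h0 hs.le) ?_ (by linarith)) hconv
    rw [div_le_iff₀ hs]
    refine hN.trans_eq ?_
    field_simp
  have := mul_le_mul_of_nonneg_left hle hs.le
  have e : (a + b) * (a / (a + b) * x ^ t + b / (a + b) * y ^ t) = a * x ^ t + b * y ^ t := by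
    field_simp
  rw [e] at this
  linarith

theorem sum_entropy_le {q t : ℝ} (hq : 1 < q) (ht : 1 ≤ t) {ι : Type*} (s : Finset ι)
    {ρ : ι → Matrix α α ℂ} (h : ∀ i, (ρ i).PosSemidef) :
    ∑ i ∈ s, entropy q t (ρ i) ≤ entropy q t (∑ i ∈ s, ρ i) := by
  classical
  induction s using Finset.induction_on with
  | empty => simp
  | insert i s hi ih =>
    rw [Finset.sum_insert hi, Finset.sum_insert hi]
    exact (add_le_add_right ih _).trans
      (entropy_add_le hq ht (h i) (Matrix.posSemidef_sum _ fun i _ => h i))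

theorem schatten_of_unique {q : ℝ} (hq : 1 < q) [Unique α] {ρ : Matrix α α ℂ}
    (h : ρ.PosSemidef) : schatten q ρ = ρ.trace.re := by
  rw [schatten, tracePow_eq_sum_eigenvalues q h.1, h.1.trace_eq_sum_eigenvalues]
  simp only [Fintype.sum_unique]
  rw [← Real.rpow_mul (h.eigenvalues_nonneg _), mul_one_div_cancel (by linarith), Real.rpow_one]
  simp

theorem entropy_of_unique {q : ℝ} (hq : 1 < q) (t : ℝ) [Unique α] {ρ : Matrix α α ℂ}
    (h : ρ.PosSemidef) : entropy q t ρ = 0 := by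
  rw [entropy, schatten_of_unique hq h]
  rcases eq_or_ne ρ.trace.re 0 with h0 | h0
  · simp [h0]
  · simp [div_self h0]

/-- Pure states have zero entropy. -/
theorem entropy_proj {q : ℝ} (hq : 1 < q) (t : ℝ) (u : α → ℂ) : entropy q t (proj u) = 0 := by
  have : proj u = Matrix.replicateCol Unit u * (Matrix.replicateCol Unit u)ᴴ := by
    rw [proj, Matrix.vecMulVec_eq Unit, Matrix.conjTranspose_replicateCol]
  rw [this, entropy_mul_conjTranspose_comm hq]
  exact entropy_of_unique hq t (Matrix.posSemidef_conjTranspose_mul_self _)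

/-- After scaling to trace one this is Audenaert's inequality raised to the power `t`. In the
equality case some marginal has norm equal to its trace, so its entropy is zero. -/
theorem entropy_subadditive {q t : ℝ} (hq : 1 < q) (ht : 1 ≤ t)
    {ρ : Matrix (α × β) (α × β) ℂ} (h : ρ.PosSemidef) :
    entropy q t ρ ≤ entropy q t (margFst ρ) + entropy q t (margSnd ρ) ∧
    (entropy q t ρ = entropy q t (margFst ρ) + entropy q t (margSnd ρ) →
      entropy q t (margFst ρ) = 0 ∨ entropy q t (margSnd ρ) = 0) := by
  have hA := margFst_posSemidef h
  have hB := margSnd_posSemidef h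
  rcases (trace_re_nonneg h).eq_or_lt with h0 | hpos
  · simp [entropy, trace_margFst, trace_margSnd, ← h0]
  have ha0 := schatten_div_trace_nonneg q hA
  have ha1 := schatten_div_trace_le_one hq hA
  have hb0 := schatten_div_trace_nonneg q hB
  have hb1 := schatten_div_trace_le_one hq hB
  have hc0 := schatten_div_trace_nonneg q h
  have htpos : 0 < t := by linarith
  simp only [trace_margFst, trace_margSnd] at ha0 ha1 hb0 hb1
  unfold entropy
  simp only [trace_margFst, trace_margSnd]
  set τ := ρ.trace.re with hτ
  have hi : 0 ≤ τ⁻¹ := (inv_pos.2 hpos).le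
  have hs := schatten_marg_le hq (ρ := ((τ⁻¹ : ℝ) : ℂ) • ρ)
    (h.smul (by exact_mod_cast hi)) (by
      simp [Matrix.trace_smul, ← hτ, inv_mul_cancel₀ hpos.ne'])
  have e1 : margFst (((τ⁻¹ : ℝ) : ℂ) • ρ) = ((τ⁻¹ : ℝ) : ℂ) • margFst ρ := by
    ext; simp [margFst, Finset.mul_sum]
  have e2 : margSnd (((τ⁻¹ : ℝ) : ℂ) • ρ) = ((τ⁻¹ : ℝ) : ℂ) • margSnd ρ := by
    ext; simp [margSnd, Finset.mul_sum]
  rw [e1, e2, schatten_smul hq hA hi, schatten_smul hq hB hi, schatten_smul hq h hi] at hs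
  simp only [inv_mul_eq_div] at hs
  -- Strictness of the power inequality needs a positive norm; a vanishing norm would force the
  -- trace to vanish.
  have hcpos : 0 < schatten q ρ / τ := by
    refine hc0.lt_of_ne' fun hc => ?_
    obtain ⟨U, hU, hUe⟩ := exists_lpNorm_diagIn_eq q h
    have h1 : schatten q ρ = 0 := (div_eq_zero_iff.1 hc).resolve_right hpos.ne'
    have h2 : ∑ i, diagIn U ρ i ≤ 0 := Finset.sum_nonpos fun i _ =>
      (le_abs_self _).trans ((abs_le_lpNorm hq _ i).trans (hUe.trans h1).le)
    rw [sum_diagIn hU] at h2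
    linarith
  set a := schatten q (margFst ρ) / τ
  set b := schatten q (margSnd ρ) / τ
  set c := schatten q ρ / τ
  constructor
  · have := mul_le_mul_of_nonneg_left
      (rpow_add_rpow_le_one_add ht ha0 hb0 hc0 ha1 hb1 hs.1) hpos.le
    linarith
  · intro heq
    rcases ha1.eq_or_lt with ha | ha
    · left; simp [ha]
    rcases hb1.eq_or_lt with hb | hb
    · right; simp [hb]
    have := mul_lt_mul_of_pos_left
      (rpow_add_rpow_lt_one_add ht ha0 hb0 hcpos ha1 hb1 (hs.2 ha hb)) hpos
    linarith

end Entropy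

/-! ### Reduced states of vectors described by pairs of readout maps. -/

section Readout

variable {α β β' γ δ δ' : Type} [Fintype α] [Fintype β] [DecidableEq β] [Fintype β']
  [DecidableEq β'] [Fintype γ] [DecidableEq γ] [Fintype δ] [DecidableEq δ] [Fintype δ']
  [DecidableEq δ']

/-- The coefficient matrix of a vector whose basis labels are read out by two maps. -/
def coeffMatrix (g : α → β) (h : α → δ) (v : α → ℂ) : Matrix β δ ℂ :=
  fun x c => ∑ a, if g a = x ∧ h a = c then v a else 0

/-- The partial trace keeping the label `g` and tracing out the label `h`. -/
def ptrace (g : α → β) (h : α → δ) (ρ : Matrix α α ℂ) : Matrix β β ℂ :=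
  fun x y => ∑ a, ∑ b, if g a = x ∧ g b = y ∧ h a = h b then ρ a b else 0

/-- The component of a vector on which the label `k` takes the value `c`. -/
def component (k : α → γ) (c : γ) (v : α → ℂ) : α → ℂ := fun a => if k a = c then v a else 0

/-- The entropy of the reduced state on the label `g`, the complementary label being `h`. -/
def labelEntropy (q t : ℝ) (g : α → β) (h : α → δ) (v : α → ℂ) : ℝ :=
  entropy q t (coeffMatrix g h v * (coeffMatrix g h v)ᴴ)

theorem coeffMatrix_swap (g : α → β) (h : α → δ) (v : α → ℂ) :
    coeffMatrix h g v = (coeffMatrix g h v)ᵀ := by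
  ext x c
  simp only [coeffMatrix, Matrix.transpose_apply, and_comm]

theorem coeffMatrix_zero (g : α → β) (h : α → δ) : coeffMatrix g h 0 = 0 := by
  ext x c
  simp [coeffMatrix]

theorem coeffMatrix_smul (g : α → β) (h : α → δ) (c : ℂ) (v : α → ℂ) :
    coeffMatrix g h (c • v) = c • coeffMatrix g h v := by
  ext x d
  simp [coeffMatrix, Finset.mul_sum, mul_ite]

theorem coeffMatrix_apply_mul (g : α → β) (h : α → δ) (v : α → ℂ) (x y : β) :
    (coeffMatrix g h v * (coeffMatrix g h v)ᴴ) x y =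
      ∑ a, ∑ b, if g a = x ∧ g b = y ∧ h a = h b then v a * star (v b) else 0 := by
  simp only [Matrix.mul_apply, Matrix.conjTranspose_apply, coeffMatrix, star_sum,
    Finset.sum_mul_sum]
  rw [Finset.sum_comm]
  refine Finset.sum_congr rfl fun a _ => ?_
  rw [Finset.sum_comm]
  refine Finset.sum_congr rfl fun b _ => ?_
  rw [Finset.sum_eq_single (h a)]
  · by_cases h1 : g a = x <;> by_cases h2 : g b = y <;> by_cases h3 : h b = h a <;>
      simp [h1, h2, h3, eq_comm (a := h a)]
  · intro c _ hc
    simp [hc.symm]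
  · simp

theorem ptrace_proj (g : α → β) (h : α → δ) (v : α → ℂ) :
    ptrace g h (proj v) = coeffMatrix g h v * (coeffMatrix g h v)ᴴ := by
  ext x y
  rw [coeffMatrix_apply_mul]
  rfl

/-- The columns of the coefficient matrix form an ensemble of the reduced state, indexed by the
traced-out label. The upper bounds on roofs of reduced states come from this ensemble. -/
theorem ptrace_proj_eq_sum (g : α → β) (h : α → δ) (v : α → ℂ) :
    ptrace g h (proj v) = ∑ c, proj fun x => coeffMatrix g h v x c := by
  rw [ptrace_proj]
  ext x y
  simp [Matrix.mul_apply, Matrix.sum_apply, proj, Matrix.vecMulVec_apply]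

theorem ptrace_add (g : α → β) (h : α → δ) (ρ σ : Matrix α α ℂ) :
    ptrace g h (ρ + σ) = ptrace g h ρ + ptrace g h σ := by
  ext x y
  simp only [ptrace, Matrix.add_apply, ← Finset.sum_add_distrib]
  refine Finset.sum_congr rfl fun a _ => Finset.sum_congr rfl fun b _ => ?_
  split_ifs <;> simp

/-- The partial trace as an additive map. -/
def ptraceHom (g : α → β) (h : α → δ) : Matrix α α ℂ →+ Matrix β β ℂ :=
  AddMonoidHom.mk' (ptrace g h) (ptrace_add g h)

theorem trace_ptrace (g : α → β) (h : α → δ) (hgh : ∀ a b, g a = g b → h a = h b → a = b)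
    (ρ : Matrix α α ℂ) : (ptrace g h ρ).trace = ρ.trace := by
  classical
  simp only [Matrix.trace, Matrix.diag_apply, ptrace]
  rw [Finset.sum_comm]
  refine Finset.sum_congr rfl fun a _ => ?_
  rw [Finset.sum_comm, Finset.sum_eq_single a]
  · simp
  · intro b _ hb
    refine Finset.sum_eq_zero fun x _ => if_neg ?_
    rintro ⟨h1, h2, h3⟩
    exact hb (hgh a b (h1.trans h2.symm) h3).symm
  · simp

/-- Positive matrices are sums of rank-one operators. -/
theorem exists_eq_sum_proj {ρ : Matrix α α ℂ} (hρ : ρ.PosSemidef) :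
    ∃ (m : ℕ) (v : Fin m → α → ℂ), ρ = ∑ i, proj (v i) :=
  Matrix.posSemidef_iff_eq_sum_vecMulVec.1 hρ

theorem ptrace_posSemidef (g : α → β) (h : α → δ) {ρ : Matrix α α ℂ} (hρ : ρ.PosSemidef) :
    (ptrace g h ρ).PosSemidef := by
  obtain ⟨m, v, rfl⟩ := exists_eq_sum_proj hρ
  have : ptrace g h (∑ i, proj (v i)) = ∑ i, ptrace g h (proj (v i)) :=
    map_sum (ptraceHom g h) _ _
  rw [this]
  refine Matrix.posSemidef_sum _ fun i _ => ?_
  rw [ptrace_proj]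
  exact Matrix.posSemidef_self_mul_conjTranspose _

theorem ptrace_congr {g : α → β} {h : α → δ} {h' : α → δ'}
    (hh : ∀ a b, h a = h b ↔ h' a = h' b) : ptrace g h = ptrace g h' := by
  funext ρ x y
  simp only [ptrace, hh]

theorem ptrace_ptrace (g : α → β) (h : α → δ) (g' : β → β') (h' : β → δ') (ρ : Matrix α α ℂ) :
    ptrace g' h' (ptrace g h ρ) = ptrace (g' ∘ g) (fun a => (h a, h' (g a))) ρ := by
  ext x y
  have e : ∀ z w, ptrace g h ρ z w = ∑ p : α × α with (g p.1, g p.2) = (z, w),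
      if h p.1 = h p.2 then ρ p.1 p.2 else 0 := by
    intro z w
    rw [Finset.sum_filter, Fintype.sum_prod_type]
    simp only [ptrace, Prod.mk.injEq, ← ite_and, and_assoc]
  rw [ptrace, ptrace, ← Fintype.sum_prod_type', ← Fintype.sum_prod_type',
    ← Finset.sum_fiberwise Finset.univ fun p : α × α => (g p.1, g p.2)]
  refine Finset.sum_congr rfl fun z _ => ?_
  rw [e]
  split_ifs with hz
  · refine Finset.sum_congr rfl fun p hp => ?_
    obtain rfl : (g p.1, g p.2) = z := (Finset.mem_filter.1 hp).2
    simp only [Function.comp_apply, Prod.mk.injEq, hz, and_true, true_and]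
  · refine (Finset.sum_eq_zero fun p hp => if_neg fun hc => hz ?_).symm
    obtain rfl : (g p.1, g p.2) = z := (Finset.mem_filter.1 hp).2
    simp only [Function.comp_apply, Prod.mk.injEq] at hc
    exact ⟨hc.1, hc.2.1, hc.2.2.2⟩

theorem labelEntropy_nonneg {q t : ℝ} (hq : 1 < q) (ht : 1 ≤ t) (g : α → β) (h : α → δ)
    (v : α → ℂ) : 0 ≤ labelEntropy q t g h v :=
  entropy_nonneg hq ht (Matrix.posSemidef_self_mul_conjTranspose _)

@[simp]
theorem labelEntropy_zero (q t : ℝ) (g : α → β) (h : α → δ) : labelEntropy q t g h 0 = 0 := by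
  simp [labelEntropy, coeffMatrix_zero]

theorem labelEntropy_smul {q : ℝ} (hq : 1 < q) (t : ℝ) (g : α → β) (h : α → δ) (c : ℂ)
    (v : α → ℂ) : labelEntropy q t g h (c • v) = ‖c‖ ^ 2 * labelEntropy q t g h v := by
  rw [labelEntropy, labelEntropy, ← entropy_smul hq t
    (Matrix.posSemidef_self_mul_conjTranspose _) (by positivity), coeffMatrix_smul]
  congr 1
  rw [Matrix.conjTranspose_smul, Matrix.smul_mul, Matrix.mul_smul, smul_smul, RCLike.star_def,
    Complex.mul_conj']
  push_cast
  rfl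

/-- The Schmidt decomposition in matrix form: the reduced operators on the two sides of a cut are `M
* Mᴴ` and the transpose of `Mᴴ * M`, with equal spectra up to zeros. -/
theorem labelEntropy_swap {q : ℝ} (hq : 1 < q) (t : ℝ) (g : α → β) (h : α → δ) (v : α → ℂ) :
    labelEntropy q t h g v = labelEntropy q t g h v := by
  have : (coeffMatrix g h v)ᵀ * ((coeffMatrix g h v)ᵀ)ᴴ =
      ((coeffMatrix g h v)ᴴ * coeffMatrix g h v)ᵀ := by
    rw [Matrix.transpose_mul]
    rfl
  rw [labelEntropy, labelEntropy, coeffMatrix_swap, this,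
    entropy_transpose q t (Matrix.isHermitian_conjTranspose_mul_self _),
    entropy_mul_conjTranspose_comm hq]

/-- Readouts with the same fibres are related by the partial permutation matrix `V`, which carries
one coefficient matrix to the other and whose adjoint carries it back; hence the Gram matrices on
the `h` side coincide. -/
theorem labelEntropy_congr_left {q : ℝ} (hq : 1 < q) (t : ℝ) {g : α → β} {g' : α → β'}
    (hg : ∀ a b, g a = g b ↔ g' a = g' b) (h : α → δ) (v : α → ℂ) :
    labelEntropy q t g h v = labelEntropy q t g' h v := by
  classical
  obtain ⟨V, hV⟩ : ∃ V : Matrix β β' ℂ,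
      ∀ x x', V x x' = if ∃ a, g a = x ∧ g' a = x' then 1 else 0 := ⟨fun _ _ => _, fun _ _ => rfl⟩
  have h1 : coeffMatrix g h v = V * coeffMatrix g' h v := by
    ext x c
    simp only [Matrix.mul_apply, coeffMatrix, Finset.mul_sum, hV]
    rw [Finset.sum_comm]
    refine Finset.sum_congr rfl fun b _ => ?_
    rw [Finset.sum_eq_single (g' b)]
    · have : (∃ a, g a = x ∧ g' a = g' b) ↔ g b = x :=
        ⟨fun ⟨a, ha, hab⟩ => ((hg a b).2 hab).symm.trans ha, fun hb => ⟨b, hb, rfl⟩⟩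
      by_cases hx : g b = x <;> simp [this, hx]
    · intro x' _ hx'
      simp [hx'.symm]
    · simp
  have h2 : coeffMatrix g' h v = Vᴴ * coeffMatrix g h v := by
    ext x' c
    simp only [Matrix.mul_apply, coeffMatrix, Finset.mul_sum, hV, Matrix.conjTranspose_apply]
    rw [Finset.sum_comm]
    refine Finset.sum_congr rfl fun b _ => ?_
    rw [Finset.sum_eq_single (g b)]
    · have : (∃ a, g a = g b ∧ g' a = x') ↔ g' b = x' :=
        ⟨fun ⟨a, hab, ha⟩ => ((hg a b).1 hab).symm.trans ha, fun hb => ⟨b, rfl, hb⟩⟩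
      by_cases hx : g' b = x' <;> simp [this, hx]
    · intro x _ hx
      simp [hx.symm]
    · simp
  have h3 : (coeffMatrix g h v)ᴴ * coeffMatrix g h v =
      (coeffMatrix g' h v)ᴴ * coeffMatrix g' h v := by
    calc (coeffMatrix g h v)ᴴ * coeffMatrix g h v
        = (coeffMatrix g h v)ᴴ * (V * coeffMatrix g' h v) := by rw [← h1]
      _ = (Vᴴ * coeffMatrix g h v)ᴴ * coeffMatrix g' h v := by
        rw [Matrix.conjTranspose_mul, Matrix.conjTranspose_conjTranspose, Matrix.mul_assoc]
      _ = _ := by rw [← h2]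
  rw [labelEntropy, labelEntropy, entropy_mul_conjTranspose_comm hq, h3,
    ← entropy_mul_conjTranspose_comm hq]

/-- Entropies depend only on which basis labels the two readout maps identify. -/
theorem labelEntropy_congr {q : ℝ} (hq : 1 < q) (t : ℝ) {g : α → β} {g' : α → β'}
    {h : α → δ} {h' : α → δ'} (hg : ∀ a b, g a = g b ↔ g' a = g' b)
    (hh : ∀ a b, h a = h b ↔ h' a = h' b) (v : α → ℂ) :
    labelEntropy q t g h v = labelEntropy q t g' h' v := by
  rw [labelEntropy_congr_left hq t hg, ← labelEntropy_swap hq, labelEntropy_congr_left hq t hh,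
    labelEntropy_swap hq]

theorem labelEntropy_pure {q : ℝ} (hq : 1 < q) (t : ℝ) (g : α → β) (v : α → ℂ) :
    labelEntropy q t g (fun _ => ()) v = 0 := by
  rw [labelEntropy, ← ptrace_proj, ptrace_proj_eq_sum]
  simp [entropy_proj hq]

/-- The reduced operators of the components along `k` add up to the reduced operator for which `k`
belongs to the traced-out side, so superadditivity applies. The primed form moves `k` to the kept
side by symmetry of the cut. -/
theorem sum_labelEntropy_component_le {q t : ℝ} (hq : 1 < q) (ht : 1 ≤ t) (g : α → β)
    (h : α → δ) (k : α → γ) (v : α → ℂ) :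
    ∑ c, labelEntropy q t g h (component k c v) ≤
      labelEntropy q t g (fun a => (k a, h a)) v := by
  refine (sum_entropy_le hq ht _ fun c =>
    Matrix.posSemidef_self_mul_conjTranspose _).trans_eq ?_
  rw [labelEntropy]
  congr 1
  ext x y
  simp only [Matrix.sum_apply, Matrix.mul_apply, Matrix.conjTranspose_apply,
    Fintype.sum_prod_type]
  have : ∀ c x d, coeffMatrix g h (component k c v) x d =
      coeffMatrix g (fun a => (k a, h a)) v x (c, d) := by
    intro c x d
    simp only [coeffMatrix, component, Prod.mk.injEq, ← ite_and]
    refine Finset.sum_congr rfl fun a _ => if_congr (by tauto) rfl rfl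
  simp only [this]

theorem sum_labelEntropy_component_le' {q t : ℝ} (hq : 1 < q) (ht : 1 ≤ t) (g : α → β)
    (h : α → δ) (k : α → γ) (v : α → ℂ) :
    ∑ c, labelEntropy q t g h (component k c v) ≤
      labelEntropy q t (fun a => (k a, g a)) h v := by
  simp only [← labelEntropy_swap hq t g h]
  rw [← labelEntropy_swap hq t _ h]
  exact sum_labelEntropy_component_le hq ht h g k v

theorem sum_component_congr {k : α → γ} {k' : α → δ} (hk : ∀ a b, k a = k b ↔ k' a = k' b)
    {Φ : (α → ℂ) → ℝ} (h0 : Φ 0 = 0) (v : α → ℂ) :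
    ∑ c, Φ (component k c v) = ∑ c, Φ (component k' c v) := by
  -- The sum over label values becomes a sum over basis elements weighted by inverse fibre size,
  -- which sees only the fibres of `k`; a value not attained contributes `Φ 0 = 0`.
  have aux : ∀ {ε : Type} [Fintype ε] [DecidableEq ε] (k : α → ε),
      ∑ c, Φ (component k c v) =
        ∑ a, ((Finset.univ.filter fun b => k b = k a).card : ℝ)⁻¹ *
          Φ (component k (k a) v) := by
    intro ε _ _ k
    rw [← Finset.sum_fiberwise Finset.univ k]
    refine Finset.sum_congr rfl fun c _ => ?_
    rw [Finset.sum_congr rfl (g := fun _ =>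
      ((Finset.univ.filter fun b => k b = c).card : ℝ)⁻¹ * Φ (component k c v)) (by
        intro a ha
        rw [(Finset.mem_filter.1 ha).2]), Finset.sum_const, nsmul_eq_mul]
    rcases (Finset.univ.filter fun b => k b = c).eq_empty_or_nonempty with he | hne
    · have : component k c v = 0 := by
        funext a
        have : ¬ k a = c := fun h => by
          have : a ∈ Finset.univ.filter fun b => k b = c := by simp [h]
          simp [he] at this
        simp [component, this]
      simp [this, h0]
    · have : ((Finset.univ.filter fun b => k b = c).card : ℝ) ≠ 0 := by
        exact_mod_cast hne.card_pos.ne'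
      rw [mul_inv_cancel_left₀ this]
  rw [aux k, aux k']
  refine Finset.sum_congr rfl fun a _ => ?_
  have e1 : component k (k a) v = component k' (k' a) v := by
    funext b
    simp only [component, hk]
  simp only [e1, hk]

/-- A discarded register can be divided, one piece joining each side of the cut. Coarsening needs
this: the lost parties of each block must be counted together with the rest of that block. -/
theorem sum_labelEntropy_component_split {q t : ℝ} (hq : 1 < q) (ht : 1 ≤ t) (g : α → β)
    (h : α → δ) {ε : Type} [Fintype ε] [DecidableEq ε] (k : α → ε) (k₁ : α → γ) (k₂ : α → δ')
    (hk : ∀ a b, k a = k b ↔ k₁ a = k₁ b ∧ k₂ a = k₂ b) (v : α → ℂ) :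
    ∑ c, labelEntropy q t g h (component k c v) ≤
      labelEntropy q t (fun a => (k₁ a, g a)) (fun a => (k₂ a, h a)) v := by
  rw [sum_component_congr (k' := fun a => (k₁ a, k₂ a)) (by simpa using hk)
    (Φ := fun v => labelEntropy q t g h v) (by simp), Fintype.sum_prod_type]
  have : ∀ c₁ c₂, component (fun a => (k₁ a, k₂ a)) (c₁, c₂) v =
      component k₂ c₂ (component k₁ c₁ v) := by
    intro c₁ c₂
    funext a
    simp only [component, Prod.mk.injEq, ← ite_and]
    exact if_congr and_comm rfl rfl
  simp only [this]
  exact (Finset.sum_le_sum fun c _ => sum_labelEntropy_component_le hq ht g h k₂ _).trans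
    (sum_labelEntropy_component_le' hq ht _ _ k₁ v)

theorem labelEntropy_subadditive {q t : ℝ} (hq : 1 < q) (ht : 1 ≤ t) (g₁ : α → β) (g₂ : α → γ)
    (h : α → δ) (v : α → ℂ) :
    labelEntropy q t (fun a => (g₁ a, g₂ a)) h v ≤
      labelEntropy q t g₁ (fun a => (g₂ a, h a)) v +
        labelEntropy q t g₂ (fun a => (g₁ a, h a)) v ∧
    (labelEntropy q t (fun a => (g₁ a, g₂ a)) h v =
        labelEntropy q t g₁ (fun a => (g₂ a, h a)) v +
          labelEntropy q t g₂ (fun a => (g₁ a, h a)) v →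
      labelEntropy q t g₁ (fun a => (g₂ a, h a)) v = 0 ∨
        labelEntropy q t g₂ (fun a => (g₁ a, h a)) v = 0) := by
  set M := coeffMatrix (fun a => (g₁ a, g₂ a)) h v with hM
  have e1 : coeffMatrix g₁ (fun a => (g₂ a, h a)) v *
      (coeffMatrix g₁ (fun a => (g₂ a, h a)) v)ᴴ = margFst (M * Mᴴ) := by
    ext x y
    simp only [margFst, Matrix.mul_apply, Matrix.conjTranspose_apply, hM, coeffMatrix,
      Prod.mk.injEq, Fintype.sum_prod_type, and_assoc]
  have e2 : coeffMatrix g₂ (fun a => (g₁ a, h a)) v *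
      (coeffMatrix g₂ (fun a => (g₁ a, h a)) v)ᴴ = margSnd (M * Mᴴ) := by
    ext x y
    simp only [margSnd, Matrix.mul_apply, Matrix.conjTranspose_apply, hM, coeffMatrix,
      Prod.mk.injEq, Fintype.sum_prod_type, and_assoc, and_left_comm]
  simp only [labelEntropy, e1, e2]
  exact entropy_subadditive hq ht (Matrix.posSemidef_self_mul_conjTranspose _)

end Readout

/-! ### Entropies of parties and groups of parties; the measure on vectors. -/

section Parties

variable {κ : Type} [Fintype κ] [DecidableEq κ]
  {X : κ → Type} [∀ k, Fintype (X k)] [∀ k, DecidableEq (X k)]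

/-- The entropy of the reduced state of party `k`. -/
def partyEntropy (q t : ℝ) (k : κ) (v : (∀ k, X k) → ℂ) : ℝ :=
  labelEntropy q t (fun a => a k) (fun a (i : {i // i ≠ k}) => a i) v

/-- The entropy of the reduced state of the parties in `S`. -/
def setEntropy (q t : ℝ) (S : Finset κ) (v : (∀ k, X k) → ℂ) : ℝ :=
  labelEntropy q t S.restrict Sᶜ.restrict v

theorem restrict_eq_iff (S : Finset κ) (a b : ∀ k, X k) :
    S.restrict a = S.restrict b ↔ ∀ k ∈ S, a k = b k := by
  simp [funext_iff, Finset.restrict]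

theorem labelEntropy_eq_setEntropy {q : ℝ} (hq : 1 < q) (t : ℝ) {β δ : Type} [Fintype β]
    [DecidableEq β] [Fintype δ] [DecidableEq δ] {g : (∀ k, X k) → β} {h : (∀ k, X k) → δ}
    {S : Finset κ} (hg : ∀ a b, g a = g b ↔ ∀ k ∈ S, a k = b k)
    (hh : ∀ a b, h a = h b ↔ ∀ k, k ∉ S → a k = b k) (v : (∀ k, X k) → ℂ) :
    labelEntropy q t g h v = setEntropy q t S v :=
  labelEntropy_congr hq t (by simp only [hg, restrict_eq_iff, implies_true])
    (by simp only [hh, restrict_eq_iff, Finset.mem_compl, implies_true]) v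

theorem partyEntropy_eq_setEntropy {q : ℝ} (hq : 1 < q) (t : ℝ) (k : κ)
    (v : (∀ k, X k) → ℂ) : partyEntropy q t k v = setEntropy q t {k} v :=
  labelEntropy_eq_setEntropy hq t (by simp) (by simp [funext_iff]) v

theorem partyEntropy_nonneg {q t : ℝ} (hq : 1 < q) (ht : 1 ≤ t) (k : κ)
    (v : (∀ k, X k) → ℂ) : 0 ≤ partyEntropy q t k v :=
  labelEntropy_nonneg hq ht _ _ _

theorem setEntropy_compl {q : ℝ} (hq : 1 < q) (t : ℝ) (S : Finset κ) (v : (∀ k, X k) → ℂ) :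
    setEntropy q t Sᶜ v = setEntropy q t S v := by
  rw [← labelEntropy_eq_setEntropy hq t (g := Sᶜ.restrict) (h := S.restrict) (S := Sᶜ)
    (restrict_eq_iff _) (by simp [restrict_eq_iff]), labelEntropy_swap hq]
  rfl

theorem setEntropy_univ {q : ℝ} (hq : 1 < q) (t : ℝ) (v : (∀ k, X k) → ℂ) :
    setEntropy q t Finset.univ v = 0 := by
  rw [← labelEntropy_eq_setEntropy hq t (g := id) (h := fun _ => ())
    (by simp [funext_iff]) (by simp), labelEntropy_pure hq]

theorem setEntropy_empty {q : ℝ} (hq : 1 < q) (t : ℝ) (v : (∀ k, X k) → ℂ) :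
    setEntropy q t ∅ v = 0 := by
  rw [← setEntropy_compl hq, Finset.compl_empty, setEntropy_univ hq]

theorem setEntropy_union {q t : ℝ} (hq : 1 < q) (ht : 1 ≤ t) {S T : Finset κ}
    (hST : Disjoint S T) (v : (∀ k, X k) → ℂ) :
    setEntropy q t (S ∪ T) v ≤ setEntropy q t S v + setEntropy q t T v ∧
    (setEntropy q t (S ∪ T) v = setEntropy q t S v + setEntropy q t T v →
      setEntropy q t S v = 0 ∨ setEntropy q t T v = 0) := by
  have hd : ∀ k, k ∈ S → k ∉ T := fun k hk => Finset.disjoint_left.1 hST hk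
  have key := labelEntropy_subadditive hq ht (S.restrict (π := X)) T.restrict
    ((S ∪ T)ᶜ.restrict) v
  rw [labelEntropy_eq_setEntropy hq t (S := S ∪ T), labelEntropy_eq_setEntropy hq t (S := S),
    labelEntropy_eq_setEntropy hq t (S := T)] at key
  · exact key
  all_goals
    intro a b
    simp only [Prod.mk.injEq, restrict_eq_iff, Finset.mem_union, Finset.mem_compl] <;> grind

theorem setEntropy_le_sum {q t : ℝ} (hq : 1 < q) (ht : 1 ≤ t) (S : Finset κ)
    (v : (∀ k, X k) → ℂ) : setEntropy q t S v ≤ ∑ k ∈ S, partyEntropy q t k v := by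
  induction S using Finset.induction_on with
  | empty => simp [setEntropy_empty hq]
  | insert k S hk ih =>
    rw [Finset.sum_insert hk, Finset.insert_eq]
    have := (setEntropy_union hq ht (Finset.disjoint_singleton_left.2 hk) v).1
    rw [partyEntropy_eq_setEntropy hq]
    linarith

/-- If the entropy of a group of parties is the sum of their entropies, at most one of them is in
a mixed state. -/
theorem partyEntropy_eq_zero_or {q t : ℝ} (hq : 1 < q) (ht : 1 ≤ t) {S : Finset κ}
    {v : (∀ k, X k) → ℂ} (h : setEntropy q t S v = ∑ k ∈ S, partyEntropy q t k v) {k l : κ}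
    (hk : k ∈ S) (hl : l ∈ S) (hkl : k ≠ l) :
    partyEntropy q t k v = 0 ∨ partyEntropy q t l v = 0 := by
  have hl' : l ∈ S.erase k := Finset.mem_erase.2 ⟨hkl.symm, hl⟩
  set R := (S.erase k).erase l
  have hS : S = ({k} ∪ {l}) ∪ R := by grind
  have hR : Disjoint ({k} ∪ {l}) R := by
    rw [Finset.disjoint_left]; grind
  have h1 := (setEntropy_union hq ht hR v).1
  have h2 := setEntropy_union hq ht (Finset.disjoint_singleton.2 hkl) v
  have h3 := setEntropy_le_sum hq ht R v
  rw [← Finset.add_sum_erase S _ hk, ← Finset.add_sum_erase _ _ hl'] at h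
  rw [← hS] at h1
  simp only [← partyEntropy_eq_setEntropy hq] at h2
  -- Equality for the whole group leaves no slack in the chain of subadditivity bounds, so the pair
  -- `k`, `l` is itself an equality case.
  exact h2.2 (le_antisymm h2.1 (by linarith))

/-- The homogeneous extension of `pureValue` to all vectors. -/
def vecMeasure (q s : ℝ) (v : (∀ k, X k) → ℂ) : ℝ :=
  1 / (2 * (q - 1) * s) * ∑ k, partyEntropy q (q * s) k v

theorem prefactor_pos {q s : ℝ} (hq : 1 < q) (hqs : 1 ≤ q * s) : 0 < 1 / (2 * (q - 1) * s) := by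
  have : 0 < s := pos_of_mul_pos_right (by linarith) (by linarith : (0 : ℝ) ≤ q)
  have : 0 < q - 1 := by linarith
  positivity

theorem vecMeasure_nonneg {q s : ℝ} (hq : 1 < q) (hqs : 1 ≤ q * s) (v : (∀ k, X k) → ℂ) :
    0 ≤ vecMeasure q s v :=
  mul_nonneg (prefactor_pos hq hqs).le
    (Finset.sum_nonneg fun k _ => partyEntropy_nonneg hq hqs k v)

theorem vecMeasure_smul {q : ℝ} (hq : 1 < q) (s : ℝ) (c : ℂ) (v : (∀ k, X k) → ℂ) :
    vecMeasure q s (c • v) = ‖c‖ ^ 2 * vecMeasure q s v := by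
  simp only [vecMeasure, partyEntropy, labelEntropy_smul hq, ← Finset.mul_sum]
  ring

theorem marginal_proj (v : (∀ k, X k) → ℂ) (k : κ) :
    marginal (proj v) k =
      coeffMatrix (fun a => a k) (fun a (i : {i // i ≠ k}) => a i) v *
        (coeffMatrix (fun a => a k) (fun a (i : {i // i ≠ k}) => a i) v)ᴴ := by
  rw [← ptrace_proj]
  ext x y
  simp only [marginal, ptrace]
  refine Finset.sum_congr rfl fun a _ => Finset.sum_congr rfl fun b _ => if_congr ?_ rfl rfl
  simp [funext_iff]

theorem trace_proj {α : Type} [Fintype α] (v : α → ℂ) :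
    (proj v).trace = ((∑ a, ‖v a‖ ^ 2 : ℝ) : ℂ) := by
  simp [proj, Matrix.trace, Matrix.vecMulVec_apply, Complex.mul_conj']

theorem trace_marginal_proj (v : (∀ k, X k) → ℂ) (k : κ) :
    (marginal (proj v) k).trace = ((∑ a, ‖v a‖ ^ 2 : ℝ) : ℂ) := by
  rw [marginal_proj, ← ptrace_proj, trace_ptrace, trace_proj]
  intro a b h1 h2
  funext i
  by_cases hi : i = k
  · subst hi; exact h1
  · exact congrFun h2 ⟨i, hi⟩

theorem marginal_proj_posSemidef (v : (∀ k, X k) → ℂ) (k : κ) :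
    (marginal (proj v) k).PosSemidef := by
  rw [marginal_proj]
  exact Matrix.posSemidef_self_mul_conjTranspose _

/-- Here the exponent `t = q * s` enters: `(Tr ρ^q)^s` is the Schatten norm to the power `q * s`. -/
theorem pureValue_eq {q : ℝ} (hq : 1 < q) (s : ℝ) (ψ : (∀ k, X k) → ℂ) :
    pureValue q s ψ =
      1 / (2 * (q - 1) * s) * ∑ k, (1 - schatten q (marginal (proj ψ) k) ^ (q * s)) := by
  have : ∀ k, schatten q (marginal (proj ψ) k) ^ (q * s) =
      tracePow q (marginal (proj ψ) k) ^ s := fun k => by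
    rw [schatten, ← Real.rpow_mul (tracePow_nonneg q (marginal_proj_posSemidef ψ k)),
      ← mul_assoc, one_div_mul_cancel (by linarith), one_mul]
  simp [pureValue, this, Finset.sum_sub_distrib]

theorem pureValue_eq_vecMeasure {q : ℝ} (hq : 1 < q) (s : ℝ) {ψ : (∀ k, X k) → ℂ}
    (hψ : IsUnitVector ψ) : pureValue q s ψ = vecMeasure q s ψ := by
  rw [pureValue_eq hq, vecMeasure]
  congr 1
  refine Finset.sum_congr rfl fun k _ => ?_
  rw [partyEntropy, labelEntropy, ← marginal_proj, entropy, trace_marginal_proj]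
  simp [show ∑ a, ‖ψ a‖ ^ 2 = 1 from hψ]

theorem continuous_pureValue {q s : ℝ} (hq : 1 < q) (hqs : 1 ≤ q * s) :
    Continuous (pureValue (κ := κ) (X := X) q s) := by
  have : (pureValue (κ := κ) (X := X) q s) = fun ψ =>
      1 / (2 * (q - 1) * s) * ∑ k, (1 - schatten q (marginal (proj ψ) k) ^ (q * s)) :=
    funext fun ψ => pureValue_eq hq s ψ
  rw [this]
  refine continuous_const.mul (continuous_finsetSum _ fun k _ => continuous_const.sub ?_)
  refine Continuous.rpow_const (continuous_schatten_comp hq ?_ fun ψ =>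
    marginal_proj_posSemidef ψ k) fun _ => Or.inr (by linarith)
  refine continuous_matrix fun x y => ?_
  simp only [marginal]
  refine continuous_finsetSum _ fun a _ => continuous_finsetSum _ fun b _ => ?_
  split_ifs
  · simp only [proj, Matrix.vecMulVec_apply, Pi.star_apply]
    fun_prop
  · exact continuous_const

end Parties

/-! ### Convex roofs over unnormalized decompositions. -/

section Roof

variable {α β : Type} [Fintype α] [Fintype β]

/-- The least value of `∑ f (v i)` over the decompositions `ρ = ∑ |v i⟩⟨v i|` into unnormalized
vectors. -/
def roof (f : (α → ℂ) → ℝ) (ρ : Matrix α α ℂ) : ℝ :=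
  sInf {e : ℝ | ∃ (m : ℕ) (v : Fin m → α → ℂ), ρ = ∑ i, proj (v i) ∧ e = ∑ i, f (v i)}

variable {f : (α → ℂ) → ℝ} {f' : (β → ℂ) → ℝ}

theorem roof_nonneg (hf : ∀ v, 0 ≤ f v) (ρ : Matrix α α ℂ) : 0 ≤ roof f ρ := by
  refine Real.sInf_nonneg ?_
  rintro e ⟨m, v, -, rfl⟩
  exact Finset.sum_nonneg fun i _ => hf _

theorem roof_le (hf : ∀ v, 0 ≤ f v) {ι : Type*} [Fintype ι] (v : ι → α → ℂ) :
    roof f (∑ i, proj (v i)) ≤ ∑ i, f (v i) := by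
  refine csInf_le ⟨0, ?_⟩ ⟨Fintype.card ι, v ∘ (Fintype.equivFin ι).symm, ?_, ?_⟩
  · rintro e ⟨m, v, -, rfl⟩
    exact Finset.sum_nonneg fun i _ => hf _
  · exact ((Fintype.equivFin ι).symm.sum_comp fun i => proj (v i)).symm
  · exact ((Fintype.equivFin ι).symm.sum_comp fun i => f (v i)).symm

theorem le_roof {ρ : Matrix α α ℂ} (hρ : ρ.PosSemidef) {B : ℝ}
    (h : ∀ (m : ℕ) (v : Fin m → α → ℂ), ρ = ∑ i, proj (v i) → B ≤ ∑ i, f (v i)) :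
    B ≤ roof f ρ := by
  obtain ⟨m, v, hv⟩ := exists_eq_sum_proj hρ
  refine le_csInf ⟨_, m, v, hv, rfl⟩ ?_
  rintro e ⟨m, v, hv, rfl⟩
  exact h m v hv

theorem roof_zero (hf : ∀ v, 0 ≤ f v) : roof f (0 : Matrix α α ℂ) = 0 := by
  refine le_antisymm ?_ (roof_nonneg hf 0)
  simpa using roof_le hf fun i : Empty => i.elim

theorem roof_add_le (hf : ∀ v, 0 ≤ f v) {ρ σ : Matrix α α ℂ} (hρ : ρ.PosSemidef)
    (hσ : σ.PosSemidef) : roof f (ρ + σ) ≤ roof f ρ + roof f σ := by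
  rw [← sub_le_iff_le_add]
  refine le_roof hρ fun m v hv => ?_
  rw [sub_le_comm]
  refine le_roof hσ fun l w hw => ?_
  rw [sub_le_iff_le_add']
  have := roof_le hf (Sum.elim v w)
  simpa [Fintype.sum_sum_type, ← hv, ← hw] using this

theorem roof_sum_le (hf : ∀ v, 0 ≤ f v) {ι : Type*} (s : Finset ι) {ρ : ι → Matrix α α ℂ}
    (hρ : ∀ i, (ρ i).PosSemidef) : roof f (∑ i ∈ s, ρ i) ≤ ∑ i ∈ s, roof f (ρ i) := by
  classical
  induction s using Finset.induction_on with
  | empty => simp [roof_zero hf]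
  | insert i s hi ih =>
    rw [Finset.sum_insert hi, Finset.sum_insert hi]
    exact (roof_add_le hf (hρ i) (Matrix.posSemidef_sum _ fun i _ => hρ i)).trans
      (by gcongr)

theorem proj_smul (c : ℂ) (v : α → ℂ) : proj (c • v) = ((‖c‖ ^ 2 : ℝ) : ℂ) • proj v := by
  ext a b
  have : (c * v a) * (star c * star (v b)) = (c * star c) * (v a * star (v b)) := by ring
  simp only [proj, Matrix.vecMulVec_apply, Pi.smul_apply, Pi.star_apply, smul_eq_mul, star_mul',
    Matrix.smul_apply]
  rw [this, RCLike.star_def, Complex.mul_conj']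
  push_cast
  rfl

theorem roof_smul_le (hf : ∀ v, 0 ≤ f v) (hom : ∀ (c : ℂ) v, f (c • v) = ‖c‖ ^ 2 * f v)
    {ρ : Matrix α α ℂ} (hρ : ρ.PosSemidef) {c : ℝ} (hc : 0 ≤ c) :
    roof f ((c : ℂ) • ρ) ≤ c * roof f ρ := by
  rcases hc.eq_or_lt with rfl | hc'
  · simp [roof_zero hf]
  rw [← div_le_iff₀' hc']
  refine le_roof hρ fun m v hv => ?_
  rw [div_le_iff₀' hc']
  have hs : ‖(Real.sqrt c : ℂ)‖ ^ 2 = c := by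
    rw [Complex.norm_real, Real.norm_eq_abs, sq_abs, Real.sq_sqrt hc]
  have := roof_le hf fun i => (Real.sqrt c : ℂ) • v i
  simpa only [hom, proj_smul, hs, ← Finset.smul_sum, ← Finset.mul_sum, ← hv] using this

/-- A positive additive map that does not increase `f` on vectors does not increase the roof. -/
theorem roof_map_le {ρ : Matrix α α ℂ} (hρ : ρ.PosSemidef) (hf' : ∀ v, 0 ≤ f' v)
    (T : Matrix α α ℂ →+ Matrix β β ℂ) (hT : ∀ v, (T (proj v)).PosSemidef)
    (h : ∀ v, roof f' (T (proj v)) ≤ f v) : roof f' (T ρ) ≤ roof f ρ := by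
  refine le_roof hρ fun m v hv => ?_
  rw [hv, map_sum]
  exact (roof_sum_le hf' _ fun i => hT _).trans (Finset.sum_le_sum fun i _ => h _)

theorem exists_isUnitVector [Nonempty α] : ∃ ψ : α → ℂ, IsUnitVector ψ := by
  classical
  obtain ⟨a⟩ := ‹Nonempty α›
  refine ⟨Pi.single a 1, ?_⟩
  rw [IsUnitVector, Finset.sum_eq_single a] <;> simp +contextual

theorem exists_smul_isUnitVector [Nonempty α] (v : α → ℂ) :
    ∃ (c : ℝ) (ψ : α → ℂ), 0 ≤ c ∧ IsUnitVector ψ ∧ v = (c : ℂ) • ψ := by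
  set N := ∑ a, ‖v a‖ ^ 2 with hN
  have hN0 : 0 ≤ N := Finset.sum_nonneg fun a _ => by positivity
  rcases hN0.eq_or_lt with h0 | hpos
  · obtain ⟨ψ, hψ⟩ := exists_isUnitVector (α := α)
    refine ⟨0, ψ, le_rfl, hψ, ?_⟩
    funext a
    have := (Finset.sum_eq_zero_iff_of_nonneg (fun a _ => by positivity)).1 (hN.symm.trans h0.symm)
      a (Finset.mem_univ a)
    simpa using this
  · refine ⟨Real.sqrt N, ((Real.sqrt N)⁻¹ : ℂ) • v, Real.sqrt_nonneg _, ?_, ?_⟩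
    · simp only [IsUnitVector, Pi.smul_apply, smul_eq_mul, norm_mul, mul_pow, ← Finset.mul_sum,
        ← hN]
      rw [norm_inv, Complex.norm_real, Real.norm_eq_abs, inv_pow, sq_abs, Real.sq_sqrt hN0,
        inv_mul_cancel₀ hpos.ne']
    · rw [smul_smul, mul_inv_cancel₀, one_smul]
      exact_mod_cast (Real.sqrt_pos.2 hpos).ne'

/-- A decomposition of a state into unnormalized vectors, written as an ensemble. -/
theorem exists_unit_ensemble {ρ : Matrix α α ℂ} (hρ : IsState ρ) {m : ℕ} {v : Fin m → α → ℂ}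
    (hv : ρ = ∑ i, proj (v i)) :
    ∃ (c : Fin m → ℝ) (ψ : Fin m → α → ℂ), (∀ i, 0 ≤ c i) ∧ (∀ i, IsUnitVector (ψ i)) ∧
      (∀ i, v i = (c i : ℂ) • ψ i) ∧ ∑ i, c i ^ 2 = 1 ∧
      ρ = ∑ i, ((c i ^ 2 : ℝ) : ℂ) • proj (ψ i) := by
  -- A zero vector in the decomposition receives weight `0` and an arbitrary unit vector; one exists
  -- because an operator of trace one cannot live on an empty basis.
  have hne : Nonempty α := by
    by_contra h
    have := not_nonempty_iff.1 h
    have h1 := hρ.2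
    simp [Matrix.trace] at h1
  choose c ψ hc hψ hcψ using fun i => exists_smul_isUnitVector (v i)
  have hs : ∀ i, ‖(c i : ℂ)‖ ^ 2 = c i ^ 2 := fun i => by
    rw [Complex.norm_real, Real.norm_eq_abs, sq_abs]
  refine ⟨c, ψ, hc, hψ, hcψ, ?_, ?_⟩
  · have h1 := hρ.2
    rw [hv, Matrix.trace_sum] at h1
    have : ∀ i, (proj (v i)).trace = ((c i ^ 2 : ℝ) : ℂ) := fun i => by
      rw [hcψ i, proj_smul, Matrix.trace_smul, trace_proj, hs,
        show ∑ a, ‖ψ i a‖ ^ 2 = 1 from hψ i]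
      simp
    simp only [this] at h1
    exact_mod_cast h1
  · rw [hv]
    exact Finset.sum_congr rfl fun i _ => by rw [hcψ i, proj_smul, hs]

/-- For states, ensembles of unit vectors and decompositions into unnormalized vectors give the
same roof. -/
theorem convexRoof_eq_roof {f₀ : (α → ℂ) → ℝ} (h₀ : ∀ ψ, IsUnitVector ψ → f₀ ψ = f ψ)
    (hom : ∀ (c : ℂ) v, f (c • v) = ‖c‖ ^ 2 * f v) {ρ : Matrix α α ℂ} (hρ : IsState ρ) :
    convexRoof f₀ ρ = roof f ρ := by
  unfold convexRoof roof
  congr 1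
  ext e
  constructor
  · rintro ⟨m, p, ψ, hp, -, hψ, hρe, rfl⟩
    have hs : ∀ i, ‖(Real.sqrt (p i) : ℂ)‖ ^ 2 = p i := fun i => by
      rw [Complex.norm_real, Real.norm_eq_abs, sq_abs, Real.sq_sqrt (hp i)]
    refine ⟨m, fun i => (Real.sqrt (p i) : ℂ) • ψ i, ?_, ?_⟩
    · simp only [proj_smul, hs, hρe]
    · simp only [hom, hs, h₀ _ (hψ _)]
  · rintro ⟨m, v, hv, rfl⟩
    obtain ⟨c, ψ, hc, hψ, hcψ, h1, h2⟩ := exists_unit_ensemble hρ hv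
    refine ⟨m, fun i => c i ^ 2, ψ, fun i => sq_nonneg _, h1, hψ, h2, ?_⟩
    exact Finset.sum_congr rfl fun i _ => by
      rw [h₀ _ (hψ i), hcψ i, hom, Complex.norm_real, Real.norm_eq_abs, sq_abs]

end Roof

/-! ### Existence of optimal ensembles. -/

section Attained

/-- The convex hull of a compact set in a finite-dimensional space is compact. -/
theorem isCompact_convexHull_of_finiteDimensional {E : Type} [AddCommGroup E] [Module ℝ E]
    [FiniteDimensional ℝ E] [TopologicalSpace E] [ContinuousAdd E] [ContinuousSMul ℝ E]
    {s : Set E} (hs : IsCompact s) : IsCompact (convexHull ℝ s) := by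
  let comb : ∀ k : ℕ, (Fin k → ℝ) × (Fin k → E) → E := fun k wz => ∑ i, wz.1 i • wz.2 i
  -- Carathéodory's theorem: at most `finrank + 1` points are needed, hence the range up to `finrank
  -- + 2`. The hull is then a finite union of continuous images of compact sets.
  have heq : convexHull ℝ s = ⋃ k ∈ Finset.range (Module.finrank ℝ E + 2),
      comb k '' (stdSimplex ℝ (Fin k) ×ˢ Set.pi Set.univ fun _ => s) := by
    ext x
    simp only [Set.mem_iUnion, Finset.mem_range, exists_prop]
    constructor
    · intro hx
      obtain ⟨ι, _, z, w, hz, hind, hw, hw1, hx⟩ := eq_pos_convex_span_of_mem_convexHull hx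
      let e := (Fintype.equivFin ι).symm
      refine ⟨Fintype.card ι, ?_, (w ∘ e, z ∘ e), ⟨⟨fun i => (hw _).le, ?_⟩, fun i _ => ?_⟩, ?_⟩
      · have := hind.card_le_finrank_succ
        have h2 := Submodule.finrank_le (vectorSpan ℝ (Set.range z))
        omega
      · simpa using (e.sum_comp w).trans hw1
      · exact hz ⟨_, rfl⟩
      · exact (e.sum_comp fun i => w i • z i).trans hx
    · rintro ⟨k, -, ⟨w, z⟩, ⟨hw, hz⟩, rfl⟩
      exact mem_convexHull_of_exists_fintype w z hw.1 hw.2 (fun i => hz i trivial) rfl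
  rw [heq]
  refine Finset.isCompact_biUnion _ fun k _ => ?_
  refine ((isCompact_stdSimplex ℝ (Fin k)).prod (isCompact_univ_pi fun _ => hs)).image ?_
  simp only [comb]
  fun_prop

variable {α : Type} [Fintype α] {f : (α → ℂ) → ℝ}

theorem isCompact_isUnitVector : IsCompact {ψ : α → ℂ | IsUnitVector ψ} := by
  refine Metric.isCompact_of_isClosed_isBounded ?_ ?_
  · simp only [IsUnitVector]
    exact isClosed_eq (by fun_prop) continuous_const
  · refine (Metric.isBounded_closedBall (x := (0 : α → ℂ)) (r := 1)).subset fun ψ hψ => ?_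
    rw [mem_closedBall_zero_iff, pi_norm_le_iff_of_nonneg zero_le_one]
    intro a
    have : ‖ψ a‖ ^ 2 ≤ ∑ a, ‖ψ a‖ ^ 2 :=
      Finset.single_le_sum (f := fun a => ‖ψ a‖ ^ 2) (fun a _ => by positivity)
        (Finset.mem_univ a)
    rw [show ∑ a, ‖ψ a‖ ^ 2 = 1 from hψ] at this
    exact (sq_le_one_iff₀ (norm_nonneg _)).1 this

/-- The minimum in the convex roof of a continuous function is attained. -/
theorem exists_convexRoof_eq (hf : Continuous f) {ρ : Matrix α α ℂ} (hρ : IsState ρ) :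
    ∃ (m : ℕ) (p : Fin m → ℝ) (ψ : Fin m → α → ℂ), (∀ i, 0 ≤ p i) ∧ ∑ i, p i = 1 ∧
      (∀ i, IsUnitVector (ψ i)) ∧ ρ = ∑ i, (p i : ℂ) • proj (ψ i) ∧
      convexRoof f ρ = ∑ i, p i * f (ψ i) := by
  -- In the convex hull of the pairs `(proj ψ, f ψ)`, the points above `ρ` are exactly the averages
  -- of `f` over ensembles of `ρ`. This slice is compact, so its least value is attained.
  set S : Set (Matrix α α ℂ × ℝ) := (fun ψ => (proj ψ, f ψ)) '' {ψ | IsUnitVector ψ} with hS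
  have hcont : Continuous fun ψ : α → ℂ => (proj ψ, f ψ) := by
    refine Continuous.prodMk (continuous_matrix fun x y => ?_) hf
    simp only [proj, Matrix.vecMulVec_apply, Pi.star_apply]
    fun_prop
  have hC : IsCompact (convexHull ℝ S) :=
    isCompact_convexHull_of_finiteDimensional (isCompact_isUnitVector.image hcont)
  have hD : IsCompact (Prod.snd '' (convexHull ℝ S ∩ Prod.fst ⁻¹' {ρ})) :=
    (hC.inter_right (isClosed_singleton.preimage continuous_fst)).image continuous_snd
  have hset : {e : ℝ | ∃ (m : ℕ) (p : Fin m → ℝ) (ψ : Fin m → α → ℂ),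
      (∀ i, 0 ≤ p i) ∧ ∑ i, p i = 1 ∧ (∀ i, IsUnitVector (ψ i)) ∧
      ρ = ∑ i, (p i : ℂ) • proj (ψ i) ∧ e = ∑ i, p i * f (ψ i)} =
      Prod.snd '' (convexHull ℝ S ∩ Prod.fst ⁻¹' {ρ}) := by
    have hsum : ∀ {ι : Type} [Fintype ι] (p : ι → ℝ) (ψ : ι → α → ℂ),
        ∑ i, p i • (proj (ψ i), f (ψ i)) =
          (∑ i, (p i : ℂ) • proj (ψ i), ∑ i, p i * f (ψ i)) := by
      intro ι _ p ψ
      refine Prod.ext ?_ ?_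
      · simp [Prod.fst_sum]
      · simp [Prod.snd_sum]
    ext e
    constructor
    · rintro ⟨m, p, ψ, hp, hp1, hψ, hρe, rfl⟩
      exact ⟨(ρ, ∑ i, p i * f (ψ i)), ⟨mem_convexHull_of_exists_fintype p _ hp hp1
        (fun i => ⟨ψ i, hψ i, rfl⟩) ((hsum p ψ).trans (by rw [← hρe])), rfl⟩, rfl⟩
    · rintro ⟨⟨σ, e⟩, ⟨hmem, rfl⟩, rfl⟩
      obtain ⟨ι, _, p, z, hp, hp1, hz, hsumz⟩ := mem_convexHull_iff_exists_fintype.1 hmem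
      choose ψ hψ hψz using hz
      simp only [← hψz] at hsumz
      rw [hsum] at hsumz
      obtain ⟨h1, h2⟩ := Prod.mk.inj hsumz
      let e' := (Fintype.equivFin ι).symm
      exact ⟨Fintype.card ι, p ∘ e', ψ ∘ e', fun i => hp _, (e'.sum_comp p).trans hp1,
        fun i => hψ _, h1.symm.trans (e'.sum_comp fun i => (p i : ℂ) • proj (ψ i)).symm,
        h2.symm.trans (e'.sum_comp fun i => p i * f (ψ i)).symm⟩
  have hne : (Prod.snd '' (convexHull ℝ S ∩ Prod.fst ⁻¹' {ρ})).Nonempty := by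
    rw [← hset]
    obtain ⟨m, v, hv⟩ := exists_eq_sum_proj hρ.1
    obtain ⟨c, ψ, -, hψ, -, h1, h2⟩ := exists_unit_ensemble hρ hv
    exact ⟨_, m, fun i => c i ^ 2, ψ, fun i => sq_nonneg _, h1, hψ, h2, rfl⟩
  have hmem := hD.sInf_mem hne
  rw [← hset] at hmem
  exact hmem

end Attained

/-! ### Local measurements on pure and mixed states. -/

section LocalOperations

variable {κ : Type} [Fintype κ] [DecidableEq κ]
  {X Y : κ → Type} [∀ k, Fintype (X k)] [∀ k, DecidableEq (X k)]
  [∀ k, Fintype (Y k)] [∀ k, DecidableEq (Y k)]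

/-- The coefficient matrix of a vector with respect to the cut of party `k` against the rest. -/
abbrev cutMatrix (k : κ) (v : (∀ k, X k) → ℂ) : Matrix (X k) (∀ i : {i // i ≠ k}, X i) ℂ :=
  coeffMatrix (fun a => a k) (fun a (i : {i // i ≠ k}) => a i) v

theorem cutMatrix_apply (k : κ) (v : (∀ k, X k) → ℂ) (y : ∀ k, X k) :
    cutMatrix k v (y k) (fun i => y i) = v y := by
  rw [cutMatrix, coeffMatrix, Finset.sum_eq_single y]
  · simp
  · intro a _ ha
    refine if_neg fun h => ha ?_
    funext i
    by_cases hi : i = k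
    · subst hi; exact h.1
    · exact congrFun h.2 ⟨i, hi⟩
  · simp

theorem cutMatrix_ext {k : κ} {M N : Matrix (X k) (∀ i : {i // i ≠ k}, X i) ℂ}
    (h : ∀ y : ∀ k, X k, M (y k) (fun i => y i) = N (y k) (fun i => y i)) : M = N := by
  ext x c
  obtain ⟨y, hy⟩ := (Equiv.piSplitAt k X).surjective (x, c)
  obtain ⟨rfl, rfl⟩ := Prod.mk.inj hy
  exact h y

/-- Across the cut at `k` a local operation acts on rows by its own factor and on columns by all the
others, so both can be treated as Kraus operators of a bipartite matrix. -/
theorem cutMatrix_tensor_mulVec (K : ∀ k, Matrix (Y k) (X k) ℂ) (k : κ)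
    (v : (∀ k, X k) → ℂ) :
    cutMatrix k (tensor K *ᵥ v) =
      K k * cutMatrix k v * (tensor fun j : {j // j ≠ k} => K j)ᵀ := by
  refine cutMatrix_ext fun y => ?_
  rw [cutMatrix_apply, Matrix.mul_apply]
  simp only [Matrix.mul_apply, Finset.sum_mul]
  rw [Finset.sum_comm, ← Fintype.sum_prod_type', ← (Equiv.piSplitAt k X).sum_comp]
  simp only [Matrix.mulVec, dotProduct]
  refine Finset.sum_congr rfl fun a _ => ?_
  simp only [Equiv.piSplitAt_apply, cutMatrix_apply, Matrix.transpose_apply, tensor]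
  rw [Fintype.prod_eq_mul_prod_subtype_ne _ k]
  ring

/-- Seen from the unmeasured side, the outcomes have reduced operators that add up to the original
one by the completeness relation; superadditivity then bounds the sum of their entropies. -/
theorem sum_entropy_kraus_left_le {q t : ℝ} (hq : 1 < q) (ht : 1 ≤ t) {I α β : Type}
    {α' : I → Type} [Fintype I] [Fintype α] [DecidableEq α] [Fintype β] [DecidableEq β]
    [∀ i, Fintype (α' i)] [∀ i, DecidableEq (α' i)] (A : ∀ i, Matrix (α' i) α ℂ)
    (hA : ∑ i, (A i)ᴴ * A i = 1) (M : Matrix α β ℂ) :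
    ∑ i, entropy q t (A i * M * (A i * M)ᴴ) ≤ entropy q t (M * Mᴴ) := by
  simp only [entropy_mul_conjTranspose_comm hq]
  refine (sum_entropy_le hq ht _ fun i =>
    Matrix.posSemidef_conjTranspose_mul_self _).trans_eq ?_
  congr 1
  calc ∑ i, (A i * M)ᴴ * (A i * M) = Mᴴ * (∑ i, (A i)ᴴ * A i) * M := by
        simp only [Matrix.conjTranspose_mul, Matrix.mul_sum, Matrix.sum_mul, Matrix.mul_assoc]
    _ = Mᴴ * M := by rw [hA, Matrix.mul_one]

theorem sum_entropy_kraus_le {q t : ℝ} (hq : 1 < q) (ht : 1 ≤ t) {I O α β : Type}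
    {α' : I → Type} {β' : O → Type} [Fintype I] [Fintype O] [Fintype α] [DecidableEq α]
    [Fintype β] [DecidableEq β] [∀ i, Fintype (α' i)] [∀ i, DecidableEq (α' i)]
    [∀ i, Fintype (β' i)] [∀ i, DecidableEq (β' i)] (A : ∀ i, Matrix (α' i) α ℂ)
    (B : ∀ o, Matrix (β' o) β ℂ) (hA : ∑ i, (A i)ᴴ * A i = 1) (hB : ∑ o, (B o)ᴴ * B o = 1)
    (M : Matrix α β ℂ) :
    ∑ i, ∑ o, entropy q t (A i * M * (B o)ᵀ * (A i * M * (B o)ᵀ)ᴴ) ≤ entropy q t (M * Mᴴ) := by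
  refine (Finset.sum_le_sum fun i _ => ?_).trans (sum_entropy_kraus_left_le hq ht A hA M)
  refine (sum_entropy_le hq ht _ fun o =>
    Matrix.posSemidef_self_mul_conjTranspose _).trans_eq ?_
  congr 1
  have hB' : ∑ o, (B o)ᵀ * ((B o)ᵀ)ᴴ = 1 := by
    have := congrArg Matrix.transpose hB
    rw [Matrix.transpose_sum, Matrix.transpose_one] at this
    rw [← this]
    exact Finset.sum_congr rfl fun o _ => (Matrix.transpose_mul _ _).symm
  calc ∑ o, A i * M * (B o)ᵀ * (A i * M * (B o)ᵀ)ᴴ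
      = (A i * M) * (∑ o, (B o)ᵀ * ((B o)ᵀ)ᴴ) * (A i * M)ᴴ := by
        simp only [Matrix.conjTranspose_mul, Matrix.mul_sum, Matrix.sum_mul, Matrix.mul_assoc]
    _ = _ := by rw [hB', Matrix.mul_one]

theorem sum_tensor_conjTranspose_mul {R : κ → Type} [∀ k, Fintype (R k)]
    [∀ k, DecidableEq (R k)] {Y : ∀ k, R k → Type} [∀ k i, Fintype (Y k i)]
    (K : ∀ k i, Matrix (Y k i) (X k) ℂ) (hK : ∀ k, ∑ i, (K k i)ᴴ * K k i = 1) :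
    ∑ o : ∀ k, R k, (tensor fun k => K k (o k))ᴴ * tensor (fun k => K k (o k)) = 1 := by
  ext x y
  have h1 : ∀ o : ∀ k, R k,
      ((tensor fun k => K k (o k))ᴴ * tensor (fun k => K k (o k))) x y =
        ∏ k, ((K k (o k))ᴴ * K k (o k)) (x k) (y k) := by
    intro o
    simp only [Matrix.mul_apply, Finset.prod_univ_sum, Fintype.piFinset_univ,
      Matrix.conjTranspose_apply, tensor, star_prod, Finset.prod_mul_distrib]
  have h2 : ∀ k, ∑ i, ((K k i)ᴴ * K k i) (x k) (y k) = if x k = y k then 1 else 0 := by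
    intro k
    rw [← Matrix.sum_apply, hK, Matrix.one_apply]
  rw [Matrix.sum_apply]
  simp only [h1]
  have h3 := Finset.prod_univ_sum (fun k => (Finset.univ : Finset (R k)))
    (fun k i => ((K k i)ᴴ * K k i) (x k) (y k))
  rw [Fintype.piFinset_univ] at h3
  rw [← h3]
  simp only [h2, Matrix.one_apply]
  rw [Finset.prod_ite_zero]
  simp [funext_iff]

theorem sum_partyEntropy_local_le {q t : ℝ} (hq : 1 < q) (ht : 1 ≤ t) {R : κ → Type}
    [∀ k, Fintype (R k)] [∀ k, DecidableEq (R k)] {Y : ∀ k, R k → Type}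
    [∀ k i, Fintype (Y k i)] [∀ k i, DecidableEq (Y k i)]
    (K : ∀ k i, Matrix (Y k i) (X k) ℂ) (hK : ∀ k, ∑ i, (K k i)ᴴ * K k i = 1) (k : κ)
    (v : (∀ k, X k) → ℂ) :
    ∑ o : ∀ k, R k, partyEntropy q t k (tensor (fun k => K k (o k)) *ᵥ v) ≤
      partyEntropy q t k v := by
  have hle := sum_entropy_kraus_le hq ht (K k)
    (fun o : ∀ j : {j // j ≠ k}, R j => tensor fun j : {j // j ≠ k} => K j (o j)) (hK k)
    (sum_tensor_conjTranspose_mul (fun (j : {j // j ≠ k}) i => K j i) fun j => hK j)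
    (cutMatrix k v)
  rw [← Fintype.sum_prod_type', ← (Equiv.piSplitAt k R).sum_comp] at hle
  refine le_trans (Finset.sum_le_sum fun o _ => ?_) hle
  rw [partyEntropy, labelEntropy]
  exact (congrArg (fun N => entropy q t (N * Nᴴ))
    (cutMatrix_tensor_mulVec (fun k => K k (o k)) k v)).le

/-- Local measurements do not increase the measure on average. -/
theorem sum_vecMeasure_local_le {q s : ℝ} (hq : 1 < q) (hqs : 1 ≤ q * s) {R : κ → Type}
    [∀ k, Fintype (R k)] [∀ k, DecidableEq (R k)] {Y : ∀ k, R k → Type}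
    [∀ k i, Fintype (Y k i)] [∀ k i, DecidableEq (Y k i)]
    (K : ∀ k i, Matrix (Y k i) (X k) ℂ) (hK : ∀ k, ∑ i, (K k i)ᴴ * K k i = 1)
    (v : (∀ k, X k) → ℂ) :
    ∑ o : ∀ k, R k, vecMeasure q s (tensor (fun k => K k (o k)) *ᵥ v) ≤ vecMeasure q s v := by
  simp only [vecMeasure, ← Finset.mul_sum]
  rw [Finset.sum_comm]
  exact mul_le_mul_of_nonneg_left
    (Finset.sum_le_sum fun k _ => sum_partyEntropy_local_le hq hqs K hK k v)
    (prefactor_pos hq hqs).le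

theorem mul_proj_mul {α β : Type} [Fintype α] (T : Matrix β α ℂ) (v : α → ℂ) :
    T * proj v * Tᴴ = proj (T *ᵥ v) := by
  rw [proj, Matrix.mul_vecMulVec, Matrix.vecMulVec_mul, proj, ← Matrix.star_mulVec]

theorem sum_roof_local_le {q s : ℝ} (hq : 1 < q) (hqs : 1 ≤ q * s) {R : κ → Type}
    [∀ k, Fintype (R k)] [∀ k, DecidableEq (R k)] {Y : ∀ k, R k → Type}
    [∀ k i, Fintype (Y k i)] [∀ k i, DecidableEq (Y k i)]
    (K : ∀ k i, Matrix (Y k i) (X k) ℂ) (hK : ∀ k, ∑ i, (K k i)ᴴ * K k i = 1)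
    {ρ : Matrix (∀ k, X k) (∀ k, X k) ℂ} (hρ : ρ.PosSemidef) :
    ∑ o : ∀ k, R k, roof (vecMeasure q s)
        (tensor (fun k => K k (o k)) * ρ * (tensor (fun k => K k (o k)))ᴴ) ≤
      roof (vecMeasure q s) ρ := by
  refine le_roof hρ fun m v hv => ?_
  calc ∑ o : ∀ k, R k, roof (vecMeasure q s)
        (tensor (fun k => K k (o k)) * ρ * (tensor (fun k => K k (o k)))ᴴ)
      ≤ ∑ o : ∀ k, R k, ∑ i, vecMeasure q s (tensor (fun k => K k (o k)) *ᵥ v i) := by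
        refine Finset.sum_le_sum fun o _ => ?_
        rw [hv, Matrix.mul_sum, Matrix.sum_mul]
        simp only [mul_proj_mul]
        exact roof_le (vecMeasure_nonneg hq hqs) _
    _ ≤ ∑ i, vecMeasure q s (v i) := by
        rw [Finset.sum_comm]
        exact Finset.sum_le_sum fun i _ => sum_vecMeasure_local_le hq hqs K hK (v i)

end LocalOperations

/-! ### LOCC protocols, by induction on rounds. -/

section Protocols

variable {n : ℕ} {J : Type} {e : J → Fin n → ℕ}

theorem LOCC.run_posSemidef {d : Fin n → ℕ} (Λ : LOCC e d) {ρ : Op d} (hρ : ρ.PosSemidef)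
    (j : J) : (Λ.run ρ j).PosSemidef := by
  induction Λ with
  | finish i =>
    simp only [LOCC.run]
    split_ifs with h
    · subst h; exact hρ
    · exact Matrix.PosSemidef.zero
  | round r d' K hK next ih =>
    simp only [LOCC.run]
    exact Matrix.posSemidef_sum _ fun o _ => ih o (hρ.mul_mul_conjTranspose_same _)

theorem LOCC.sum_trace_run [Fintype J] {d : Fin n → ℕ} (Λ : LOCC e d) (ρ : Op d) :
    ∑ j, (Λ.run ρ j).trace = ρ.trace := by
  induction Λ with
  | finish i =>
    simp only [LOCC.run]
    rw [Finset.sum_eq_single i]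
    · simp
    · intro j _ hj
      rw [dif_neg hj.symm, Matrix.trace_zero]
    · simp
  | round r d' K hK next ih =>
    simp only [LOCC.run, Matrix.trace_sum]
    rw [Finset.sum_comm]
    simp only [ih]
    calc ∑ o : ∀ k, Fin (r k), (tensor (fun k => K k (o k)) * ρ * (tensor fun k => K k (o k))ᴴ).trace
        = ((∑ o : ∀ k, Fin (r k),
            (tensor fun k => K k (o k))ᴴ * tensor (fun k => K k (o k))) * ρ).trace := by
          rw [Finset.sum_mul, Matrix.trace_sum]
          exact Finset.sum_congr rfl fun o _ => by
            rw [Matrix.trace_mul_comm, Matrix.mul_assoc]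
      _ = ρ.trace := by rw [sum_tensor_conjTranspose_mul K hK, Matrix.one_mul]

/-- Unnormalized outputs absorb the outcome probabilities, so a round is the local measurement bound
followed by the induction hypothesis. Merging branches with one label is allowed because the roof is
subadditive. -/
theorem LOCC.sum_roof_run_le {q s : ℝ} (hq : 1 < q) (hqs : 1 ≤ q * s) [Fintype J]
    {d : Fin n → ℕ} (Λ : LOCC e d) {ρ : Op d} (hρ : ρ.PosSemidef) :
    ∑ j, roof (vecMeasure q s) (Λ.run ρ j) ≤ roof (vecMeasure q s) ρ := by
  induction Λ with
  | finish i =>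
    simp only [LOCC.run]
    rw [Finset.sum_eq_single i]
    · simp
    · intro j _ hj
      rw [dif_neg hj.symm, roof_zero (vecMeasure_nonneg hq hqs)]
    · simp
  | round r d' K hK next ih =>
    simp only [LOCC.run]
    have hpos := fun o : ∀ k, Fin (r k) =>
      hρ.mul_mul_conjTranspose_same (tensor fun k => K k (o k))
    refine (Finset.sum_le_sum fun j _ => roof_sum_le (vecMeasure_nonneg hq hqs) _
      fun o => (next o).run_posSemidef (hpos o) j).trans ?_
    rw [Finset.sum_comm]
    exact (Finset.sum_le_sum fun o _ => ih o (hpos o)).trans (sum_roof_local_le hq hqs K hK hρ)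

end Protocols

/-! ### Separable states and the entanglement monotone. -/

section Products

variable {κ : Type} [Fintype κ] [DecidableEq κ]
  {X : κ → Type} [∀ k, Fintype (X k)] [∀ k, DecidableEq (X k)]

/-- Every cut matrix of a product vector has the form `vecMulVec`, so each party is in a multiple of
a pure state. -/
theorem vecMeasure_product {q : ℝ} (hq : 1 < q) (s : ℝ) (w : ∀ k, X k → ℂ) :
    vecMeasure q s (fun x => ∏ k, w k (x k)) = 0 := by
  rw [vecMeasure, Finset.sum_eq_zero, mul_zero]
  intro k _
  set b : (∀ i : {i // i ≠ k}, X i) → ℂ := fun c => ∏ i : {i // i ≠ k}, w i (c i) with hb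
  have : cutMatrix k (fun x => ∏ k, w k (x k)) = Matrix.vecMulVec (w k) b := by
    refine cutMatrix_ext fun y => ?_
    rw [cutMatrix_apply, Matrix.vecMulVec_apply, Fintype.prod_eq_mul_prod_subtype_ne _ k]
  have hpos : (Matrix.vecMulVec (w k) b * (Matrix.vecMulVec (w k) b)ᴴ) =
      ((∑ c, ‖b c‖ ^ 2 : ℝ) : ℂ) • proj (w k) := by
    ext x y
    simp only [Matrix.mul_apply, Matrix.conjTranspose_apply, Matrix.vecMulVec_apply, proj,
      Matrix.smul_apply, smul_eq_mul, Pi.star_apply, star_mul']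
    push_cast
    rw [Finset.sum_mul]
    refine Finset.sum_congr rfl fun c _ => ?_
    rw [← Complex.mul_conj', ← RCLike.star_def]
    ring
  rw [partyEntropy, labelEntropy]
  change entropy q _ (cutMatrix k _ * (cutMatrix k _)ᴴ) = 0
  rw [this, hpos, entropy_smul hq _ (proj_posSemidef _)
    (Finset.sum_nonneg fun c _ => by positivity), entropy_proj hq, mul_zero]

theorem tensor_sum_proj {m : κ → ℕ} (w : ∀ k, Fin (m k) → X k → ℂ) :
    tensor (fun k => ∑ i, proj (w k i)) =
      ∑ o : ∀ k, Fin (m k), proj fun x => ∏ k, w k (o k) (x k) := by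
  ext x y
  simp only [tensor, Matrix.sum_apply, proj, Matrix.vecMulVec_apply, Pi.star_apply, star_prod,
    ← Finset.prod_mul_distrib, Finset.prod_univ_sum, Fintype.piFinset_univ]

theorem roof_fullySeparable {q s : ℝ} (hq : 1 < q) (hqs : 1 ≤ q * s)
    {ρ : Matrix (∀ k, X k) (∀ k, X k) ℂ} (hρ : IsFullySeparable ρ) :
    roof (vecMeasure q s) ρ = 0 := by
  have hf := vecMeasure_nonneg (X := X) hq hqs
  obtain ⟨m, p, σ, hp, -, hσ, rfl⟩ := hρ
  have key : ∀ i, (tensor (σ i)).PosSemidef ∧ roof (vecMeasure q s) (tensor (σ i)) ≤ 0 := by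
    intro i
    choose l w hw using fun k => exists_eq_sum_proj (hσ i k).1
    have : tensor (σ i) = ∑ o : ∀ k, Fin (l k), proj fun x => ∏ k, w k (o k) (x k) := by
      rw [← tensor_sum_proj]
      exact congrArg tensor (funext hw)
    rw [this]
    refine ⟨Matrix.posSemidef_sum _ fun o _ => proj_posSemidef _, (roof_le hf _).trans_eq ?_⟩
    exact Finset.sum_eq_zero fun o _ => vecMeasure_product hq s _
  refine le_antisymm ?_ (roof_nonneg hf _)
  refine (roof_sum_le hf _ fun i => (key i).1.smul (by exact_mod_cast hp i)).trans ?_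
  exact Finset.sum_nonpos fun i _ =>
    (roof_smul_le hf (vecMeasure_smul hq s) (key i).1 (hp i)).trans
      (mul_nonpos_of_nonneg_of_nonpos (hp i) (key i).2)

theorem unifiedMeasure_eq_roof {q : ℝ} (hq : 1 < q) (s : ℝ)
    {ρ : Matrix (∀ k, X k) (∀ k, X k) ℂ} (hρ : IsState ρ) :
    unifiedMeasure q s κ X ρ = roof (vecMeasure q s) ρ :=
  convexRoof_eq_roof (f₀ := pureValue q s) (f := vecMeasure q s)
    (fun _ hψ => pureValue_eq_vecMeasure hq s hψ) (vecMeasure_smul hq s) hρ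

theorem unifiedMeasure_val_eq_roof {q : ℝ} (hq : 1 < q) (s : ℝ) {n : ℕ} {d : Fin n → ℕ}
    {ρ : Op d} (hρ : IsState ρ) : (unifiedMeasure q s).val ρ = roof (vecMeasure q s) ρ :=
  unifiedMeasure_eq_roof hq s hρ

theorem unifiedMeasure_isEntanglementMonotone {q s : ℝ} (hq : 1 < q) (hqs : 1 ≤ q * s) :
    (unifiedMeasure q s).IsEntanglementMonotone where
  nonneg ρ hρ := by
    rw [unifiedMeasure_val_eq_roof hq s hρ]
    exact roof_nonneg (vecMeasure_nonneg hq hqs) ρ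
  separable ρ hρ hsep := by
    rw [unifiedMeasure_val_eq_roof hq s hρ]
    exact roof_fullySeparable hq hqs hsep
  locc Λ ρ hρ := by
    have htr := Λ.sum_trace_run ρ
    rw [Fintype.sum_unique] at htr
    have hrun : IsState (Λ.run ρ ()) := ⟨Λ.run_posSemidef hρ.1 _, htr.trans hρ.2⟩
    rw [unifiedMeasure_val_eq_roof hq s hρ, unifiedMeasure_val_eq_roof hq s hrun]
    simpa using Λ.sum_roof_run_le hq hqs hρ.1
  convex ρ σ t hρ hσ ht0 ht1 := by
    have ht1' := sub_nonneg.2 ht1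
    have h1 : ((t : ℂ) • ρ).PosSemidef := hρ.1.smul (by exact_mod_cast ht0)
    have h2 : (((1 - t : ℝ) : ℂ) • σ).PosSemidef := hσ.1.smul (by exact_mod_cast ht1')
    have hmix : IsState ((t : ℂ) • ρ + ((1 - t : ℝ) : ℂ) • σ) := by
      refine ⟨h1.add h2, ?_⟩
      rw [Matrix.trace_add, Matrix.trace_smul, Matrix.trace_smul, hρ.2, hσ.2]
      simp
    rw [unifiedMeasure_val_eq_roof hq s hρ, unifiedMeasure_val_eq_roof hq s hσ,
      unifiedMeasure_val_eq_roof hq s hmix]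
    exact (roof_add_le (vecMeasure_nonneg hq hqs) h1 h2).trans (add_le_add
      (roof_smul_le (vecMeasure_nonneg hq hqs) (vecMeasure_smul hq s) hρ.1 ht0)
      (roof_smul_le (vecMeasure_nonneg hq hqs) (vecMeasure_smul hq s) hσ.1 ht1'))
  average Λ ρ hρ := by
    rw [unifiedMeasure_val_eq_roof hq s hρ]
    refine le_trans (Finset.sum_le_sum fun j _ => ?_) (Λ.sum_roof_run_le hq hqs hρ.1)
    have hpos := Λ.run_posSemidef hρ.1 j
    have hp : 0 ≤ Λ.prob ρ j := trace_re_nonneg hpos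
    -- A label of probability zero has no normalized state, but its value is multiplied by `0`.
    rcases hp.eq_or_lt with h0 | h0
    · rw [← h0, zero_mul]
      exact roof_nonneg (vecMeasure_nonneg hq hqs) _
    · have hinv : 0 ≤ (Λ.prob ρ j)⁻¹ := inv_nonneg.2 hp
      have htr : (Λ.run ρ j).trace = (Λ.prob ρ j : ℂ) :=
        Complex.ext rfl (Complex.nonneg_iff.1 hpos.trace_nonneg).2.symm
      have hpost : IsState (Λ.post ρ j) := by
        refine ⟨hpos.smul (by exact_mod_cast hinv), ?_⟩
        rw [LOCC.post, Matrix.trace_smul, htr, smul_eq_mul, ← Complex.ofReal_mul,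
          inv_mul_cancel₀ h0.ne', Complex.ofReal_one]
      rw [unifiedMeasure_val_eq_roof hq s hpost, ← le_inv_mul_iff₀ h0]
      exact roof_smul_le (vecMeasure_nonneg hq hqs) (vecMeasure_smul hq s) hpos hinv

end Products

/-! ### Components of vectors and changes of basis labels. -/

section Relabelling

variable {α β δ ε ε' : Type} [Fintype α] [Fintype β] [DecidableEq β] [Fintype δ]
  [DecidableEq δ] [Fintype ε] [DecidableEq ε] [Fintype ε'] [DecidableEq ε']

/-- A member of the ensemble of a reduced state has the same coefficient matrices as a component of
the original vector, so its entropies can be estimated on the full space. -/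
theorem coeffMatrix_column (g : α → β) (h : α → δ) (v : α → ℂ) (c : δ) (G : β → ε)
    (H : β → ε') :
    coeffMatrix G H (fun x => coeffMatrix g h v x c) =
      coeffMatrix (G ∘ g) (H ∘ g) (component h c v) := by
  ext x d
  simp only [coeffMatrix, component, Function.comp_apply]
  rw [← Finset.sum_fiberwise Finset.univ g]
  refine Finset.sum_congr rfl fun y _ => ?_
  split_ifs with hy
  · rw [Finset.sum_filter]
    refine Finset.sum_congr rfl fun a _ => ?_
    by_cases ha : g a = y
    · simp [ha, hy]
    · simp [ha]
  · refine (Finset.sum_eq_zero fun a ha => if_neg ?_).symm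
    rwa [(Finset.mem_filter.1 ha).2]

theorem labelEntropy_comp_equiv (q t : ℝ) (e : β ≃ α) (g : β → ε) (h : β → ε') (v : α → ℂ) :
    labelEntropy q t g h (v ∘ e) = labelEntropy q t (g ∘ e.symm) (h ∘ e.symm) v := by
  have : coeffMatrix g h (v ∘ e) = coeffMatrix (g ∘ e.symm) (h ∘ e.symm) v := by
    ext x c
    simp only [coeffMatrix, Function.comp_apply]
    rw [← e.sum_comp]
    simp
  rw [labelEntropy, this, labelEntropy]

theorem roof_submatrix {f : (α → ℂ) → ℝ} {f' : (β → ℂ) → ℝ} (e : β ≃ α)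
    (hf : ∀ v, f' (v ∘ e) = f v) (ρ : Matrix α α ℂ) :
    roof f' (ρ.submatrix e e) = roof f ρ := by
  unfold roof
  congr 1
  ext x
  have hproj : ∀ v : α → ℂ, (proj v).submatrix e e = proj (v ∘ e) := fun v => rfl
  constructor
  · rintro ⟨m, w, hw, rfl⟩
    have hwe : ∀ i, (w i ∘ e.symm) ∘ e = w i := fun i => by
      funext b; simp
    refine ⟨m, fun i => w i ∘ e.symm, ?_, ?_⟩
    · have := congrArg (fun M : Matrix β β ℂ => M.submatrix e.symm e.symm) hw
      simp only [Matrix.submatrix_submatrix, Equiv.self_comp_symm, Matrix.submatrix_id_id] at this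
      rw [this]
      ext a b
      simp [Matrix.sum_apply, proj, Matrix.vecMulVec_apply]
    · simp only [← hf, hwe]
  · rintro ⟨m, v, rfl, rfl⟩
    refine ⟨m, fun i => v i ∘ e, ?_, ?_⟩
    · ext a b
      simp [Matrix.sum_apply, proj, Matrix.vecMulVec_apply]
    · simp only [hf]

end Relabelling

/-! ### Bounds for the measure of reduced states. -/

section Reductions

variable {α δ : Type} [Fintype α] [Fintype δ] [DecidableEq δ]
  {κ : Type} [Fintype κ] [DecidableEq κ]
  {X : κ → Type} [∀ k, Fintype (X k)] [∀ k, DecidableEq (X k)]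

theorem roof_ptrace_proj_le_component {q s : ℝ} (hq : 1 < q) (hqs : 1 ≤ q * s)
    (g : α → ∀ k, X k) (h : α → δ) (v : α → ℂ) :
    roof (vecMeasure q s) (ptrace g h (proj v)) ≤
      1 / (2 * (q - 1) * s) * ∑ k, ∑ c, labelEntropy q (q * s) (fun a => g a k)
        (fun a (i : {i // i ≠ k}) => g a i) (component h c v) := by
  have hk : ∀ c k, partyEntropy q (q * s) k (fun x => coeffMatrix g h v x c) =
      labelEntropy q (q * s) (fun a => g a k) (fun a (i : {i // i ≠ k}) => g a i)
        (component h c v) := fun c k => by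
    rw [partyEntropy, labelEntropy, coeffMatrix_column]
    rfl
  have hle := roof_le (f := vecMeasure q s) (vecMeasure_nonneg hq hqs)
    fun c x => coeffMatrix g h v x c
  rw [← ptrace_proj_eq_sum] at hle
  refine hle.trans_eq ?_
  simp only [vecMeasure, hk]
  rw [← Finset.mul_sum, Finset.sum_comm]

/-- The measure of a reduced state is at most the average of the measures of pure states with the
same local entropies. -/
theorem roof_ptrace_proj_le {q s : ℝ} (hq : 1 < q) (hqs : 1 ≤ q * s)
    (g : α → ∀ k, X k) (h : α → δ) (v : α → ℂ) :
    roof (vecMeasure q s) (ptrace g h (proj v)) ≤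
      1 / (2 * (q - 1) * s) * ∑ k, labelEntropy q (q * s) (fun a => g a k)
        (fun a => (h a, fun (i : {i // i ≠ k}) => g a i)) v := by
  refine (roof_ptrace_proj_le_component hq hqs g h v).trans ?_
  refine mul_le_mul_of_nonneg_left (Finset.sum_le_sum fun k _ => ?_) (prefactor_pos hq hqs).le
  exact sum_labelEntropy_component_le hq hqs _ _ h v

theorem isState_ptrace {g : α → ∀ k, X k} {h : α → δ}
    (hgh : ∀ a b, g a = g b → h a = h b → a = b) {ρ : Matrix α α ℂ} (hρ : IsState ρ) :
    IsState (ptrace g h ρ) :=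
  ⟨ptrace_posSemidef g h hρ.1, (trace_ptrace g h hgh ρ).trans hρ.2⟩

theorem ptrace_sum (g : α → ∀ k, X k) (h : α → δ) {ι : Type*} (s : Finset ι)
    (ρ : ι → Matrix α α ℂ) : ptrace g h (∑ i ∈ s, ρ i) = ∑ i ∈ s, ptrace g h (ρ i) :=
  map_sum (ptraceHom g h) _ _

theorem roof_ptrace_sum_proj_le {q s : ℝ} (hq : 1 < q) (hqs : 1 ≤ q * s)
    (g : α → ∀ k, X k) (h : α → δ) {m : ℕ} (v : Fin m → α → ℂ) :
    roof (vecMeasure q s) (ptrace g h (∑ i, proj (v i))) ≤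
      ∑ i, roof (vecMeasure q s) (ptrace g h (proj (v i))) := by
  rw [ptrace_sum]
  exact roof_sum_le (vecMeasure_nonneg hq hqs) _ fun i =>
    ptrace_posSemidef g h (proj_posSemidef _)

end Reductions

/-! ### Superadditivity, the single-party case and symmetry. -/

section Unification

variable {κ : Type} [Fintype κ] [DecidableEq κ]
  {X : κ → Type} [∀ k, Fintype (X k)] [∀ k, DecidableEq (X k)]

theorem labelEntropy_eq_partyEntropy {q : ℝ} (hq : 1 < q) (t : ℝ) {β δ : Type} [Fintype β]
    [DecidableEq β] [Fintype δ] [DecidableEq δ] {g : (∀ k, X k) → β} {h : (∀ k, X k) → δ}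
    {k : κ} (hg : ∀ a b, g a = g b ↔ a k = b k)
    (hh : ∀ a b, h a = h b ↔ ∀ i, i ≠ k → a i = b i) (v : (∀ k, X k) → ℂ) :
    labelEntropy q t g h v = partyEntropy q t k v :=
  labelEntropy_congr hq t hg (by simp [hh, funext_iff]) v

open scoped Kronecker in
theorem prodState_eq (S : Finset κ)
    (ρ : Matrix (∀ k : {k // k ∈ S}, X k) (∀ k : {k // k ∈ S}, X k) ℂ)
    (σ : Matrix (∀ k : {k // k ∉ S}, X k) (∀ k : {k // k ∉ S}, X k) ℂ) :
    prodState S ρ σ = (ρ ⊗ₖ σ).submatrix (Equiv.piEquivPiSubtypeProd (· ∈ S) X)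
      (Equiv.piEquivPiSubtypeProd (· ∈ S) X) :=
  rfl

theorem ptrace_prodState_left (S : Finset κ)
    (ρ : Matrix (∀ k : {k // k ∈ S}, X k) (∀ k : {k // k ∈ S}, X k) ℂ)
    {σ : Matrix (∀ k : {k // k ∉ S}, X k) (∀ k : {k // k ∉ S}, X k) ℂ} (hσ : σ.trace = 1) :
    ptrace (fun a (k : {k // k ∈ S}) => a k) (fun a (k : {k // k ∉ S}) => a k)
      (prodState S ρ σ) = ρ := by
  ext x y
  have h1 : ∀ z : (∀ k : {k // k ∈ S}, X k) × (∀ k : {k // k ∉ S}, X k),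
      (∑ w : (∀ k : {k // k ∈ S}, X k) × (∀ k : {k // k ∉ S}, X k),
        if z.1 = x ∧ w.1 = y ∧ z.2 = w.2 then ρ z.1 w.1 * σ z.2 w.2 else 0) =
      if z.1 = x then ρ x y * σ z.2 z.2 else 0 := by
    intro z
    rw [Finset.sum_eq_single (y, z.2)]
    · by_cases hz : z.1 = x <;> simp [hz]
    · rintro ⟨w1, w2⟩ _ hw
      refine if_neg ?_
      rintro ⟨-, h2, h3⟩
      exact hw (Prod.ext h2 h3.symm)
    · simp
  rw [ptrace, ← (Equiv.piEquivPiSubtypeProd (· ∈ S) X).symm.sum_comp]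
  simp only [← (Equiv.piEquivPiSubtypeProd (· ∈ S) X).symm.sum_comp]
  have h2 : ∀ z, (fun k : {k // k ∈ S} => (Equiv.piEquivPiSubtypeProd (· ∈ S) X).symm z k) = z.1 :=
    fun z => congrArg Prod.fst ((Equiv.piEquivPiSubtypeProd (· ∈ S) X).apply_symm_apply z)
  have h3 : ∀ z, (fun k : {k // k ∉ S} => (Equiv.piEquivPiSubtypeProd (· ∈ S) X).symm z k) = z.2 :=
    fun z => congrArg Prod.snd ((Equiv.piEquivPiSubtypeProd (· ∈ S) X).apply_symm_apply z)
  simp only [prodState, h2, h3, h1, Fintype.sum_prod_type]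
  rw [Finset.sum_comm]
  simp only [Finset.sum_ite_eq', Finset.mem_univ, if_true, ← Finset.mul_sum]
  rw [show ∑ c, σ c c = σ.trace from rfl, hσ, mul_one]

theorem ptrace_prodState_right (S : Finset κ)
    {ρ : Matrix (∀ k : {k // k ∈ S}, X k) (∀ k : {k // k ∈ S}, X k) ℂ} (hρ : ρ.trace = 1)
    (σ : Matrix (∀ k : {k // k ∉ S}, X k) (∀ k : {k // k ∉ S}, X k) ℂ) :
    ptrace (fun a (k : {k // k ∉ S}) => a k) (fun a (k : {k // k ∈ S}) => a k)
      (prodState S ρ σ) = σ := by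
  ext x y
  have h1 : ∀ z : (∀ k : {k // k ∈ S}, X k) × (∀ k : {k // k ∉ S}, X k),
      (∑ w : (∀ k : {k // k ∈ S}, X k) × (∀ k : {k // k ∉ S}, X k),
        if z.2 = x ∧ w.2 = y ∧ z.1 = w.1 then ρ z.1 w.1 * σ z.2 w.2 else 0) =
      if z.2 = x then ρ z.1 z.1 * σ x y else 0 := by
    intro z
    rw [Finset.sum_eq_single (z.1, y)]
    · by_cases hz : z.2 = x <;> simp [hz]
    · rintro ⟨w1, w2⟩ _ hw
      refine if_neg ?_
      rintro ⟨-, h2, h3⟩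
      exact hw (Prod.ext h3.symm h2)
    · simp
  rw [ptrace, ← (Equiv.piEquivPiSubtypeProd (· ∈ S) X).symm.sum_comp]
  simp only [← (Equiv.piEquivPiSubtypeProd (· ∈ S) X).symm.sum_comp]
  have h2 : ∀ z, (fun k : {k // k ∈ S} => (Equiv.piEquivPiSubtypeProd (· ∈ S) X).symm z k) = z.1 :=
    fun z => congrArg Prod.fst ((Equiv.piEquivPiSubtypeProd (· ∈ S) X).apply_symm_apply z)
  have h3 : ∀ z, (fun k : {k // k ∉ S} => (Equiv.piEquivPiSubtypeProd (· ∈ S) X).symm z k) = z.2 :=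
    fun z => congrArg Prod.snd ((Equiv.piEquivPiSubtypeProd (· ∈ S) X).apply_symm_apply z)
  simp only [prodState, h2, h3, h1, Fintype.sum_prod_type]
  simp only [Finset.sum_ite_eq', Finset.mem_univ, if_true, ← Finset.sum_mul]
  rw [show ∑ c, ρ c c = ρ.trace from rfl, hρ, one_mul]

theorem isState_prodState (S : Finset κ)
    {ρ : Matrix (∀ k : {k // k ∈ S}, X k) (∀ k : {k // k ∈ S}, X k) ℂ}
    {σ : Matrix (∀ k : {k // k ∉ S}, X k) (∀ k : {k // k ∉ S}, X k) ℂ}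
    (hρ : IsState ρ) (hσ : IsState σ) : IsState (prodState S ρ σ) := by
  refine ⟨?_, ?_⟩
  · rw [prodState_eq]
    exact (hρ.1.kronecker hσ.1).submatrix _
  · rw [← trace_ptrace (fun a (k : {k // k ∈ S}) => a k) (fun a (k : {k // k ∉ S}) => a k) ?_
      (prodState S ρ σ), ptrace_prodState_left S ρ hσ.2, hρ.2]
    intro a b h1 h2
    funext k
    by_cases hk : k ∈ S
    · exact congrFun h1 ⟨k, hk⟩
    · exact congrFun h2 ⟨k, hk⟩

/-- Partial traces of any decomposition of the product state decompose both factors. With the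
traced-out parties counted in the complement, the bounds for the two factors are the party entropies
inside and outside `S`, which together make up the measure of each vector. -/
theorem roof_prodState_ge {q s : ℝ} (hq : 1 < q) (hqs : 1 ≤ q * s) (S : Finset κ)
    {ρ : Matrix (∀ k : {k // k ∈ S}, X k) (∀ k : {k // k ∈ S}, X k) ℂ}
    {σ : Matrix (∀ k : {k // k ∉ S}, X k) (∀ k : {k // k ∉ S}, X k) ℂ}
    (hρ : IsState ρ) (hσ : IsState σ) :
    roof (vecMeasure q s) ρ + roof (vecMeasure q s) σ ≤
      roof (vecMeasure q s) (prodState S ρ σ) := by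
  refine le_roof (isState_prodState S hρ hσ).1 fun m v hv => ?_
  have h1 : roof (vecMeasure q s) ρ ≤
      ∑ i, 1 / (2 * (q - 1) * s) * ∑ k : {k // k ∈ S}, partyEntropy q (q * s) k.1 (v i) := by
    rw [← ptrace_prodState_left S ρ hσ.2, hv]
    refine (roof_ptrace_sum_proj_le hq hqs _ _ v).trans (Finset.sum_le_sum fun i _ =>
      (roof_ptrace_proj_le hq hqs _ _ (v i)).trans_eq ?_)
    congr 1
    refine Finset.sum_congr rfl fun k _ => ?_
    refine labelEntropy_eq_partyEntropy hq _ (by simp) (fun a b => ?_) (v i)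
    simp only [Prod.mk.injEq, funext_iff, Subtype.forall, ne_eq, Subtype.ext_iff]
    grind
  have h2 : roof (vecMeasure q s) σ ≤
      ∑ i, 1 / (2 * (q - 1) * s) * ∑ k : {k // k ∉ S}, partyEntropy q (q * s) k.1 (v i) := by
    rw [← ptrace_prodState_right S hρ.2 σ, hv]
    refine (roof_ptrace_sum_proj_le hq hqs _ _ v).trans (Finset.sum_le_sum fun i _ =>
      (roof_ptrace_proj_le hq hqs _ _ (v i)).trans_eq ?_)
    congr 1
    refine Finset.sum_congr rfl fun k _ => ?_
    refine labelEntropy_eq_partyEntropy hq _ (by simp) (fun a b => ?_) (v i)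
    simp only [Prod.mk.injEq, funext_iff, Subtype.forall, ne_eq, Subtype.ext_iff]
    grind
  refine (add_le_add h1 h2).trans_eq ?_
  rw [← Finset.sum_add_distrib]
  refine Finset.sum_congr rfl fun i _ => ?_
  rw [← mul_add, vecMeasure]
  congr 1
  convert Fintype.sum_subtype_add_sum_subtype (· ∈ S) fun k => partyEntropy q (q * s) k (v i)

theorem vecMeasure_of_unique [Unique κ] {q : ℝ} (hq : 1 < q) (s : ℝ) (v : (∀ k, X k) → ℂ) :
    vecMeasure q s v = 0 := by
  rw [vecMeasure, Finset.sum_eq_zero, mul_zero]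
  intro k _
  rw [partyEntropy_eq_setEntropy hq, show ({k} : Finset κ) = Finset.univ by
    ext i; simpa only [Finset.mem_singleton, Finset.mem_univ, iff_true] using
      Subsingleton.elim i k, setEntropy_univ hq]

theorem vecMeasure_permute {q : ℝ} (hq : 1 < q) (s : ℝ) (π : Equiv.Perm κ)
    (v : (∀ k, X k) → ℂ) :
    vecMeasure (X := fun k => X (π k)) q s (v ∘ Equiv.piCongrLeft X π) = vecMeasure q s v := by
  rw [vecMeasure, vecMeasure, ← Equiv.sum_comp π fun k => partyEntropy q (q * s) k v]
  congr 1
  refine Finset.sum_congr rfl fun k _ => ?_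
  rw [partyEntropy, labelEntropy_comp_equiv]
  refine labelEntropy_eq_partyEntropy hq _ (fun a b => ?_) (fun a b => ?_) v
  · simp
  · simp only [Function.comp_apply, Equiv.piCongrLeft_symm_apply, funext_iff, Subtype.forall]
    constructor
    · intro h i hi
      have := h (π.symm i) (fun h => hi (by rw [← h, π.apply_symm_apply]))
      rwa [π.apply_symm_apply] at this
    · exact fun h i hi => h _ fun h => hi (π.injective h)

end Unification

/-! ### Coarser partitions and the reduced states on them. -/

namespace SubPartition

variable {n : ℕ}

theorem mem_supp {γ : SubPartition n} {k : Fin n} : k ∈ γ.supp ↔ ∃ P ∈ γ.parts, k ∈ P := by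
  simp [supp, Finset.mem_sup]

theorem subset_supp {γ : SubPartition n} {P : Finset (Fin n)} (hP : P ∈ γ.parts) : P ⊆ γ.supp :=
  fun _ hk => mem_supp.2 ⟨P, hP, hk⟩

theorem eq_of_mem {γ : SubPartition n} {P Q : Finset (Fin n)} (hP : P ∈ γ.parts)
    (hQ : Q ∈ γ.parts) {k : Fin n} (hkP : k ∈ P) (hkQ : k ∈ Q) : P = Q := by
  by_contra h
  exact Finset.disjoint_left.1 (γ.disjoint P hP Q hQ h) hkP hkQ

/-- In a coarser partition only parties of the original subsystem occur, and those of one original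
block occur in one block only. -/
theorem CoarsensTo.supp_subset_and_meets {γ Γ : SubPartition n} (h : CoarsensTo γ Γ) :
    Γ.supp ⊆ γ.supp ∧ ∀ P ∈ γ.parts, ∀ R ∈ Γ.parts, ∀ R' ∈ Γ.parts,
      (P ∩ R).Nonempty → (P ∩ R').Nonempty → R = R' := by
  induction h with
  | refl =>
    refine ⟨subset_rfl, fun P hP R hR R' hR' ⟨k, hk⟩ ⟨l, hl⟩ => ?_⟩
    rw [Finset.mem_inter] at hk hl
    rw [← eq_of_mem hP hR hk.1 hk.2, ← eq_of_mem hP hR' hl.1 hl.2]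
  | @tail Γ Γ' _ hstep ih =>
    obtain ⟨ihs, ihm⟩ := ih
    rcases hstep with hd | ⟨hs, hc⟩ | ⟨f, hf, hparts⟩
    · exact ⟨fun k hk => by
        obtain ⟨P, hP, hkP⟩ := mem_supp.1 hk
        exact ihs (mem_supp.2 ⟨P, hd hP, hkP⟩),
        fun P hP R hR R' hR' => ihm P hP R (hd hR) R' (hd hR')⟩
    · refine ⟨hs ▸ ihs, fun P hP R hR R' hR' ⟨k, hk⟩ ⟨l, hl⟩ => ?_⟩
      rw [Finset.mem_inter] at hk hl
      obtain ⟨S, hS, hkS⟩ := mem_supp.1 (hs ▸ mem_supp.2 ⟨R, hR, hk.2⟩)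
      obtain ⟨S', hS', hlS'⟩ := mem_supp.1 (hs ▸ mem_supp.2 ⟨R', hR', hl.2⟩)
      have hSS := ihm P hP S hS S' hS' ⟨k, Finset.mem_inter.2 ⟨hk.1, hkS⟩⟩
        ⟨l, Finset.mem_inter.2 ⟨hl.1, hlS'⟩⟩
      subst hSS
      obtain ⟨Q, hQ, hSQ⟩ := hc S hS
      rw [eq_of_mem hR hQ hk.2 (hSQ hkS), eq_of_mem hR' hQ hl.2 (hSQ hlS')]
    · have hmem : ∀ R ∈ Γ'.parts, ∃ S ∈ Γ.parts, R = f S ∧ R ⊆ S := by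
        intro R hR
        rw [hparts] at hR
        obtain ⟨S, hS, rfl⟩ := Finset.mem_image.1 hR
        exact ⟨S, hS, rfl, hf S hS⟩
      refine ⟨fun k hk => ?_, fun P hP R hR R' hR' hk hl => ?_⟩
      · obtain ⟨R, hR, hkR⟩ := mem_supp.1 hk
        obtain ⟨S, hS, -, hRS⟩ := hmem R hR
        exact ihs (mem_supp.2 ⟨S, hS, hRS hkR⟩)
      · obtain ⟨S, hS, rfl, hRS⟩ := hmem R hR
        obtain ⟨S', hS', rfl, hRS'⟩ := hmem R' hR'
        rw [ihm P hP S hS S' hS' (hk.mono (Finset.inter_subset_inter_left hRS))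
          (hl.mono (Finset.inter_subset_inter_left hRS'))]

variable {d : Fin n → ℕ}

/-- Basis labels of the subsystem partitioned by `γ`. -/
abbrev Label (γ : SubPartition n) (d : Fin n → ℕ) : Type :=
  ∀ P : {P // P ∈ γ.parts}, ∀ k : {k // k ∈ P.1}, Fin (d k)

theorem exists_block {γ Γ : SubPartition n} (h : Γ.supp ⊆ γ.supp) (R : {R // R ∈ Γ.parts})
    (k : {k // k ∈ R.1}) : ∃ P : {P // P ∈ γ.parts}, k.1 ∈ P.1 := by
  obtain ⟨P, hP, hk⟩ := mem_supp.1 (h (subset_supp R.2 k.2))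
  exact ⟨⟨P, hP⟩, hk⟩

/-- The label of a smaller subsystem determined by a label of a larger one. -/
def regroup {γ Γ : SubPartition n} (h : Γ.supp ⊆ γ.supp) (x : γ.Label d) : Γ.Label d :=
  fun R k => x (exists_block h R k).choose ⟨k.1, (exists_block h R k).choose_spec⟩

/-- The coordinates, in the blocks satisfying `p`, of the parties that do not occur in `Γ`. -/
def dropped (γ Γ : SubPartition n) (p : {P // P ∈ γ.parts} → Prop) (x : γ.Label d) :
    ∀ P : {P // p P}, ∀ k : {k : {k // k ∈ P.1.1} // k.1 ∉ Γ.supp}, Fin (d k.1) :=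
  fun P k => x P.1 k.1

theorem regroup_eq_iff {γ Γ : SubPartition n} (h : Γ.supp ⊆ γ.supp) (x y : γ.Label d)
    (R : {R // R ∈ Γ.parts}) :
    regroup h x R = regroup h y R ↔
      ∀ (P : {P // P ∈ γ.parts}) (k : {k // k ∈ P.1}), k.1 ∈ R.1 → x P k = y P k := by
  constructor
  · intro hxy P k hk
    have := congrFun hxy ⟨k.1, hk⟩
    simp only [regroup] at this
    have hP : (exists_block h R ⟨k.1, hk⟩).choose = P :=
      Subtype.ext (eq_of_mem (Subtype.prop _) P.2 (exists_block h R ⟨k.1, hk⟩).choose_spec k.2)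
    have key : ∀ (Q : {P // P ∈ γ.parts}) (hQ : k.1 ∈ Q.1), Q = P →
        x Q ⟨k.1, hQ⟩ = y Q ⟨k.1, hQ⟩ → x P k = y P k := by
      rintro Q hQ rfl h
      exact h
    exact key _ _ hP this
  · intro hxy
    funext k
    exact hxy _ _ k.2

theorem dropped_eq_iff {γ Γ : SubPartition n} (p : {P // P ∈ γ.parts} → Prop)
    (x y : γ.Label d) : dropped γ Γ p x = dropped γ Γ p y ↔
      ∀ P, p P → ∀ k : {k // k ∈ P.1}, k.1 ∉ Γ.supp → x P k = y P k := by
  simp only [funext_iff, dropped, Subtype.forall]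

/-- The coordinates of the parties outside `γ`. -/
def outside (γ : SubPartition n) (a : ∀ k, Fin (d k)) : ∀ k : {k // k ∉ γ.supp}, Fin (d k) :=
  fun k => a k

theorem reduce_eq_ptrace (γ : SubPartition n) (ρ : Op d) :
    γ.reduce ρ = ptrace γ.restrict γ.outside ρ := by
  ext x y
  simp only [reduce, ptrace]
  refine Finset.sum_congr rfl fun a _ => Finset.sum_congr rfl fun b _ => if_congr ?_ rfl rfl
  simp only [outside, funext_iff, Subtype.forall]

theorem reduce_reduce {γ Γ : SubPartition n} (h : Γ.supp ⊆ γ.supp) (ρ : Op d) :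
    Γ.reduce ρ = ptrace (regroup h) (dropped γ Γ fun _ => True) (γ.reduce ρ) := by
  rw [reduce_eq_ptrace, reduce_eq_ptrace, ptrace_ptrace]
  refine congrFun (ptrace_congr fun a b => ?_) ρ
  simp only [Prod.mk.injEq, outside, funext_iff, Subtype.forall]
  constructor
  · exact fun hab => ⟨fun k hk => hab k fun hk' => hk (h hk'), fun P hP _ k _ hk' => hab k hk'⟩
  · rintro ⟨h1, h2⟩ k hk
    by_cases hkγ : k ∈ γ.supp
    · obtain ⟨P, hP, hkP⟩ := mem_supp.1 hkγ
      exact h2 P hP trivial k hkP hk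
    · exact h1 k hkγ

theorem isState_reduce (γ : SubPartition n) {ρ : Op d} (hρ : IsState ρ) :
    IsState (γ.reduce ρ) := by
  rw [reduce_eq_ptrace]
  refine isState_ptrace (fun a b h1 h2 => ?_) hρ
  funext k
  by_cases hk : k ∈ γ.supp
  · obtain ⟨P, hP, hkP⟩ := mem_supp.1 hk
    exact congrFun (congrFun h1 ⟨P, hP⟩) ⟨k, hkP⟩
  · exact congrFun h2 ⟨k, hk⟩

theorem unifiedMeasure_on_eq_roof {q : ℝ} (hq : 1 < q) (s : ℝ) (γ : SubPartition n) {ρ : Op d}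
    (hρ : IsState ρ) :
    (unifiedMeasure q s).on ρ γ = roof (vecMeasure q s) (γ.reduce ρ) :=
  unifiedMeasure_eq_roof hq s (γ.isState_reduce hρ)

variable {q s : ℝ} {γ Γ : SubPartition n}

theorem Discards.supp_subset (h : γ.Discards Γ) : Γ.supp ⊆ γ.supp := fun _ hk => by
  obtain ⟨P, hP, hkP⟩ := mem_supp.1 hk
  exact mem_supp.2 ⟨P, h hP, hkP⟩

/-- In the cut of a remaining block all discarded blocks are counted in the complement, so the
entropy is exactly that of the block in the original vector. -/
theorem roof_discard_le (hq : 1 < q) (hqs : 1 ≤ q * s) (h : γ.Discards Γ)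
    (v : γ.Label d → ℂ) :
    roof (vecMeasure q s)
        (ptrace (regroup h.supp_subset) (dropped γ Γ fun _ => True) (proj v)) ≤
      1 / (2 * (q - 1) * s) *
        ∑ P with P.1 ∈ Γ.parts, partyEntropy q (q * s) P v := by
  refine (roof_ptrace_proj_le hq hqs _ _ v).trans_eq ?_
  congr 1
  let ι : {R // R ∈ Γ.parts} → {P // P ∈ γ.parts} := fun R => ⟨R.1, h R.2⟩
  have hι : (Finset.univ.filter fun P : {P // P ∈ γ.parts} => P.1 ∈ Γ.parts) =
      Finset.univ.image ι := by
    ext P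
    simp only [Finset.mem_filter, Finset.mem_univ, true_and, Finset.mem_image]
    exact ⟨fun hP => ⟨⟨P.1, hP⟩, rfl⟩, by rintro ⟨R, rfl⟩; exact R.2⟩
  rw [hι, Finset.sum_image fun R _ R' _ hR => Subtype.ext (congrArg (fun P => P.1) hR)]
  refine Finset.sum_congr rfl fun R _ => ?_
  have hg : ∀ a b : γ.Label d,
      regroup h.supp_subset a R = regroup h.supp_subset b R ↔ a (ι R) = b (ι R) := by
    intro a b
    rw [regroup_eq_iff]
    constructor
    · intro hab
      funext k
      exact hab (ι R) k k.2
    · intro hab P k hk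
      obtain rfl : P = ι R := Subtype.ext (eq_of_mem P.2 (h R.2) k.2 hk)
      rw [hab]
  have hh : ∀ a b : γ.Label d, (dropped γ Γ (fun _ => True) a,
      fun i : {i // i ≠ R} => regroup h.supp_subset a i) =
      (dropped γ Γ (fun _ => True) b, fun i : {i // i ≠ R} => regroup h.supp_subset b i) ↔
      ∀ i, i ≠ ι R → a i = b i := by
    intro a b
    simp only [Prod.mk.injEq, dropped_eq_iff]
    constructor
    · rintro ⟨h1, h2⟩ P hP
      funext k
      by_cases hk : k.1 ∈ Γ.supp
      · obtain ⟨R', hR', hkR'⟩ := mem_supp.1 hk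
        have hR : (⟨R', hR'⟩ : {R // R ∈ Γ.parts}) ≠ R := by
          rintro rfl
          exact hP (Subtype.ext (eq_of_mem P.2 (h hR') k.2 hkR'))
        exact (regroup_eq_iff _ a b _).1 (congrFun h2 ⟨_, hR⟩) P k hkR'
      · exact h1 P trivial k hk
    · intro hab
      have hne : ∀ (P : {P // P ∈ γ.parts}) (k : {k // k ∈ P.1}), k.1 ∉ R.1 → P ≠ ι R := by
        rintro P k hk rfl
        exact hk k.2
      refine ⟨fun P _ k hk => ?_, funext fun R' => (regroup_eq_iff _ a b _).2 fun P k hk => ?_⟩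
      · rw [hab P (hne P k fun hkR => hk (subset_supp R.2 hkR))]
      · rw [hab P (hne P k fun hkR => R'.2 (Subtype.ext (eq_of_mem R'.1.2 R.2 hk hkR)))]
  have key : labelEntropy q (q * s) (fun a => regroup h.supp_subset a R)
      (fun a => (dropped γ Γ (fun _ => True) a,
        fun i : {i // i ≠ R} => regroup h.supp_subset a i)) v =
      partyEntropy q (q * s) (ι R) v := labelEntropy_eq_partyEntropy hq (q * s) hg hh v
  convert key using 2

/-- The measure of a coarser partition is bounded through any assignment of the blocks of `γ` to
the blocks of `Γ` that respects the parties occurring in `Γ`. -/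
theorem roof_coarsen_le (hq : 1 < q) (hqs : 1 ≤ q * s) (h : Γ.supp ⊆ γ.supp)
    (A : {P // P ∈ γ.parts} → {R // R ∈ Γ.parts})
    (hA : ∀ P, ∀ k ∈ P.1, k ∈ Γ.supp → k ∈ (A P).1) (v : γ.Label d → ℂ) :
    roof (vecMeasure q s) (ptrace (regroup h) (dropped γ Γ fun _ => True) (proj v)) ≤
      1 / (2 * (q - 1) * s) *
        ∑ R, setEntropy q (q * s) (Finset.univ.filter fun P => A P = R) v := by
  refine (roof_ptrace_proj_le_component hq hqs _ _ v).trans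
    (mul_le_mul_of_nonneg_left (Finset.sum_le_sum fun R _ => ?_) (prefactor_pos hq hqs).le)
  have hAeq : ∀ (P : {P // P ∈ γ.parts}) (k : {k // k ∈ P.1}) (R' : {R // R ∈ Γ.parts}),
      k.1 ∈ R'.1 → A P = R' := fun P k R' hk =>
    Subtype.ext (eq_of_mem (A P).2 R'.2 (hA P k k.2 (subset_supp R'.2 hk)) hk)
  -- The lost parties of blocks assigned to `R` join the side of `R`, the others join the
  -- complement; both sides then consist of whole blocks of `γ`.
  refine (sum_labelEntropy_component_split hq hqs _ _ _ (dropped γ Γ fun P => A P = R)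
    (dropped γ Γ fun P => A P ≠ R) (fun a b => ?_) v).trans_eq ?_
  · simp only [dropped_eq_iff]
    constructor
    · exact fun hab => ⟨fun P _ => hab P trivial, fun P _ => hab P trivial⟩
    · rintro ⟨h1, h2⟩ P -
      by_cases hP : A P = R
      · exact h1 P hP
      · exact h2 P hP
  · have hg : ∀ a b : γ.Label d, (dropped γ Γ (fun P => A P = R) a, regroup h a R) =
        (dropped γ Γ (fun P => A P = R) b, regroup h b R) ↔
        ∀ P ∈ Finset.univ.filter fun P => A P = R, a P = b P := by
      intro a b
      simp only [Prod.mk.injEq, dropped_eq_iff, regroup_eq_iff, Finset.mem_filter,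
        Finset.mem_univ, true_and]
      constructor
      · rintro ⟨h1, h2⟩ P hP
        funext k
        by_cases hk : k.1 ∈ Γ.supp
        · exact h2 P k (hP ▸ hA P k k.2 hk)
        · exact h1 P hP k hk
      · exact fun hab => ⟨fun P hP k _ => by rw [hab P hP],
          fun P k hk => by rw [hab P (hAeq P k R hk)]⟩
    have hh : ∀ a b : γ.Label d, (dropped γ Γ (fun P => A P ≠ R) a,
        fun i : {i // i ≠ R} => regroup h a i) =
        (dropped γ Γ (fun P => A P ≠ R) b, fun i : {i // i ≠ R} => regroup h b i) ↔
        ∀ P, P ∉ (Finset.univ.filter fun P => A P = R) → a P = b P := by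
      intro a b
      simp only [Prod.mk.injEq, dropped_eq_iff, Finset.mem_filter, Finset.mem_univ, true_and]
      constructor
      · rintro ⟨h1, h2⟩ P hP
        funext k
        by_cases hk : k.1 ∈ Γ.supp
        · exact (regroup_eq_iff h a b _).1 (congrFun h2 ⟨A P, hP⟩) P k (hA P k k.2 hk)
        · exact h1 P hP k hk
      · exact fun hab => ⟨fun P hP k _ => by rw [hab P hP], funext fun R' =>
          (regroup_eq_iff h a b _).2 fun P k hk => by
            rw [hab P fun hP => R'.2 ((hAeq P k _ hk).symm.trans hP)]⟩
    have key : labelEntropy q (q * s) (fun a => (dropped γ Γ (fun P => A P = R) a, regroup h a R))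
        (fun a => (dropped γ Γ (fun P => A P ≠ R) a,
          fun i : {i // i ≠ R} => regroup h a i)) v =
        setEntropy q (q * s) (Finset.univ.filter fun P => A P = R) v :=
      labelEntropy_eq_setEntropy hq (q * s) hg hh v
    convert key using 2

theorem sum_setEntropy_le (hq : 1 < q) (hqs : 1 ≤ q * s)
    (A : {P // P ∈ γ.parts} → {R // R ∈ Γ.parts}) (v : γ.Label d → ℂ) :
    1 / (2 * (q - 1) * s) *
        ∑ R, setEntropy q (q * s) (Finset.univ.filter fun P => A P = R) v ≤
      vecMeasure q s v := by
  refine mul_le_mul_of_nonneg_left ?_ (prefactor_pos hq hqs).le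
  rw [← Finset.sum_fiberwise Finset.univ A]
  exact Finset.sum_le_sum fun R _ => setEntropy_le_sum hq hqs _ v

theorem Combines.exists_assignment (h : γ.Combines Γ) :
    ∃ A : {P // P ∈ γ.parts} → {R // R ∈ Γ.parts}, ∀ P, P.1 ⊆ (A P).1 := by
  choose A hA hPA using h.2
  exact ⟨fun P => ⟨A P.1 P.2, hA _ _⟩, fun P => hPA _ _⟩

end SubPartition

/-! ### Coarsening monotonicity and the two monogamy statements. -/

open SubPartition

variable {q s : ℝ}

theorem unifiedMeasure_coarseningMonotone (hq : 1 < q) (hqs : 1 ≤ q * s) :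
    (unifiedMeasure q s).CoarseningMonotone := by
  intro n d ρ hρ γ γ' h
  rw [unifiedMeasure_on_eq_roof hq s _ hρ, unifiedMeasure_on_eq_roof hq s _ hρ,
    reduce_reduce h.supp_subset]
  refine roof_map_le (γ.isState_reduce hρ).1 (vecMeasure_nonneg hq hqs) (ptraceHom _ _)
    (fun v => ptrace_posSemidef _ _ (proj_posSemidef v)) fun v => ?_
  refine (roof_discard_le hq hqs h v).trans
    (mul_le_mul_of_nonneg_left ?_ (prefactor_pos hq hqs).le)
  exact Finset.sum_le_sum_of_subset_of_nonneg (Finset.filter_subset _ _)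
    fun P _ _ => partyEntropy_nonneg hq hqs P v

theorem unifiedMeasure_tightCoarseningMonotone (hq : 1 < q) (hqs : 1 ≤ q * s) :
    (unifiedMeasure q s).TightCoarseningMonotone := by
  intro n d ρ hρ γ γ' h
  rw [unifiedMeasure_on_eq_roof hq s _ hρ, unifiedMeasure_on_eq_roof hq s _ hρ,
    reduce_reduce h.1.subset]
  refine roof_map_le (γ.isState_reduce hρ).1 (vecMeasure_nonneg hq hqs) (ptraceHom _ _)
    (fun v => ptrace_posSemidef _ _ (proj_posSemidef v)) fun v => ?_
  obtain ⟨A, hA⟩ := h.exists_assignment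
  exact (roof_coarsen_le hq hqs _ A (fun P k hk _ => hA P hk) v).trans
    (sum_setEntropy_le hq hqs A v)

theorem unifiedMeasure_isUnified (hq : 1 < q) (hqs : 1 ≤ q * s) :
    (unifiedMeasure q s).IsUnified where
  superadditive {n d} S ρ σ hρ hσ := by
    rw [unifiedMeasure_eq_roof hq s hρ, unifiedMeasure_eq_roof hq s hσ,
      unifiedMeasure_val_eq_roof hq s (isState_prodState (X := fun k => Fin (d k)) S hρ hσ)]
    exact roof_prodState_ge (X := fun k => Fin (d k)) hq hqs S hρ hσ
  trivial_of_single ρ hρ := by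
    rw [unifiedMeasure_val_eq_roof hq s hρ]
    obtain ⟨m, v, rfl⟩ := exists_eq_sum_proj hρ.1
    refine le_antisymm ((roof_le (vecMeasure_nonneg hq hqs) v).trans_eq ?_)
      (roof_nonneg (vecMeasure_nonneg hq hqs) _)
    exact Finset.sum_eq_zero fun i _ => vecMeasure_of_unique hq s (v i)
  symmetric {n d} π ρ hρ := by
    have hstate : IsState (permute (X := fun k => Fin (d k)) π ρ) := by
      refine ⟨hρ.1.submatrix _, Eq.trans ?_ hρ.2⟩
      exact Equiv.sum_comp (Equiv.piCongrLeft (fun k => Fin (d k)) π) fun a => ρ a a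
    rw [unifiedMeasure_val_eq_roof hq s hρ,
      unifiedMeasure_val_eq_roof (d := fun k => d (π k)) hq s hstate]
    exact roof_submatrix (Equiv.piCongrLeft (fun k => Fin (d k)) π)
      (vecMeasure_permute (X := fun k => Fin (d k)) hq s π) ρ
  coarsening := unifiedMeasure_coarseningMonotone hq hqs

/-- An optimal decomposition into unnormalized vectors. -/
theorem exists_roof_eq {κ : Type} [Fintype κ] [DecidableEq κ] {X : κ → Type}
    [∀ k, Fintype (X k)] [∀ k, DecidableEq (X k)] (hq : 1 < q) (hqs : 1 ≤ q * s)
    {ρ : Matrix (∀ k, X k) (∀ k, X k) ℂ} (hρ : IsState ρ) :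
    ∃ (m : ℕ) (v : Fin m → (∀ k, X k) → ℂ), ρ = ∑ i, proj (v i) ∧
      roof (vecMeasure q s) ρ = ∑ i, vecMeasure q s (v i) := by
  obtain ⟨m, p, ψ, hp, -, hψ, hρe, he⟩ := exists_convexRoof_eq
    (continuous_pureValue (X := X) hq hqs) hρ
  have hs : ∀ i, ‖(Real.sqrt (p i) : ℂ)‖ ^ 2 = p i := fun i => by
    rw [Complex.norm_real, Real.norm_eq_abs, sq_abs, Real.sq_sqrt (hp i)]
  refine ⟨m, fun i => (Real.sqrt (p i) : ℂ) • ψ i, ?_, ?_⟩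
  · simp only [proj_smul, hs, hρe]
  · rw [← unifiedMeasure_eq_roof hq s hρ]
    refine he.trans (Finset.sum_congr rfl fun i _ => ?_)
    rw [vecMeasure_smul hq, hs, pureValue_eq_vecMeasure hq s (hψ i)]

/-- If the blocks in a mixed state meet at most one block of a coarser partition, the measure
vanishes there. -/
theorem roof_coarsen_eq_zero {n : ℕ} {d : Fin n → ℕ} {γ Γ : SubPartition n} (hq : 1 < q)
    (hqs : 1 ≤ q * s) (hΓ : γ.CoarsensTo Γ) (hne : Γ.parts.Nonempty) (v : γ.Label d → ℂ)
    (hv : ∀ P P' : {P // P ∈ γ.parts}, partyEntropy q (q * s) P v ≠ 0 →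
      partyEntropy q (q * s) P' v ≠ 0 → ∀ R ∈ Γ.parts, ∀ R' ∈ Γ.parts,
        (P.1 ∩ R).Nonempty → (P'.1 ∩ R').Nonempty → R = R') :
    roof (vecMeasure q s)
      (ptrace (regroup hΓ.supp_subset_and_meets.1) (dropped γ Γ fun _ => True) (proj v)) ≤ 0 := by
  classical
  obtain ⟨hsupp, hmeet⟩ := hΓ.supp_subset_and_meets
  -- `R₀` is the only block of `Γ` that mixed blocks can meet; if they meet none, any block of `Γ`
  -- serves.
  obtain ⟨R₀, hR₀⟩ : ∃ R₀ : {R // R ∈ Γ.parts}, ∀ P : {P // P ∈ γ.parts},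
      partyEntropy q (q * s) P v ≠ 0 → ∀ R ∈ Γ.parts, (P.1 ∩ R).Nonempty → R = R₀.1 := by
    by_cases hex : ∃ P : {P // P ∈ γ.parts}, partyEntropy q (q * s) P v ≠ 0 ∧
        ∃ R ∈ Γ.parts, (P.1 ∩ R).Nonempty
    · obtain ⟨P, hP, R, hR, hPR⟩ := hex
      exact ⟨⟨R, hR⟩, fun P' hP' R' hR' hPR' => hv P' P hP' hP R' hR' R hR hPR' hPR⟩
    · obtain ⟨R, hR⟩ := hne
      exact ⟨⟨R, hR⟩, fun P hP R' hR' hPR' => absurd ⟨P, hP, R', hR', hPR'⟩ hex⟩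
  -- A block meeting `Γ` has a forced target, and a block disjoint from `Γ` is free. Sending the
  -- free ones to `R₀` puts all mixed blocks into a single group.
  let A : {P // P ∈ γ.parts} → {R // R ∈ Γ.parts} := fun P =>
    if h : ∃ R : {R // R ∈ Γ.parts}, (P.1 ∩ R.1).Nonempty then h.choose else R₀
  have hA : ∀ P, ∀ k ∈ P.1, k ∈ Γ.supp → k ∈ (A P).1 := by
    intro P k hkP hk
    obtain ⟨R, hR, hkR⟩ := mem_supp.1 hk
    have hPR : (P.1 ∩ R).Nonempty := ⟨k, Finset.mem_inter.2 ⟨hkP, hkR⟩⟩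
    have hex : ∃ R : {R // R ∈ Γ.parts}, (P.1 ∩ R.1).Nonempty := ⟨⟨R, hR⟩, hPR⟩
    simp only [A, dif_pos hex]
    rwa [hmeet P.1 P.2 _ hex.choose.2 R hR hex.choose_spec hPR]
  have hA₀ : ∀ P, A P ≠ R₀ → partyEntropy q (q * s) P v = 0 := by
    intro P hP
    by_contra h0
    refine hP ?_
    by_cases hex : ∃ R : {R // R ∈ Γ.parts}, (P.1 ∩ R.1).Nonempty
    · simp only [A, dif_pos hex]
      exact Subtype.ext (hR₀ P h0 _ hex.choose.2 hex.choose_spec)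
    · simp only [A, dif_neg hex]
  refine (roof_coarsen_le hq hqs hsupp A hA v).trans
    (mul_nonpos_of_nonneg_of_nonpos (prefactor_pos hq hqs).le
      (Finset.sum_nonpos fun R _ => ?_))
  by_cases hR : R = R₀
  -- The group over `R₀` may contain many mixed blocks, but it has the entropy of its complement,
  -- where every block is pure.
  · rw [← setEntropy_compl hq]
    refine (setEntropy_le_sum hq hqs _ v).trans_eq (Finset.sum_eq_zero fun P hP => hA₀ P ?_)
    simpa [hR] using hP
  · refine (setEntropy_le_sum hq hqs _ v).trans_eq (Finset.sum_eq_zero fun P hP => hA₀ P ?_)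
    rw [(Finset.mem_filter.1 hP).2]
    exact hR

theorem on_eq_zero_of_decomposition {n : ℕ} {d : Fin n → ℕ} {γ Γ : SubPartition n} (hq : 1 < q)
    (hqs : 1 ≤ q * s) {ρ : Op d} (hρ : IsState ρ) (hΓ : γ.CoarsensTo Γ)
    (hne : Γ.parts.Nonempty) {m : ℕ} {v : Fin m → γ.Label d → ℂ}
    (hdec : γ.reduce ρ = ∑ i, proj (v i))
    (hv : ∀ i, ∀ P P' : {P // P ∈ γ.parts}, partyEntropy q (q * s) P (v i) ≠ 0 →
      partyEntropy q (q * s) P' (v i) ≠ 0 → ∀ R ∈ Γ.parts, ∀ R' ∈ Γ.parts,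
        (P.1 ∩ R).Nonempty → (P'.1 ∩ R').Nonempty → R = R') :
    (unifiedMeasure q s).on ρ Γ = 0 := by
  rw [unifiedMeasure_on_eq_roof hq s _ hρ]
  refine le_antisymm ?_ (roof_nonneg (vecMeasure_nonneg hq hqs) _)
  rw [reduce_reduce hΓ.supp_subset_and_meets.1, hdec]
  exact (roof_ptrace_sum_proj_le hq hqs _ _ v).trans
    (Finset.sum_nonpos fun i _ => roof_coarsen_eq_zero hq hqs hΓ hne (v i) (hv i))

theorem unifiedMeasure_completelyMonogamous (hq : 1 < q) (hqs : 1 ≤ q * s) :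
    (unifiedMeasure q s).CompletelyMonogamous := by
  refine ⟨unifiedMeasure_coarseningMonotone hq hqs, ?_⟩
  intro n d ρ hρ γ γ' h heq Γ hΓ
  obtain ⟨hcard, hcoarse, -, -, hone⟩ := hΓ
  obtain ⟨m, v, hdec, hopt⟩ := exists_roof_eq hq hqs (γ.isState_reduce hρ)
  refine on_eq_zero_of_decomposition hq hqs hρ hcoarse (Finset.card_pos.1 (by omega)) hdec ?_
  rw [unifiedMeasure_on_eq_roof hq s _ hρ, unifiedMeasure_on_eq_roof hq s _ hρ, hopt,
    reduce_reduce h.supp_subset, hdec] at heq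
  have hle := fun i => (roof_discard_le hq hqs h (v i))
  have hle' : ∀ i, 1 / (2 * (q - 1) * s) *
      ∑ P with P.1 ∈ γ'.parts, partyEntropy q (q * s) P (v i) ≤ vecMeasure q s (v i) := fun i =>
    mul_le_mul_of_nonneg_left (Finset.sum_le_sum_of_subset_of_nonneg (Finset.filter_subset _ _)
      fun P _ _ => partyEntropy_nonneg hq hqs P (v i)) (prefactor_pos hq hqs).le
  -- The totals agree and each term is bounded, so every vector of the optimal ensemble is an
  -- equality case.
  have hall := (Finset.sum_eq_sum_iff_of_le fun i _ => hle' i).1 (le_antisymm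
    (Finset.sum_le_sum fun i _ => hle' i)
    (heq.le.trans ((roof_ptrace_sum_proj_le hq hqs _ _ v).trans
      (Finset.sum_le_sum fun i _ => hle i))))
  -- Equality leaves nothing for the discarded blocks, so every mixed block survives in `γ'`.
  have hmem : ∀ i (P : {P // P ∈ γ.parts}), partyEntropy q (q * s) P (v i) ≠ 0 →
      P.1 ∈ γ'.parts := by
    intro i P hP
    by_contra hP'
    have h1 := mul_left_cancel₀ (prefactor_pos hq hqs).ne' (hall i (Finset.mem_univ i))
    rw [← Finset.sum_filter_add_sum_filter_not Finset.univ
      (fun P : {P // P ∈ γ.parts} => P.1 ∈ γ'.parts), left_eq_add] at h1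
    exact hP ((Finset.sum_eq_zero_iff_of_nonneg fun P _ => partyEntropy_nonneg hq hqs P (v i)).1 h1
      P (Finset.mem_filter.2 ⟨Finset.mem_univ _, hP'⟩))
  intro i P P' hP hP' R hR R' hR' hPR hPR'
  by_cases hPP : P = P'
  · subst hPP
    exact hcoarse.supp_subset_and_meets.2 P P.2 R hR R' hR' hPR hPR'
  · rw [Finset.inter_comm] at hPR hPR'
    -- Two different mixed blocks are different blocks of `γ'`, and what `Γ` contains of them lies
    -- in one block by the last clause of `Xi`.
    exact hone P (hmem i P hP) P' (hmem i P' hP') (fun h => hPP (Subtype.ext h)) R hR R' hR'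
      hPR hPR'

theorem unifiedMeasure_tightlyCompletelyMonogamous (hq : 1 < q) (hqs : 1 ≤ q * s) :
    (unifiedMeasure q s).TightlyCompletelyMonogamous := by
  refine ⟨unifiedMeasure_tightCoarseningMonotone hq hqs, ?_⟩
  intro n d ρ hρ γ γ' h heq Γ hΓ
  obtain ⟨hcard, hcoarse, -, -, hone⟩ := hΓ
  obtain ⟨m, v, hdec, hopt⟩ := exists_roof_eq hq hqs (γ.isState_reduce hρ)
  refine on_eq_zero_of_decomposition hq hqs hρ hcoarse (Finset.card_pos.1 (by omega)) hdec ?_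
  obtain ⟨A, hA⟩ := h.exists_assignment
  rw [unifiedMeasure_on_eq_roof hq s _ hρ, unifiedMeasure_on_eq_roof hq s _ hρ, hopt,
    reduce_reduce h.1.subset, hdec] at heq
  have hle := fun i => roof_coarsen_le hq hqs h.1.subset A (fun P k hk _ => hA P hk) (v i)
  have hall := (Finset.sum_eq_sum_iff_of_le fun i _ => sum_setEntropy_le hq hqs A (v i)).1
    (le_antisymm (Finset.sum_le_sum fun i _ => sum_setEntropy_le hq hqs A (v i))
      (heq.le.trans ((roof_ptrace_sum_proj_le hq hqs _ _ v).trans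
        (Finset.sum_le_sum fun i _ => hle i))))
  intro i P P' hP hP' R hR R' hR' hPR hPR'
  by_cases hPP : P = P'
  · subst hPP
    exact hcoarse.supp_subset_and_meets.2 P P.2 R hR R' hR' hPR hPR'
  -- Two mixed blocks combined into the same block of `γ'` would contradict the equality case of
  -- subadditivity. Otherwise their combined blocks differ, and the last clause of `Xi` applies to
  -- these.
  by_cases hAA : A P = A P'
  · exfalso
    have h1 := mul_left_cancel₀ (prefactor_pos hq hqs).ne' (hall i (Finset.mem_univ i))
    rw [← Finset.sum_fiberwise Finset.univ A] at h1
    have h2 := (Finset.sum_eq_sum_iff_of_le fun R _ => setEntropy_le_sum hq hqs _ (v i)).1 h1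
      (A P) (Finset.mem_univ _)
    rcases partyEntropy_eq_zero_or hq hqs h2 (k := P) (l := P') (by simp) (by simp [hAA]) hPP
      with h0 | h0
    · exact hP h0
    · exact hP' h0
  · rw [Finset.inter_comm] at hPR hPR'
    exact hone _ (A P).2 _ (A P').2 (fun h => hAA (Subtype.ext h)) R hR R' hR'
      (hPR.mono (Finset.inter_subset_inter_left (hA P)))
      (hPR'.mono (Finset.inter_subset_inter_left (hA P')))

end Multipartite
end

theorem theorem2 (q s : ℝ) (hq : 1 < q) (hqs : 1 ≤ q * s) :
    (Multipartite.unifiedMeasure q s).IsCompleteMonotone ∧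
      (Multipartite.unifiedMeasure q s).CompletelyMonogamous ∧
      (Multipartite.unifiedMeasure q s).TightlyCompletelyMonogamous :=
  ⟨⟨Multipartite.unifiedMeasure_isEntanglementMonotone hq hqs,
    Multipartite.unifiedMeasure_isUnified hq hqs,
    Multipartite.unifiedMeasure_tightCoarseningMonotone hq hqs⟩,
    Multipartite.unifiedMeasure_completelyMonogamous hq hqs,
    Multipartite.unifiedMeasure_tightlyCompletelyMonogamous hq hqs⟩
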